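/- Let $L>0$, $\Omega=[0,L]$, $\alpha\in(1,2)$, $\beta=\alpha/2$, and let $\lambda_n=(n\pi/L)^2$, $\varphi_n(x)=\sqrt{2/L}\,\sin(n\pi x/L)$ $(n\ge 1)$ be the Dirichlet eigensystem of $-\Delta=-\partial_x^2$ on $\Omega$. For $\gamma\in\mathbb R$ put $$D((-\Delta)^\gamma)=\Big\{\psi\in L^2(\Omega):\ \sum_{n\ge1}|\lambda_n^\gamma(\psi,\varphi_n)|^2<\infty\Big\},\qquad (-\Delta)^\gamma\psi=\sum_{n\ge1}\lambda_n^\gamma(\psi,\varphi_n)\varphi_n .$$ Write $\omega_b(t)=t^{b-1}/\Gamma(b)$, $\mathcal I^{b}w(t)=\int_0^t\omega_b(t-s)w(s)\,ds$ and $\partial_t^\beta w=\mathcal I^{1-\beta}\partial_t w$ (Caputo derivative, $0<\beta<1$). For $T>0$ and $a_0,a_1,f\in L^2(\Omega)$ consider the symmetric fractional-order reduction $$\partial_t^\beta v-u_{xx}=\omega_{2-\alpha}(t)\,a_1+t^{1-\alpha}f,\qquad v=\partial_t^\beta u,\qquad u(0)=a_0,\quad v(0)=0,\qquad u=0 \text{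 on }\partial\Omega \qquad (*)$$ of the diffusion-wave problem $\partial_t^\alpha u-u_{xx}=t^{1-\alpha}f$, $u(0)=a_0$, $\partial_t u(0)=a_1$, $u|_{\partial\Omega}=0$. A (strong) solution of $(*)$ is a pair $u,v\in W^{1,1}(0,T;L^2(\Omega))$ (continuous versions) satisfying the initial conditions and such that, for almost every $t\in(0,T)$, $u(t)\in H^2(\Omega)\cap H^1_0(\Omega)$ and the two equations hold in $L^2(\Omega)$. Let $\gamma_1\in(\frac1\alpha+\frac14,\frac32]$, $\gamma_2\in(\frac14,1]$ and $\epsilon>0$. Then there is a constant $C>0$, depending only on $\alpha,L,\gamma_1,\gamma_2,\epsilon$, such that for every $T>0$: 1. If $a_0\in D((-\Delta)^{\gamma_1+\epsilon})$ and $a_1,f\in D((-\Delta)^{\gamma_2+\epsilon})$, then $(*)$ has a solution, and for every solution $(u,v)$ one has $u(t)\in D((-\Delta)^{1/2})$ for $t\in(0,T]$, the map $t\mapsto(-\Delta)^{1/2}u(t)$ belongs to $C^3((0,T];L^2(\Omega))$, and for $m=0,1,2,3$ and $t\in(0,T]$ $$\|\partial_t^m(-\Delta)^{\frac12}u(t)\|_{L^2}\le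 C\big(1+t^{1-m-\frac\alpha4}\big)\Big(\|(-\Delta)^{\gamma_1+\epsilon}a_0\|_{L^2}+\|(-\Delta)^{\gamma_2+\epsilon}a_1\|_{L^2}+\|(-\Delta)^{\gamma_2+\epsilon}f\|_{L^2}\Big).$$ 2. If $a_0\in D((-\Delta)^{\gamma_1+\epsilon+\frac12})$ and $a_1,f\in D((-\Delta)^{\gamma_2+\epsilon+\frac12})$, then for every solution $(u,v)$ of $(*)$ one has $u(t)\in D(-\Delta)$ for $t\in(0,T]$, the map $t\mapsto(-\Delta)u(t)$ belongs to $C^3((0,T];L^2(\Omega))$, and for $m=0,1,2,3$ and $t\in(0,T]$ $$\|\partial_t^m(-\Delta)u(t)\|_{L^2}\le C\big(1+t^{1-m-\frac\alpha4}\big)\Big(\|(-\Delta)^{\gamma_1+\epsilon+\frac12}a_0\|_{L^2}+\|(-\Delta)^{\gamma_2+\epsilon+\frac12}a_1\|_{L^2}+\|(-\Delta)^{\gamma_2+\epsilon+\frac12}f\|_{L^2}\Big).$$ -/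

import Mathlib

open MeasureTheory Set

namespace DiffusionWave

noncomputable section

/-- The real Hilbert space `L²(Ω)`, `Ω = [0, L]`. -/
abbrev L2 (L : ℝ) : Type := Lp ℝ 2 (volume.restrict (Icc (0 : ℝ) L))

/-- The Dirichlet eigenvalues of `-d²/dx²` on `[0, L]`: `(k π / L)²` for `k = n + 1 ≥ 1`. -/
def eigenvalue (L : ℝ) (n : ℕ) : ℝ := (((n : ℝ) + 1) * Real.pi / L) ^ 2

/-- The normalized Dirichlet eigenfunctions `√(2/L) sin (k π x / L)`, `k = n + 1 ≥ 1`. -/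
def eigenfunction (L : ℝ) (n : ℕ) (x : ℝ) : ℝ :=
  Real.sqrt (2 / L) * Real.sin (((n : ℝ) + 1) * Real.pi / L * x)

theorem memLp_eigenfunction (L : ℝ) (n : ℕ) :
    MemLp (eigenfunction L n) 2 (volume.restrict (Icc (0 : ℝ) L)) := by
  refine MemLp.of_bound (C := Real.sqrt (2 / L)) ?_ ?_
  · have h : Continuous (eigenfunction L n) := by
      unfold eigenfunction
      fun_prop
    exact h.aestronglyMeasurable
  · refine Filter.Eventually.of_forall fun x => ?_
    unfold eigenfunction
    rw [Real.norm_eq_abs, abs_mul, abs_of_nonneg (Real.sqrt_nonneg _)]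
    exact mul_le_of_le_one_right (Real.sqrt_nonneg _) (Real.abs_sin_le_one _)

/-- The eigenfunctions as elements of `L²(Ω)`. -/
def eigenvector (L : ℝ) (n : ℕ) : L2 L := (memLp_eigenfunction L n).toLp (eigenfunction L n)

/-- The domain `D((-Δ)^γ)`. -/
def fracDomain (L γ : ℝ) : Set (L2 L) :=
  {ψ | Summable fun n : ℕ => |eigenvalue L n ^ γ * inner ℝ ψ (eigenvector L n)| ^ 2}

/-- The fractional power `(-Δ)^γ ψ = ∑ₙ λₙ^γ (ψ, φₙ) φₙ`, convergent in `L²(Ω)` for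
`ψ ∈ D((-Δ)^γ)`. -/
def fracLaplacian (L γ : ℝ) (ψ : L2 L) : L2 L :=
  ∑' n : ℕ, (eigenvalue L n ^ γ * inner ℝ ψ (eigenvector L n)) • eigenvector L n

/-- `ψ ∈ H¹(Ω)` with weak derivative `g ∈ L²(Ω)`, and `U` is its absolutely continuous
representative on `[0, L]`. -/
def HasSobolevDeriv (L : ℝ) (ψ g : L2 L) (U : ℝ → ℝ) : Prop :=
  (ψ =ᵐ[volume.restrict (Icc (0 : ℝ) L)] U) ∧
    ∀ x ∈ Icc (0 : ℝ) L, U x = U 0 + ∫ y in (0 : ℝ)..x, g y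

/-- `ψ ∈ H²(Ω) ∩ H¹₀(Ω)` and `ψ_xx = w`. -/
def HasDirichletLaplacian (L : ℝ) (ψ w : L2 L) : Prop :=
  ∃ (g : L2 L) (U V : ℝ → ℝ), HasSobolevDeriv L ψ g U ∧ HasSobolevDeriv L g w V ∧
    U 0 = 0 ∧ U L = 0

section Time

variable {E : Type*} [NormedAddCommGroup E] [NormedSpace ℝ E]

/-- The kernel `ω_b(t) = t^(b-1) / Γ(b)`. -/
def omega (b t : ℝ) : ℝ := t ^ (b - 1) / Real.Gamma b

/-- The Riemann–Liouville integral `(I^b w)(t) = ∫₀ᵗ ω_b(t-s) w(s) ds`. -/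
def fracIntegral (b : ℝ) (w : ℝ → E) (t : ℝ) : E := ∫ s in (0 : ℝ)..t, omega b (t - s) • w s

/-- `u ∈ W^{1,1}(0, T; E)`, in its (absolutely) continuous version, and `∂ₜu = du`. -/
def HasTimeDeriv (T : ℝ) (u du : ℝ → E) : Prop :=
  IntegrableOn du (Ioc 0 T) ∧ ∀ t ∈ Icc (0 : ℝ) T, u t = u 0 + ∫ s in (0 : ℝ)..t, du s

end Time

/-- `(u, v)` is a strong solution on `[0, L] × (0, T)` of the symmetric fractional-order reduction,
with `β = α / 2`,
`∂ₜ^β v - u_xx = ω_{2-α}(t) a₁ + t^{1-α} f`, `v = ∂ₜ^β u`, `u(0) = a₀`, `v(0) = 0`, `u = 0` on `∂Ω`,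
of the problem `∂ₜ^α u - u_xx = t^{1-α} f`, `u(0) = a₀`, `∂ₜu(0) = a₁`.
The Caputo derivative of order `β ∈ (0, 1)` is `∂ₜ^β u = I^{1-β} ∂ₜu`. The homogeneous boundary
condition of `u` is part of `u(t) ∈ H²(Ω) ∩ H¹₀(Ω)`; that of `v = ∂ₜ^β u` is not imposed
separately. -/
def IsSolution (α L T : ℝ) (a₀ a₁ f : L2 L) (u v : ℝ → L2 L) : Prop :=
  ∃ du dv : ℝ → L2 L,
    HasTimeDeriv T u du ∧ HasTimeDeriv T v dv ∧ u 0 = a₀ ∧ v 0 = 0 ∧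
      ∀ᵐ t ∂(volume.restrict (Ioo (0 : ℝ) T)),
        v t = fracIntegral (1 - α / 2) du t ∧
          ∃ w : L2 L, HasDirichletLaplacian L (u t) w ∧
            fracIntegral (1 - α / 2) dv t - w = omega (2 - α) t • a₁ + t ^ (1 - α) • f

/-- On `(0, T]`, `u(t) ∈ D((-Δ)^σ)`, `t ↦ (-Δ)^σ u(t)` is three times continuously differentiable
with values in `L²(Ω)`, and
`‖∂ₜ^m (-Δ)^σ u(t)‖ ≤ K (1 + t^{1 - m - α/4})` for `m = 0, 1, 2, 3`. -/
def HasTimeBounds (α L T σ K : ℝ) (u : ℝ → L2 L) : Prop :=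
  (∀ t ∈ Ioc (0 : ℝ) T, u t ∈ fracDomain L σ) ∧
    ContDiffOn ℝ 3 (fun t => fracLaplacian L σ (u t)) (Ioc 0 T) ∧
    ∀ m : ℕ, m ≤ 3 → ∀ t ∈ Ioc (0 : ℝ) T,
      ‖iteratedDerivWithin m (fun t => fracLaplacian L σ (u t)) (Ioc 0 T) t‖ ≤
        K * (1 + t ^ (1 - (m : ℝ) - α / 4))

end

end DiffusionWave

open DiffusionWave

namespace DiffusionWave

open Filter Topology

/-! In the sine basis the system decouples. With `b` the n-th coefficient of a₁ + Γ(2-α) f and c =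
λₙ, the n-th mode of u is a E_α(-c t^α) + b t E_{α,2}(-c t^α), so everything reduces to scalar
estimates uniform in c.

The Mittag-Leffler functions are produced by inverting their Laplace transforms: `rayTransform α q`
is a Hankel integral for p^q / (1 + p^α), taken on a ray where exp(ts) decays and 1 + s^α stays away
from zero. Since |1 + s^α| dominates |s|^κ there for every κ in [0, α], one gets |rayTransform α q
t| ≤ C t^(κ-q-1) (`abs_rayTransform_le`), and differentiation in t raises q by one. A contour
argument (`im_integral_symbolDensity_div`) and Fubini identify the Laplace transform
(`laplace_rayTransform`). Lerch's theorem then turns algebraic identities between symbols into the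
fractional differential equations of the modes.

Rescaling time by c^(1/α) turns the bound t^(1-m-α/4) for the unit frequency into a factor c^(-1/4)
for the data a₁, f and c^(1/α-1/4) for a₀ when m ≥ 1; for m = 0 the a₀ part is simply bounded. These
powers are compensated exactly when σ - γ' < 1/4 and σ - γ < 1/4 - 1/α, which are the thresholds on
γ₂ and γ₁ (`hasTimeBounds_of_isSolution`). Uniform multiplier bounds allow termwise differentiation
of the series.

The estimate holds for every solution because the coefficients are forced: the difference of two
scalar solutions satisfies h = -c I^α h, and Grönwall's inequality gives h = 0
(`primitive_eq_zero_of_homogeneous`, `IsSolution.coef_eq`). Existence comes from summing the modes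
of u' and v', which are integrable at t = 0, and checking the equations coefficientwise
(`exists_isSolution`). -/

/-! ### Hankel-type integrals on a ray -/

theorem integrable_exp_neg_mul_exp {a κ : ℝ} (ha : 0 < a) (hκ : 0 < κ) :
    Integrable (fun x : ℝ => Real.exp (-(a * Real.exp x)) * Real.exp (κ * x)) ∧
      ∫ x : ℝ, Real.exp (-(a * Real.exp x)) * Real.exp (κ * x) = Real.Gamma κ * a ^ (-κ) := by
  have himg : Real.exp '' univ = Ioi 0 := by rw [image_univ, Real.range_exp]
  have hd : ∀ x ∈ (univ : Set ℝ), HasDerivWithinAt Real.exp (Real.exp x) univ x :=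
    fun x _ => (Real.hasDerivAt_exp x).hasDerivWithinAt
  have heq : (fun x : ℝ => |Real.exp x| • ((Real.exp x) ^ (κ - 1) * Real.exp (-(a * Real.exp x)))) =
      fun x : ℝ => Real.exp (-(a * Real.exp x)) * Real.exp (κ * x) := by
    funext x
    rw [abs_of_pos (Real.exp_pos x), smul_eq_mul, ← Real.exp_mul, mul_comm (Real.exp (x * (κ - 1))),
      mul_left_comm, ← Real.exp_add]
    congr 2
    ring
  have hint : IntegrableOn (fun r : ℝ => r ^ (κ - 1) * Real.exp (-(a * r))) (Ioi 0) := by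
    -- A non-integrable function has integral 0 by convention, whereas the Gamma value is positive.
    by_contra h
    have h0 := Real.integral_rpow_mul_exp_neg_mul_Ioi hκ ha
    rw [integral_undef h] at h0
    have : 0 < (1 / a) ^ κ * Real.Gamma κ := by
      have := Real.Gamma_pos_of_pos hκ
      positivity
    linarith
  constructor
  · have := (integrableOn_image_iff_integrableOn_abs_deriv_smul MeasurableSet.univ hd
      Real.exp_injective.injOn (fun r : ℝ => r ^ (κ - 1) * Real.exp (-(a * r)))).1
      (by rw [himg]; exact hint)
    rw [heq] at this
    exact integrableOn_univ.1 this
  · have := integral_image_eq_integral_abs_deriv_smul MeasurableSet.univ hd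
      Real.exp_injective.injOn (fun r : ℝ => r ^ (κ - 1) * Real.exp (-(a * r)))
    rw [heq, himg, Measure.restrict_univ, Real.integral_rpow_mul_exp_neg_mul_Ioi hκ ha] at this
    rw [← this, Real.rpow_neg ha.le, one_div, Real.inv_rpow ha.le, mul_comm]

/-- The angle of the rays on which the Hankel-type integrals below are taken. -/
noncomputable def rayAngle (α : ℝ) : ℝ := Real.pi / 4 + Real.pi / (2 * α)

theorem rayAngle_mul {α : ℝ} (hα : 1 < α) : α * rayAngle α = α * Real.pi / 4 + Real.pi / 2 := by
  unfold rayAngle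
  have : α ≠ 0 := by linarith
  field_simp

/-- The angle is the midpoint of π/2 and π/α. Beyond π/2 the exponential decays along the ray; below
π/α the sector contains no zero of 1 + s^α. -/
theorem rayAngle_bounds {α : ℝ} (hα : 1 < α ∧ α < 2) :
    Real.pi / 2 < rayAngle α ∧ rayAngle α < Real.pi ∧ α * rayAngle α < Real.pi := by
  have hm := rayAngle_mul hα.1
  have hp := Real.pi_pos
  refine ⟨?_, ?_, ?_⟩
  · by_contra! h
    have : α * rayAngle α ≤ α * (Real.pi / 2) := by nlinarith
    nlinarith
  · by_contra! h
    have : α * Real.pi ≤ α * rayAngle α := by nlinarith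
    nlinarith
  · nlinarith

/-- The point `log r + i θ` with `r = exp x`. -/
noncomputable def rayPoint (α x : ℝ) : ℂ := x + rayAngle α * Complex.I

@[simp] theorem rayPoint_re (α x : ℝ) : (rayPoint α x).re = x := by simp [rayPoint]
@[simp] theorem rayPoint_im (α x : ℝ) : (rayPoint α x).im = rayAngle α := by simp [rayPoint]

/-- The Laplace symbol `s ^ q / (1 + s ^ α)` times `s`, at `s = exp z`. -/
noncomputable def symbolDensity (α q : ℝ) (z : ℂ) : ℂ :=
  Complex.exp ((q + 1) * z) / (1 + Complex.exp (α * z))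

/-- The decay rate `- cos θ > 0` of `exp s` along the ray. -/
noncomputable def rayDecay (α : ℝ) : ℝ := -Real.cos (rayAngle α)

theorem rayDecay_pos {α : ℝ} (hα : 1 < α ∧ α < 2) : 0 < rayDecay α := by
  obtain ⟨h1, h2, -⟩ := rayAngle_bounds hα
  have := Real.cos_neg_of_pi_div_two_lt_of_lt h1 (by linarith)
  unfold rayDecay
  linarith

/-- The constant in the lower bound of `1 + s ^ α` on the sector. -/
noncomputable def sectorConst (α : ℝ) : ℝ := Real.cos (α * rayAngle α / 2)

theorem sectorConst_pos {α : ℝ} (hα : 1 < α ∧ α < 2) : 0 < sectorConst α := by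
  obtain ⟨h1, h2, h3⟩ := rayAngle_bounds hα
  have := Real.pi_pos
  exact Real.cos_pos_of_mem_Ioo ⟨by nlinarith, by linarith⟩

/-- From |1 + ρ e^{iφ}|² = (1+ρ)² cos²(φ/2) + (1-ρ)² sin²(φ/2), keep the first term; cos(φ/2) is
smallest at the edge of the sector. -/
theorem one_add_exp_lower {α : ℝ} (hα : 1 < α ∧ α < 2) {z : ℂ} (h0 : 0 ≤ z.im)
    (h1 : z.im ≤ rayAngle α) :
    sectorConst α * (1 + Real.exp (α * z.re)) ≤ ‖1 + Complex.exp (α * z)‖ := by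
  obtain ⟨g1, g2, g3⟩ := rayAngle_bounds hα
  have hcos : sectorConst α ≤ Real.cos (α * z.im / 2) := by
    apply Real.cos_le_cos_of_nonneg_of_le_pi
    · nlinarith
    · linarith
    · nlinarith
  set φ := α * z.im with hφ
  set ρ := Real.exp (α * z.re) with hρ
  have hρ0 : 0 < ρ := Real.exp_pos _
  have hre : (1 + Complex.exp (α * z)).re = 1 + ρ * Real.cos φ := by
    simp [Complex.exp_re, hρ, hφ]
  have him : (1 + Complex.exp (α * z)).im = ρ * Real.sin φ := by
    simp [Complex.exp_im, hρ, hφ]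
  have hn : ‖1 + Complex.exp (α * z)‖ ^ 2 = (1 + ρ * Real.cos φ) ^ 2 + (ρ * Real.sin φ) ^ 2 := by
    rw [← Complex.normSq_eq_norm_sq, Complex.normSq_apply, hre, him]
    ring
  have hc2 : Real.cos φ = 2 * Real.cos (φ / 2) ^ 2 - 1 := by
    rw [← Real.cos_two_mul]
    congr 1
    ring
  have hs := Real.sin_sq_add_cos_sq φ
  have hle : Real.cos φ ≤ 1 := Real.cos_le_one φ
  have key : (Real.cos (φ / 2) * (1 + ρ)) ^ 2 ≤ ‖1 + Complex.exp (α * z)‖ ^ 2 := by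
    rw [hn]
    have : Real.cos (φ / 2) ^ 2 = (1 + Real.cos φ) / 2 := by linarith
    rw [mul_pow, this]
    nlinarith [mul_nonneg (sq_nonneg (1 - ρ)) (sub_nonneg.2 hle)]
  calc sectorConst α * (1 + ρ) ≤ Real.cos (φ / 2) * (1 + ρ) := by gcongr
    _ ≤ _ := le_of_sq_le_sq key (norm_nonneg _)

theorem one_add_exp_ne_zero {α : ℝ} (hα : 1 < α ∧ α < 2) {z : ℂ} (h0 : 0 ≤ z.im)
    (h1 : z.im ≤ rayAngle α) : 1 + Complex.exp (α * z) ≠ 0 := by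
  have h := one_add_exp_lower hα h0 h1
  have := sectorConst_pos hα
  intro h2
  rw [h2, norm_zero] at h
  have : 0 < sectorConst α * (1 + Real.exp (α * z.re)) := by positivity
  linarith

/-- The denominator dominates 1 + |s|^α, hence |s|^κ for every κ between 0 and α. The free κ later
balances decay in time against growth in frequency. -/
theorem norm_symbolDensity_le {α q κ : ℝ} (hα : 1 < α ∧ α < 2) (hκ : 0 ≤ κ) (hκα : κ ≤ α) {z : ℂ}
    (h0 : 0 ≤ z.im) (h1 : z.im ≤ rayAngle α) :
    ‖symbolDensity α q z‖ ≤ (sectorConst α)⁻¹ * Real.exp ((q + 1 - κ) * z.re) := by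
  have hk := sectorConst_pos hα
  have hl := one_add_exp_lower hα h0 h1
  have hκ2 : Real.exp (κ * z.re) ≤ 1 + Real.exp (α * z.re) := by
    rcases le_total 0 z.re with h | h
    · have : Real.exp (κ * z.re) ≤ Real.exp (α * z.re) :=
        Real.exp_le_exp.2 (mul_le_mul_of_nonneg_right hκα h)
      linarith
    · have : Real.exp (κ * z.re) ≤ 1 := Real.exp_le_one_iff.2 (mul_nonpos_of_nonneg_of_nonpos hκ h)
      have := Real.exp_pos (α * z.re)
      linarith
  have hnum : ‖Complex.exp ((q + 1) * z)‖ = Real.exp ((q + 1) * z.re) := by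
    rw [Complex.norm_exp]
    simp
  unfold symbolDensity
  rw [norm_div, hnum, div_le_iff₀ (lt_of_lt_of_le (by positivity) hl)]
  calc Real.exp ((q + 1) * z.re) = Real.exp ((q + 1 - κ) * z.re) * Real.exp (κ * z.re) := by
        rw [← Real.exp_add]
        congr 1
        ring
    _ ≤ Real.exp ((q + 1 - κ) * z.re) * (1 + Real.exp (α * z.re)) := by gcongr
    _ = (sectorConst α)⁻¹ * Real.exp ((q + 1 - κ) * z.re) *
        (sectorConst α * (1 + Real.exp (α * z.re))) := by field_simp
    _ ≤ _ := by gcongr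

theorem norm_exp_mul_exp_rayPoint (α t x : ℝ) :
    ‖Complex.exp (t * Complex.exp (rayPoint α x))‖ =
      Real.exp (-(rayDecay α * t * Real.exp x)) := by
  rw [Complex.norm_exp]
  congr 1
  simp [Complex.exp_re, rayDecay]
  ring

/-- The integrand of the Hankel-type integral, in logarithmic coordinates. -/
noncomputable def rayIntegrand (α q t x : ℝ) : ℂ :=
  Complex.exp (t * Complex.exp (rayPoint α x)) * symbolDensity α q (rayPoint α x)

/-- The function with Laplace transform `p ^ q / (1 + p ^ α)`; in terms of Mittag-Leffler functions
it is `t ^ (α - q - 1) E_{α, α - q}(-t ^ α)`. -/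
noncomputable def rayTransform (α q t : ℝ) : ℝ := Real.pi⁻¹ * (∫ x : ℝ, rayIntegrand α q t x).im

theorem norm_rayIntegrand_le {α q κ : ℝ} (hα : 1 < α ∧ α < 2) (hκ : 0 ≤ κ) (hκα : κ ≤ α)
    (t x : ℝ) :
    ‖rayIntegrand α q t x‖ ≤ (sectorConst α)⁻¹ *
      (Real.exp (-(rayDecay α * t * Real.exp x)) * Real.exp ((q + 1 - κ) * x)) := by
  obtain ⟨g1, g2, g3⟩ := rayAngle_bounds hα
  have hp := Real.pi_pos
  have := norm_symbolDensity_le (q := q) hα hκ hκα (z := rayPoint α x)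
    (by rw [rayPoint_im]; linarith) (by rw [rayPoint_im])
  rw [rayPoint_re] at this
  unfold rayIntegrand
  rw [norm_mul, norm_exp_mul_exp_rayPoint, mul_left_comm]
  gcongr

theorem continuous_symbolDensity_rayPoint {α : ℝ} (q : ℝ) (hα : 1 < α ∧ α < 2) :
    Continuous fun x : ℝ => symbolDensity α q (rayPoint α x) := by
  obtain ⟨g1, g2, g3⟩ := rayAngle_bounds hα
  have hp := Real.pi_pos
  unfold symbolDensity
  have hc : Continuous fun x : ℝ => rayPoint α x := by unfold rayPoint; fun_prop
  refine Continuous.div (by fun_prop) (by fun_prop) fun x => ?_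
  exact one_add_exp_ne_zero hα (by rw [rayPoint_im]; linarith) (by rw [rayPoint_im])

theorem continuous_rayIntegrand {α : ℝ} (q : ℝ) (hα : 1 < α ∧ α < 2) :
    Continuous fun y : ℝ × ℝ => rayIntegrand α q y.1 y.2 := by
  unfold rayIntegrand
  have h1 := (continuous_symbolDensity_rayPoint q hα).comp (continuous_snd (X := ℝ) (Y := ℝ))
  have hc : Continuous fun x : ℝ => rayPoint α x := by unfold rayPoint; fun_prop
  exact Continuous.mul (by fun_prop) h1

theorem integrable_rayIntegrand {α q t : ℝ} (hα : 1 < α ∧ α < 2) (hq : -1 < q) (ht : 0 < t) :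
    Integrable (rayIntegrand α q t) := by
  have hc := rayDecay_pos hα
  refine Integrable.mono' (((integrable_exp_neg_mul_exp (a := rayDecay α * t) (κ := q + 1 - 0)
    (by positivity) (by linarith)).1).const_mul (sectorConst α)⁻¹)
    ((continuous_rayIntegrand q hα).comp (Continuous.prodMk_right t)).aestronglyMeasurable
    (Eventually.of_forall fun x => ?_)
  exact norm_rayIntegrand_le hα le_rfl (by linarith) t x

/-- Integrating the pointwise bound is a Gamma integral with exponent q + 1 - κ, which must be
positive for convergence at the vertex s = 0. -/
theorem abs_rayTransform_le {α q κ : ℝ} (hα : 1 < α ∧ α < 2) (hκ : 0 ≤ κ) (hκα : κ ≤ α)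
    (hq : κ < q + 1) :
    ∃ C : ℝ, 0 < C ∧ ∀ t : ℝ, 0 < t → |rayTransform α q t| ≤ C * t ^ (κ - q - 1) := by
  have hc := rayDecay_pos hα
  have hk := sectorConst_pos hα
  have hG := Real.Gamma_pos_of_pos (show 0 < q + 1 - κ by linarith)
  have hp := Real.pi_pos
  refine ⟨Real.pi⁻¹ * ((sectorConst α)⁻¹ * (Real.Gamma (q + 1 - κ) *
    rayDecay α ^ (-(q + 1 - κ)))), by positivity, fun t ht => ?_⟩
  obtain ⟨h1, h2⟩ := integrable_exp_neg_mul_exp (a := rayDecay α * t) (κ := q + 1 - κ)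
    (by positivity) (by linarith)
  have h3 : ‖∫ x : ℝ, rayIntegrand α q t x‖ ≤ (sectorConst α)⁻¹ *
      (Real.Gamma (q + 1 - κ) * (rayDecay α * t) ^ (-(q + 1 - κ))) := by
    rw [← h2, ← integral_const_mul]
    exact norm_integral_le_of_norm_le (h1.const_mul _)
      (Eventually.of_forall fun x => norm_rayIntegrand_le hα hκ hκα t x)
  unfold rayTransform
  rw [abs_mul, abs_of_pos (inv_pos.2 hp)]
  calc _ ≤ Real.pi⁻¹ * ‖∫ x : ℝ, rayIntegrand α q t x‖ := by
        gcongr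
        exact Complex.abs_im_le_norm _
    _ ≤ Real.pi⁻¹ * ((sectorConst α)⁻¹ *
      (Real.Gamma (q + 1 - κ) * (rayDecay α * t) ^ (-(q + 1 - κ)))) := by gcongr
    _ = _ := by
        rw [Real.mul_rpow hc.le ht.le, show κ - q - 1 = -(q + 1 - κ) by ring]
        ring

/-- Each time derivative brings down a factor s. For t > 0 the exponential absorbs any power of s,
so q needs no upper bound here, unlike in the Laplace identity. -/
theorem hasDerivAt_rayTransform {α q t : ℝ} (hα : 1 < α ∧ α < 2) (hq : -1 < q) (ht : 0 < t) :
    HasDerivAt (rayTransform α q) (rayTransform α (q + 1) t) t := by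
  have hc := rayDecay_pos hα
  have hk := sectorConst_pos hα
  have hbound : Integrable (fun x : ℝ => (sectorConst α)⁻¹ *
      (Real.exp (-(rayDecay α * (t / 2) * Real.exp x)) * Real.exp ((q + 1 + 1 - 0) * x))) :=
    ((integrable_exp_neg_mul_exp (by positivity) (by linarith)).1).const_mul _
  have key := hasDerivAt_integral_of_dominated_loc_of_deriv_le (μ := volume)
    (F := fun t x => rayIntegrand α q t x) (F' := fun t x => rayIntegrand α (q + 1) t x) (x₀ := t)
    -- For times beyond t/2 the integrand of order q + 1 is dominated by its bound at t/2.
    (Ioi_mem_nhds (show t / 2 < t by linarith))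
    (Eventually.of_forall fun s =>
      ((continuous_rayIntegrand q hα).comp (Continuous.prodMk_right s)).aestronglyMeasurable)
    (integrable_rayIntegrand hα hq ht)
    ((continuous_rayIntegrand (q + 1) hα).comp (Continuous.prodMk_right t)).aestronglyMeasurable
    (Eventually.of_forall fun x s hs => ?_) hbound
    (Eventually.of_forall fun x s hs => ?_)
  · have h2 := Complex.imCLM.hasFDerivAt.comp_hasDerivAt t key.2
    exact h2.const_mul Real.pi⁻¹
  · refine (norm_rayIntegrand_le hα le_rfl (by linarith) s x).trans ?_
    have : t / 2 ≤ s := le_of_lt hs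
    gcongr
  · have h1 : HasDerivAt (fun s : ℝ => (s : ℂ) * Complex.exp (rayPoint α x))
        (1 * Complex.exp (rayPoint α x)) s := (Complex.ofRealCLM.hasDerivAt).mul_const _
    have h2 := (h1.cexp).mul_const (symbolDensity α q (rayPoint α x))
    have h3 : rayIntegrand α (q + 1) s x = Complex.exp (s * Complex.exp (rayPoint α x)) *
        (1 * Complex.exp (rayPoint α x)) * symbolDensity α q (rayPoint α x) := by
      unfold rayIntegrand symbolDensity
      rw [show ((q + 1 : ℝ) + 1 : ℂ) * rayPoint α x = rayPoint α x + (q + 1) * rayPoint α x by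
        push_cast; ring, Complex.exp_add]
      ring
    rw [h3]
    exact h2

/-! ### Contour evaluation of the Cauchy-type integral along the ray -/

theorem exp_ne_of_mem_strip {p : ℝ} (hp : 0 < p) {z : ℂ} (h0 : 0 ≤ z.im) (h1 : z.im < Real.pi)
    (hz : z ≠ (Real.log p : ℝ)) : Complex.exp z ≠ p := by
  intro h
  apply hz
  have h2 := Complex.log_exp (x := z) (by linarith [Real.pi_pos]) h1.le
  rw [← h2, h, Complex.ofReal_log hp.le]

theorem add_exp_ne_zero_of_mem_strip {p : ℝ} (hp : 0 < p) {z : ℂ} (h0 : 0 ≤ z.im)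
    (h1 : z.im < Real.pi) : (p : ℂ) + Complex.exp z ≠ 0 := by
  intro h
  have hre := congrArg Complex.re h
  have him := congrArg Complex.im h
  simp only [Complex.add_re, Complex.add_im, Complex.ofReal_re, Complex.ofReal_im,
    Complex.exp_re, Complex.exp_im, Complex.zero_re, Complex.zero_im, zero_add] at hre him
  have he := Real.exp_pos z.re
  rcases h0.eq_or_lt with h0 | h0
  · rw [← h0, Real.cos_zero] at hre
    linarith
  · have := Real.sin_pos_of_pos_of_lt_pi h0 h1
    have : 0 < Real.exp z.re * Real.sin z.im := by positivity
    linarith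

/-- The value `p ^ q / (1 + p ^ α)` of the Laplace symbol. -/
noncomputable def symbolValue (α q p : ℝ) : ℝ := p ^ q / (1 + p ^ α)

/-- The difference, with a zero at `exp z = p`, whose quotient by `p - exp z` is holomorphic. -/
noncomputable def reducedNum (α q p : ℝ) (z : ℂ) : ℂ :=
  symbolDensity α q z - symbolValue α q p * (2 * p * Complex.exp z) / (p + Complex.exp z)

/-- The quotient of `reducedNum` by `p - exp z`, extended holomorphically to `z = log p`. -/
noncomputable def reducedQuot (α q p : ℝ) (z : ℂ) : ℂ :=
  -(dslope (reducedNum α q p) (Real.log p : ℝ) z / dslope Complex.exp (Real.log p : ℝ) z)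

/-- At exp z = p both terms equal p^(q+1) / (1 + p^α). The factor 2p e^z / (p + e^z) is used rather
than a constant because, divided by p - e^z, it still decays at both ends of the strip and has an
explicit logarithmic primitive. -/
theorem reducedNum_log {α q p : ℝ} (hp : 0 < p) : reducedNum α q p (Real.log p : ℝ) = 0 := by
  have h1 : Complex.exp ((Real.log p : ℝ) : ℂ) = p := by
    rw [← Complex.ofReal_exp, Real.exp_log hp]
  have h2 : Complex.exp ((q + 1) * ((Real.log p : ℝ) : ℂ)) = (p ^ (q + 1) : ℝ) := by
    rw [Real.rpow_def_of_pos hp, Complex.ofReal_exp]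
    push_cast
    ring_nf
  have h3 : Complex.exp (α * ((Real.log p : ℝ) : ℂ)) = (p ^ α : ℝ) := by
    rw [Real.rpow_def_of_pos hp, Complex.ofReal_exp]
    push_cast
    ring_nf
  have hpos : 0 < p ^ α := Real.rpow_pos_of_pos hp _
  unfold reducedNum symbolDensity symbolValue
  rw [h1, h2, h3]
  have : p ^ (q + 1) / (1 + p ^ α) - p ^ q / (1 + p ^ α) * (2 * p * p) / (p + p) = 0 := by
    rw [Real.rpow_add_one hp.ne']
    field_simp
    ring
  exact_mod_cast this

theorem differentiableAt_reducedNum {α q p : ℝ} (hα : 1 < α ∧ α < 2) (hp : 0 < p) {z : ℂ}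
    (h0 : 0 ≤ z.im) (h1 : z.im ≤ rayAngle α) : DifferentiableAt ℂ (reducedNum α q p) z := by
  obtain ⟨g1, g2, g3⟩ := rayAngle_bounds hα
  have ha := one_add_exp_ne_zero hα h0 h1
  have hb := add_exp_ne_zero_of_mem_strip hp h0 (h1.trans_lt g2)
  unfold reducedNum symbolDensity
  refine DifferentiableAt.sub (DifferentiableAt.div (by fun_prop) (by fun_prop) ha)
    (DifferentiableAt.div (by fun_prop) (by fun_prop) hb)

theorem reducedQuot_eq {α q p : ℝ} (hp : 0 < p) {z : ℂ} (hz : z ≠ (Real.log p : ℝ)) :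
    reducedQuot α q p z = reducedNum α q p z / (p - Complex.exp z) := by
  have h1 : Complex.exp ((Real.log p : ℝ) : ℂ) = p := by
    rw [← Complex.ofReal_exp, Real.exp_log hp]
  have hz' := sub_ne_zero.2 hz
  unfold reducedQuot
  rw [dslope_of_ne _ hz, dslope_of_ne _ hz, slope_def_field, slope_def_field, reducedNum_log hp, h1,
    sub_zero, div_div_div_cancel_right₀ hz', ← div_neg, neg_sub]

theorem dslope_exp_ne_zero {p : ℝ} (hp : 0 < p) {z : ℂ} (h0 : 0 ≤ z.im) (h1 : z.im < Real.pi) :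
    dslope Complex.exp (Real.log p : ℝ) z ≠ 0 := by
  by_cases hz : z = (Real.log p : ℝ)
  · rw [hz, dslope_same, Complex.deriv_exp]
    exact Complex.exp_ne_zero _
  · have h2 : Complex.exp ((Real.log p : ℝ) : ℂ) = p := by
      rw [← Complex.ofReal_exp, Real.exp_log hp]
    rw [dslope_of_ne _ hz, slope_def_field, h2]
    exact div_ne_zero (sub_ne_zero.2 (exp_ne_of_mem_strip hp h0 h1 hz)) (sub_ne_zero.2 hz)

theorem continuousAt_reducedQuot {α q p : ℝ} (hα : 1 < α ∧ α < 2) (hp : 0 < p) {z : ℂ}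
    (h0 : 0 ≤ z.im) (h1 : z.im ≤ rayAngle α) : ContinuousAt (reducedQuot α q p) z := by
  obtain ⟨g1, g2, g3⟩ := rayAngle_bounds hα
  have hd := differentiableAt_reducedNum (q := q) hα hp h0 h1
  have hne := dslope_exp_ne_zero hp h0 (h1.trans_lt g2)
  unfold reducedQuot
  refine (ContinuousAt.div ?_ ?_ hne).neg
  · by_cases hz : z = (Real.log p : ℝ)
    · subst hz
      exact continuousAt_dslope_same.2 hd
    · exact (continuousAt_dslope_of_ne hz).2 hd.continuousAt
  · by_cases hz : z = (Real.log p : ℝ)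
    · subst hz
      exact continuousAt_dslope_same.2 Complex.differentiableAt_exp
    · exact (continuousAt_dslope_of_ne hz).2 Complex.continuous_exp.continuousAt

theorem differentiableAt_reducedQuot {α q p : ℝ} (hα : 1 < α ∧ α < 2) (hp : 0 < p) {z : ℂ}
    (h0 : 0 < z.im) (h1 : z.im ≤ rayAngle α) : DifferentiableAt ℂ (reducedQuot α q p) z := by
  obtain ⟨g1, g2, g3⟩ := rayAngle_bounds hα
  have hd := differentiableAt_reducedNum (q := q) hα hp h0.le h1
  have hne := dslope_exp_ne_zero hp h0.le (h1.trans_lt g2)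
  have hz : z ≠ (Real.log p : ℝ) := by
    intro h
    rw [h, Complex.ofReal_im] at h0
    exact lt_irrefl _ h0
  unfold reducedQuot
  exact (DifferentiableAt.div ((differentiableAt_dslope_of_ne hz).2 hd)
    ((differentiableAt_dslope_of_ne hz).2 Complex.differentiableAt_exp) hne).neg

/-- By the reverse triangle inequality, `d` bounds both |p - e^z| and |p + e^z| from below. This
controls the vertical sides of the contour far from log p. -/
theorem norm_reducedQuot_le {α q p : ℝ} (hα : 1 < α ∧ α < 2) (hp : 0 < p) {κ : ℝ} (hκ : 0 ≤ κ)
    (hκα : κ ≤ α) {z : ℂ} (h0 : 0 ≤ z.im) (h1 : z.im ≤ rayAngle α) {d : ℝ} (hd : 0 < d)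
    (hd' : d ≤ |p - Real.exp z.re|) :
    ‖reducedQuot α q p z‖ ≤ (sectorConst α)⁻¹ * Real.exp ((q + 1 - κ) * z.re) / d +
      symbolValue α q p * (2 * p) * Real.exp z.re / (d * d) := by
  have hn := norm_symbolDensity_le (q := q) hα hκ hκα h0 h1
  have hk := sectorConst_pos hα
  have hne : ‖Complex.exp z‖ = Real.exp z.re := Complex.norm_exp z
  have hnp : ‖(p : ℂ)‖ = p := by rw [Complex.norm_real, Real.norm_of_nonneg hp.le]
  have hsv : 0 < symbolValue α q p := by
    unfold symbolValue
    have := Real.rpow_pos_of_pos hp α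
    have := Real.rpow_pos_of_pos hp q
    positivity
  have d1 : d ≤ ‖(p : ℂ) - Complex.exp z‖ := by
    refine hd'.trans ?_
    have := abs_norm_sub_norm_le (p : ℂ) (Complex.exp z)
    rwa [hnp, hne] at this
  have d2 : d ≤ ‖(p : ℂ) + Complex.exp z‖ := by
    refine hd'.trans ?_
    have := abs_norm_sub_norm_le (p : ℂ) (-Complex.exp z)
    rw [norm_neg, hnp, hne, sub_neg_eq_add] at this
    exact this
  have hz : z ≠ (Real.log p : ℝ) := by
    intro h
    rw [h, Complex.ofReal_re, Real.exp_log hp, sub_self, abs_zero] at hd'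
    linarith
  rw [reducedQuot_eq hp hz, reducedNum, sub_div]
  refine (norm_sub_le _ _).trans (add_le_add ?_ ?_)
  · rw [norm_div]
    gcongr
  · rw [norm_div, norm_div, norm_mul, norm_mul, norm_mul, hne, hnp, Complex.norm_real,
      Real.norm_of_nonneg hsv.le, Complex.norm_ofNat, div_div, ← mul_assoc]
    gcongr

/-- The elementary part of the contour integral is the derivative of a logarithm. -/
theorem hasDerivAt_log_ray {α p : ℝ} (hα : 1 < α ∧ α < 2) (hp : 0 < p) (x : ℝ) :
    HasDerivAt (fun x : ℝ => Complex.log ((p + Complex.exp (rayPoint α x)) /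
        (p - Complex.exp (rayPoint α x))))
      ((2 * p * Complex.exp (rayPoint α x)) / (p + Complex.exp (rayPoint α x)) /
        (p - Complex.exp (rayPoint α x))) x ∧
      0 < ((p + Complex.exp (rayPoint α x)) / (p - Complex.exp (rayPoint α x))).im := by
  obtain ⟨g1, g2, g3⟩ := rayAngle_bounds hα
  have hpi := Real.pi_pos
  have hb := add_exp_ne_zero_of_mem_strip (z := rayPoint α x) hp
    (by rw [rayPoint_im]; linarith) (by rw [rayPoint_im]; linarith)
  have hz : rayPoint α x ≠ (Real.log p : ℝ) := by
    intro h
    have := congrArg Complex.im h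
    rw [rayPoint_im, Complex.ofReal_im] at this
    linarith
  have ha : (p : ℂ) - Complex.exp (rayPoint α x) ≠ 0 := sub_ne_zero.2
    (exp_ne_of_mem_strip hp (by rw [rayPoint_im]; linarith) (by rw [rayPoint_im]; linarith) hz).symm
  -- The quotient stays in the open upper half-plane, off the branch cut; the same fact later
  -- selects the limit argument π.
  have him : 0 < ((p + Complex.exp (rayPoint α x)) / (p - Complex.exp (rayPoint α x))).im := by
    have hs := Real.sin_pos_of_pos_of_lt_pi (x := rayAngle α) (by linarith) g2
    have hn : 0 < Complex.normSq (p - Complex.exp (rayPoint α x)) := Complex.normSq_pos.2 ha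
    have he := Real.exp_pos x
    rw [Complex.div_im, ← sub_div]
    refine div_pos ?_ hn
    simp only [Complex.add_im, Complex.ofReal_im, Complex.exp_im, rayPoint_re, rayPoint_im,
      Complex.sub_re, Complex.ofReal_re, Complex.exp_re, Complex.add_re, Complex.sub_im]
    have : 0 < p * (Real.exp x * Real.sin (rayAngle α)) := by positivity
    nlinarith
  refine ⟨?_, him⟩
  have hr : HasDerivAt (fun x : ℝ => rayPoint α x) 1 x := by
    unfold rayPoint
    exact (Complex.ofRealCLM.hasDerivAt).add_const _
  have he : HasDerivAt (fun x : ℝ => Complex.exp (rayPoint α x)) (Complex.exp (rayPoint α x)) x := by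
    simpa using hr.cexp
  have h1 := ((he.const_add (p : ℂ)).fun_div (he.const_sub (p : ℂ)) ha)
  convert (h1.clog_real (by right; exact him.ne')) using 1
  field_simp
  ring

theorem tendsto_exp_rayPoint_atBot (α : ℝ) :
    Tendsto (fun x : ℝ => Complex.exp (rayPoint α x)) atBot (𝓝 0) := by
  rw [tendsto_zero_iff_norm_tendsto_zero]
  simpa [Complex.norm_exp] using Real.tendsto_exp_atBot

theorem tendsto_log_ray_atBot {α p : ℝ} (hp : 0 < p) :
    Tendsto (fun x : ℝ => (Complex.log ((p + Complex.exp (rayPoint α x)) /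
      (p - Complex.exp (rayPoint α x)))).im) atBot (𝓝 0) := by
  have hp' : (p : ℂ) ≠ 0 := by exact_mod_cast hp.ne'
  have h0 := tendsto_exp_rayPoint_atBot α
  have h1 : Tendsto (fun x : ℝ => (p + Complex.exp (rayPoint α x)) /
      (p - Complex.exp (rayPoint α x))) atBot (𝓝 1) := by
    have := (h0.const_add (p : ℂ)).div (h0.const_sub (p : ℂ)) (by simpa using hp')
    simpa [Pi.div_def, div_self hp'] using this
  have h2 := (h1.clog (by simp))
  rw [Complex.log_one] at h2
  exact (Complex.continuous_im.tendsto 0).comp h2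

/-- The quotient tends to -1, on the branch cut of the logarithm; since it approaches from above,
the argument tends to π and not -π. Its total increase along the ray is the half residue at p. -/
theorem tendsto_log_ray_atTop {α p : ℝ} (hα : 1 < α ∧ α < 2) (hp : 0 < p) :
    Tendsto (fun x : ℝ => (Complex.log ((p + Complex.exp (rayPoint α x)) /
      (p - Complex.exp (rayPoint α x)))).im) atTop (𝓝 Real.pi) := by
  have h0 : Tendsto (fun x : ℝ => Complex.exp (-rayPoint α x)) atTop (𝓝 0) := by
    rw [tendsto_zero_iff_norm_tendsto_zero]
    simpa [Complex.norm_exp] using Real.tendsto_exp_neg_atTop_nhds_zero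
  have h1 : Tendsto (fun x : ℝ => (p + Complex.exp (rayPoint α x)) /
      (p - Complex.exp (rayPoint α x))) atTop (𝓝 (-1)) := by
    have := ((h0.const_mul (p : ℂ)).add_const 1).div ((h0.const_mul (p : ℂ)).sub_const 1)
      (by simp)
    simp only [mul_zero, zero_add, zero_sub, div_neg, div_one] at this
    refine this.congr fun x => ?_
    have he := Complex.exp_ne_zero (rayPoint α x)
    simp only [Pi.div_apply]
    rw [Complex.exp_neg, ← mul_div_mul_right _ _ he]
    congr 1 <;> field_simp
  have h2 : Tendsto (fun x : ℝ => (p + Complex.exp (rayPoint α x)) /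
      (p - Complex.exp (rayPoint α x))) atTop (𝓝[{z | 0 ≤ z.im}] (-1)) :=
    tendsto_nhdsWithin_iff.2 ⟨h1, Eventually.of_forall fun x => (hasDerivAt_log_ray hα hp x).2.le⟩
  have h3 := Complex.continuousWithinAt_arg_of_re_neg_of_im_zero (z := -1) (by simp) (by simp)
  have h4 := h3.tendsto.comp h2
  rw [Complex.arg_neg_one] at h4
  exact h4.congr fun x => (Complex.log_im _).symm

/-- On the real axis all ingredients are real, except possibly at the single point log p, where the
quotient is defined through `dslope`. -/
theorem im_integral_reducedQuot_real {α q p : ℝ} (hp : 0 < p) (a b : ℝ) :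
    (∫ x in a..b, reducedQuot α q p (x : ℂ)).im = 0 := by
  have hae : ∀ᵐ x : ℝ, x ∈ uIoc a b →
      reducedQuot α q p (x : ℂ) = ((reducedQuot α q p (x : ℂ)).re : ℂ) := by
    have : ∀ᵐ x : ℝ, x ≠ Real.log p := by
      simp [ae_iff]
    filter_upwards [this] with x hx _
    have hx' : (x : ℂ) ≠ (Real.log p : ℝ) := by exact_mod_cast hx
    have : reducedQuot α q p (x : ℂ) = ((((Real.exp ((q + 1) * x)) / (1 + Real.exp (α * x)) -
        symbolValue α q p * (2 * p * Real.exp x) / (p + Real.exp x)) / (p - Real.exp x) : ℝ) : ℂ) := by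
      rw [reducedQuot_eq hp hx', reducedNum, symbolDensity]
      push_cast
      rfl
    rw [this, Complex.ofReal_re]
  rw [intervalIntegral.integral_congr_ae hae, intervalIntegral.integral_ofReal, Complex.ofReal_im]

theorem tendsto_integral_vertical {α q p : ℝ} (hα : 1 < α ∧ α < 2) {l : Filter ℝ}
    {B : ℝ → ℝ} (hB : Tendsto B l (𝓝 0))
    (h : ∀ᶠ x in l, ∀ z : ℂ, z.re = x → 0 ≤ z.im → z.im ≤ rayAngle α →
      ‖reducedQuot α q p z‖ ≤ B x) :
    Tendsto (fun x : ℝ => ∫ y in (0 : ℝ)..rayAngle α, reducedQuot α q p (x + y * Complex.I)) l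
      (𝓝 0) := by
  obtain ⟨g1, g2, g3⟩ := rayAngle_bounds hα
  have hpi := Real.pi_pos
  have h0 : Tendsto (fun x => B x * |rayAngle α - 0|) l (𝓝 0) := by
    simpa using hB.mul_const |rayAngle α - 0|
  refine squeeze_zero_norm' ?_ h0
  filter_upwards [h] with x hx
  refine intervalIntegral.norm_integral_le_of_norm_le_const fun y hy => ?_
  rw [uIoc_of_le (by linarith)] at hy
  exact hx _ (by simp) (by simpa using hy.1.le) (by simpa using hy.2)

theorem tendsto_integral_vertical_atTop {α q p : ℝ} (hα : 1 < α ∧ α < 2) (hqα : q < α)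
    (hp : 0 < p) :
    Tendsto (fun x : ℝ => ∫ y in (0 : ℝ)..rayAngle α, reducedQuot α q p (x + y * Complex.I)) atTop
      (𝓝 0) := by
  set A := symbolValue α q p
  have hB : Tendsto (fun x : ℝ => (sectorConst α)⁻¹ * Real.exp ((q + 1 - α) * x) /
      (Real.exp x / 2) + A * (2 * p) * Real.exp x / (Real.exp x / 2 * (Real.exp x / 2))) atTop
      (𝓝 0) := by
    have h1 : Tendsto (fun x : ℝ => Real.exp ((q - α) * x)) atTop (𝓝 0) :=
      Real.tendsto_exp_atBot.comp (tendsto_id.const_mul_atTop_of_neg (by linarith))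
    have h2 := ((h1.const_mul ((sectorConst α)⁻¹ * 2)).add
      (Real.tendsto_exp_neg_atTop_nhds_zero.const_mul (A * (2 * p) * 4)))
    simp only [mul_zero, add_zero] at h2
    refine h2.congr fun x => ?_
    rw [show (q + 1 - α) * x = (q - α) * x + x by ring, Real.exp_add, Real.exp_neg]
    have := Real.exp_pos x
    field_simp
    ring
  refine tendsto_integral_vertical hα hB ?_
  filter_upwards [Real.tendsto_exp_atTop.eventually_ge_atTop (2 * p)] with x hx z hz h0 h1
  have := norm_reducedQuot_le (q := q) hα hp (κ := α) (by linarith) le_rfl h0 h1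
    (d := Real.exp x / 2) (by positivity)
    (by rw [hz, abs_sub_comm, abs_of_nonneg] <;> linarith)
  rwa [hz] at this

theorem tendsto_integral_vertical_atBot {α q p : ℝ} (hα : 1 < α ∧ α < 2) (hq : -1 < q)
    (hp : 0 < p) :
    Tendsto (fun x : ℝ => ∫ y in (0 : ℝ)..rayAngle α, reducedQuot α q p (x + y * Complex.I)) atBot
      (𝓝 0) := by
  set A := symbolValue α q p
  have hB : Tendsto (fun x : ℝ => (sectorConst α)⁻¹ * Real.exp ((q + 1 - 0) * x) /
      (p / 2) + A * (2 * p) * Real.exp x / (p / 2 * (p / 2))) atBot (𝓝 0) := by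
    have h1 : Tendsto (fun x : ℝ => Real.exp ((q + 1 - 0) * x)) atBot (𝓝 0) :=
      Real.tendsto_exp_atBot.comp (tendsto_id.const_mul_atBot (by linarith))
    simpa using ((h1.const_mul (sectorConst α)⁻¹).div_const (p / 2)).add
      ((Real.tendsto_exp_atBot.const_mul (A * (2 * p))).div_const (p / 2 * (p / 2)))
  refine tendsto_integral_vertical hα hB ?_
  filter_upwards [Real.tendsto_exp_atBot.eventually (Iic_mem_nhds (show 0 < p / 2 by positivity))]
    with x hx z hz h0 h1
  have hx : Real.exp x ≤ p / 2 := hx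
  have := norm_reducedQuot_le (q := q) hα hp (κ := 0) le_rfl (by linarith) h0 h1
    (d := p / 2) (by positivity) (by rw [hz, abs_of_nonneg] <;> linarith)
  rwa [hz] at this

/-- Cauchy's theorem on the rectangle between the real axis and the ray. The removed pole lies on
the lower side, so only continuity is used on the boundary; that side has no imaginary part. -/
theorem integral_reducedQuot_rect {α q p : ℝ} (hα : 1 < α ∧ α < 2) (hp : 0 < p) (R : ℝ) :
    (∫ x in (-R)..R, reducedQuot α q p (rayPoint α x)).im =
      (∫ y in (0 : ℝ)..rayAngle α, reducedQuot α q p (R + y * Complex.I)).re -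
      (∫ y in (0 : ℝ)..rayAngle α, reducedQuot α q p ((-R : ℝ) + y * Complex.I)).re := by
  obtain ⟨g1, g2, g3⟩ := rayAngle_bounds hα
  have hpi := Real.pi_pos
  have h := Complex.integral_boundary_rect_eq_zero_of_continuousOn_of_differentiableOn
    (reducedQuot α q p) ((-R : ℝ) : ℂ) (rayPoint α R) ?_ ?_
  · simp only [Complex.ofReal_re, Complex.ofReal_im, rayPoint_re, rayPoint_im, zero_mul, add_zero,
      Complex.ofReal_zero] at h
    have him := congrArg Complex.im h
    simp only [Complex.add_im, Complex.sub_im, im_integral_reducedQuot_real hp, smul_eq_mul,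
      Complex.mul_im, Complex.I_re, Complex.I_im, Complex.zero_im, zero_mul, one_mul, zero_add] at him
    unfold rayPoint
    linarith
  · intro z hz
    rw [Complex.mem_reProdIm] at hz
    simp only [Complex.ofReal_im, rayPoint_im, uIcc_of_le (show 0 ≤ rayAngle α by linarith)] at hz
    exact (continuousAt_reducedQuot hα hp hz.2.1 hz.2.2).continuousWithinAt
  · intro z hz
    rw [Complex.mem_reProdIm] at hz
    simp only [Complex.ofReal_im, rayPoint_im, min_eq_left (show 0 ≤ rayAngle α by linarith),
      max_eq_right (show 0 ≤ rayAngle α by linarith)] at hz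
    exact (differentiableAt_reducedQuot hα hp hz.2.1 hz.2.2.le).differentiableWithinAt

/-- Split off the pole: the holomorphic part contributes only vertical sides, which vanish on the
left because q > -1 and on the right because q < α. The elementary part contributes the change π of
the argument of the logarithm. -/
theorem im_integral_symbolDensity_div {α q p : ℝ} (hα : 1 < α ∧ α < 2) (hq : -1 < q) (hqα : q < α)
    (hp : 0 < p) (hint : Integrable fun x : ℝ => symbolDensity α q (rayPoint α x) /
      (p - Complex.exp (rayPoint α x))) :
    (∫ x : ℝ, symbolDensity α q (rayPoint α x) / (p - Complex.exp (rayPoint α x))).im =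
      Real.pi * symbolValue α q p := by
  obtain ⟨g1, g2, g3⟩ := rayAngle_bounds hα
  have hpi := Real.pi_pos
  set A := symbolValue α q p
  have hlim := intervalIntegral_tendsto_integral hint tendsto_neg_atTop_atBot tendsto_id
  have hlim' := (Complex.continuous_im.tendsto _).comp hlim
  have hr : Continuous fun x : ℝ => rayPoint α x := by unfold rayPoint; fun_prop
  set lg : ℝ → ℂ := fun x => Complex.log ((p + Complex.exp (rayPoint α x)) /
        (p - Complex.exp (rayPoint α x))) with hlg
  have hz : ∀ x : ℝ, rayPoint α x ≠ (Real.log p : ℝ) := by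
    intro x h
    have := congrArg Complex.im h
    rw [rayPoint_im, Complex.ofReal_im] at this
    linarith
  have hb : ∀ x : ℝ, (p : ℂ) + Complex.exp (rayPoint α x) ≠ 0 := fun x =>
    add_exp_ne_zero_of_mem_strip hp (by rw [rayPoint_im]; linarith) (by rw [rayPoint_im]; linarith)
  have ha : ∀ x : ℝ, (p : ℂ) - Complex.exp (rayPoint α x) ≠ 0 := fun x => sub_ne_zero.2
    (exp_ne_of_mem_strip hp (by rw [rayPoint_im]; linarith) (by rw [rayPoint_im]; linarith)
      (hz x)).symm
  have hQ : Continuous fun x : ℝ => reducedQuot α q p (rayPoint α x) :=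
    continuous_iff_continuousAt.2 fun x => ContinuousAt.comp
      (g := reducedQuot α q p) (continuousAt_reducedQuot hα hp (by rw [rayPoint_im]; linarith) (by rw [rayPoint_im]))
      hr.continuousAt
  have hK : Continuous fun x : ℝ => (2 * p * Complex.exp (rayPoint α x)) /
      (p + Complex.exp (rayPoint α x)) / (p - Complex.exp (rayPoint α x)) :=
    ((by fun_prop : Continuous fun x : ℝ => 2 * p * Complex.exp (rayPoint α x)).div
      (by fun_prop) hb).div (by fun_prop) ha
  have heq : ∀ x : ℝ, symbolDensity α q (rayPoint α x) / (p - Complex.exp (rayPoint α x)) =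
      reducedQuot α q p (rayPoint α x) + A * ((2 * p * Complex.exp (rayPoint α x)) /
      (p + Complex.exp (rayPoint α x)) / (p - Complex.exp (rayPoint α x))) := by
    intro x
    rw [reducedQuot_eq hp (hz x), reducedNum]
    ring
  have hfin : ∀ R : ℝ, 0 < R →
      (∫ x in (-R)..R, symbolDensity α q (rayPoint α x) / (p - Complex.exp (rayPoint α x))).im =
      (∫ y in (0 : ℝ)..rayAngle α, reducedQuot α q p (R + y * Complex.I)).re -
      (∫ y in (0 : ℝ)..rayAngle α, reducedQuot α q p ((-R : ℝ) + y * Complex.I)).re +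
      A * ((lg R).im - (lg (-R)).im) := by
    intro R hR
    simp_rw [heq]
    rw [intervalIntegral.integral_add (hQ.intervalIntegrable _ _)
      ((hK.intervalIntegrable _ _).const_mul (A : ℂ)), intervalIntegral.integral_const_mul,
      Complex.add_im, integral_reducedQuot_rect hα hp R, Complex.im_ofReal_mul,
      intervalIntegral.integral_eq_sub_of_hasDerivAt
        (fun x _ => (hasDerivAt_log_ray hα hp x).1) (hK.intervalIntegrable _ _), Complex.sub_im]
  have hT := tendsto_integral_vertical_atTop hα hqα hp
  have hBt := (tendsto_integral_vertical_atBot hα hq hp).comp tendsto_neg_atTop_atBot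
  have hT' := (Complex.continuous_re.tendsto _).comp hT
  have hBt' := (Complex.continuous_re.tendsto _).comp hBt
  have hlgt := tendsto_log_ray_atTop hα hp
  have hlgb := (tendsto_log_ray_atBot (α := α) hp).comp tendsto_neg_atTop_atBot
  have htot := (hT'.sub hBt').add ((hlgt.sub hlgb).const_mul A)
  have h2 : Tendsto (fun R : ℝ => (∫ x in (-R)..R, symbolDensity α q (rayPoint α x) /
      (p - Complex.exp (rayPoint α x))).im) atTop (𝓝 (A * Real.pi)) := by
    simp only [Complex.zero_re, sub_zero, zero_add] at htot
    refine htot.congr' ?_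
    filter_upwards [eventually_gt_atTop 0] with R hR
    rw [hfin R hR]
    rfl
  rw [mul_comm Real.pi]
  exact tendsto_nhds_unique hlim' h2

/-! ### Laplace transform of the ray integral -/

/-- With q < κ the bound t^(κ-q-1) is integrable at t = 0; with κ < q + 1 the integral along the ray
converges. Both are needed for Fubini. -/
theorem exists_exponent_near {α q : ℝ} (hα : 0 < α) (hq : -1 < q) (hqα : q < α) :
    ∃ κ : ℝ, 0 ≤ κ ∧ κ ≤ α ∧ q < κ ∧ κ < q + 1 := by
  by_cases h : q < 0
  · exact ⟨0, le_rfl, hα.le, h, by linarith⟩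
  · push Not at h
    refine ⟨min ((q + α) / 2) (q + 1 / 2), ?_, ?_, ?_, ?_⟩
    · exact le_min (by linarith) (by linarith)
    · exact (min_le_left _ _).trans (by linarith)
    · exact lt_min (by linarith) (by linarith)
    · exact (min_le_right _ _).trans_lt (by linarith)

theorem integrableOn_rpow_mul_exp_neg_mul {a p : ℝ} (ha : 0 < a) (hp : 0 < p) :
    IntegrableOn (fun t : ℝ => t ^ (a - 1) * Real.exp (-(p * t))) (Ioi 0) := by
  by_contra h
  have h0 := Real.integral_rpow_mul_exp_neg_mul_Ioi ha hp
  rw [integral_undef h] at h0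
  have : 0 < (1 / p) ^ a * Real.Gamma a := by
    have := Real.Gamma_pos_of_pos ha
    positivity
  linarith

theorem integrable_laplace_rayIntegrand {α q p : ℝ} (hα : 1 < α ∧ α < 2) (hq : -1 < q)
    (hqα : q < α) (hp : 0 < p) :
    Integrable (fun y : ℝ × ℝ => (Real.exp (-(p * y.1)) : ℂ) * rayIntegrand α q y.1 y.2)
      ((volume.restrict (Ioi 0)).prod volume) := by
  obtain ⟨κ, h0, h1, h2, h3⟩ := exists_exponent_near (by linarith) hq hqα
  have hc := rayDecay_pos hα
  have hk := sectorConst_pos hα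
  have hcont : Continuous fun y : ℝ × ℝ =>
      (Real.exp (-(p * y.1)) : ℂ) * rayIntegrand α q y.1 y.2 :=
    Continuous.mul (by fun_prop) (continuous_rayIntegrand q hα)
  have hB : Integrable (fun y : ℝ × ℝ => Real.exp (-(p * y.1)) * ((sectorConst α)⁻¹ *
      (Real.exp (-(rayDecay α * y.1 * Real.exp y.2)) * Real.exp ((q + 1 - κ) * y.2))))
      ((volume.restrict (Ioi 0)).prod volume) := by
    refine (integrable_prod_iff (by fun_prop)).2 ⟨?_, ?_⟩
    · filter_upwards [ae_restrict_mem measurableSet_Ioi] with t ht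
      have ht : 0 < t := ht
      exact (((integrable_exp_neg_mul_exp (by positivity) (by linarith)).1).const_mul _).const_mul _
    · have hi := (integrableOn_rpow_mul_exp_neg_mul (a := κ - q) (by linarith) hp).const_mul
        ((sectorConst α)⁻¹ * (Real.Gamma (q + 1 - κ) * rayDecay α ^ (-(q + 1 - κ))))
      refine hi.congr ?_
      filter_upwards [ae_restrict_mem measurableSet_Ioi] with t ht
      have ht : 0 < t := ht
      have hn : ∀ x : ℝ, ‖Real.exp (-(p * t)) * ((sectorConst α)⁻¹ *
          (Real.exp (-(rayDecay α * t * Real.exp x)) * Real.exp ((q + 1 - κ) * x)))‖ =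
          Real.exp (-(p * t)) * ((sectorConst α)⁻¹ *
          (Real.exp (-(rayDecay α * t * Real.exp x)) * Real.exp ((q + 1 - κ) * x))) :=
        fun x => Real.norm_of_nonneg (by positivity)
      simp_rw [hn]
      rw [integral_const_mul, integral_const_mul,
        (integrable_exp_neg_mul_exp (by positivity) (by linarith)).2, Real.mul_rpow hc.le ht.le,
        show κ - q - 1 = -(q + 1 - κ) by ring]
      ring
  refine hB.mono' hcont.aestronglyMeasurable (Eventually.of_forall fun y => ?_)
  rw [norm_mul, Complex.norm_real, Real.norm_of_nonneg (Real.exp_pos _).le]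
  gcongr
  exact norm_rayIntegrand_le hα h0 h1 _ _

/-- After exchanging the integrals, integration of exp(-(p - s)t) in t gives 1 / (p - s), since Re s
< 0 on the ray; the contour evaluation finishes. -/
theorem laplace_rayTransform {α q p : ℝ} (hα : 1 < α ∧ α < 2) (hq : -1 < q)
    (hqα : q < α) (hp : 0 < p) :
    IntegrableOn (fun t => Real.exp (-(p * t)) * rayTransform α q t) (Ioi 0) ∧
    ∫ t in Ioi (0 : ℝ), Real.exp (-(p * t)) * rayTransform α q t = symbolValue α q p := by
  have hpi := Real.pi_pos
  have hI := integrable_laplace_rayIntegrand hα hq hqα hp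
  have hc := rayDecay_pos hα
  have hswap := integral_integral_swap (f := fun t x : ℝ =>
    (Real.exp (-(p * t)) : ℂ) * rayIntegrand α q t x) hI
  have hleft := hI.integral_prod_left
  have hin : ∀ t x : ℝ, (Real.exp (-(p * t)) : ℂ) * rayIntegrand α q t x =
      Complex.exp ((-(p - Complex.exp (rayPoint α x))) * t) * symbolDensity α q (rayPoint α x) := by
    intro t x
    unfold rayIntegrand
    rw [Complex.ofReal_exp, ← mul_assoc, ← Complex.exp_add]
    congr 2
    push_cast
    ring
  have hin2 : ∀ x : ℝ, ∫ t in Ioi (0 : ℝ), (Real.exp (-(p * t)) : ℂ) * rayIntegrand α q t x =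
      symbolDensity α q (rayPoint α x) / (p - Complex.exp (rayPoint α x)) := by
    intro x
    simp_rw [hin]
    rw [integral_mul_const, integral_exp_mul_complex_Ioi]
    · simp only [Complex.ofReal_zero, mul_zero, Complex.exp_zero]
      rw [neg_div_neg_eq]
      ring
    · have : 0 < Real.exp x * rayDecay α := by positivity
      unfold rayDecay at this
      simp only [Complex.neg_re, Complex.sub_re, Complex.ofReal_re, Complex.exp_re, rayPoint_re,
        rayPoint_im]
      linarith
  have hright := hI.integral_prod_right
  have e1 : ∀ t : ℝ, Real.exp (-(p * t)) * rayTransform α q t =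
      Real.pi⁻¹ * (∫ x : ℝ, (Real.exp (-(p * t)) : ℂ) * rayIntegrand α q t x).im := by
    intro t
    rw [integral_const_mul, Complex.im_ofReal_mul, rayTransform]
    ring
  simp_rw [e1]
  constructor
  · exact (hleft.im).const_mul _
  · rw [integral_const_mul]
    have h3 : ∫ t in Ioi (0 : ℝ), (∫ x : ℝ, (Real.exp (-(p * t)) : ℂ) * rayIntegrand α q t x).im =
        (∫ t in Ioi (0 : ℝ), ∫ x : ℝ, (Real.exp (-(p * t)) : ℂ) * rayIntegrand α q t x).im :=
      integral_im hleft
    rw [h3, hswap]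
    simp_rw [hin2] at hright ⊢
    rw [im_integral_symbolDensity_div hα hq hqα hp hright]
    field_simp

/-! ### Laplace transform calculus -/

/-- Lerch's theorem: uniqueness of the Laplace transform. -/
theorem ae_eq_zero_of_laplace_eq_zero {h : ℝ → ℝ}
    (hint : IntegrableOn (fun t => Real.exp (-t) * h t) (Ioi 0))
    (hzero : ∀ p : ℝ, 1 ≤ p → ∫ t in Ioi (0 : ℝ), Real.exp (-(p * t)) * h t = 0) :
    ∀ᵐ t, t ∈ Ioi (0 : ℝ) → h t = 0 := by
  set k : ℝ → ℝ := fun t => Real.exp (-t) * h t with hk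
  suffices hk0 : ∀ᵐ t, t ∈ Ioi (0 : ℝ) → k t = 0 by
    filter_upwards [hk0] with t ht htp
    exact (mul_eq_zero.1 (ht htp)).resolve_left (Real.exp_pos _).ne'
  -- Integer values of p suffice: with x = e^{-t} they are the moments on [0, 1], and Weierstrass
  -- approximation applies to test functions.
  have hmono : ∀ n : ℕ, ∫ t in Ioi (0 : ℝ), Real.exp (-t) ^ n * k t = 0 := by
    intro n
    refine Eq.trans ?_ (hzero (n + 1) (by linarith [n.cast_nonneg (α := ℝ)]))
    congr 1
    funext t
    rw [hk, ← Real.exp_nat_mul, ← mul_assoc, ← Real.exp_add]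
    congr 2
    ring
  have hbd : ∀ t ∈ Ioi (0 : ℝ), Real.exp (-t) ∈ Icc (0 : ℝ) 1 := fun t ht =>
    ⟨(Real.exp_pos _).le, Real.exp_le_one_iff.2 (by linarith [show (0 : ℝ) < t from ht])⟩
  have hintp : ∀ P : Polynomial ℝ, IntegrableOn (fun t => P.eval (Real.exp (-t)) * k t) (Ioi 0) := by
    intro P
    obtain ⟨C, hC⟩ := isCompact_Icc.exists_bound_of_continuousOn
      (P.continuous.continuousOn (s := Icc (0 : ℝ) 1))
    refine hint.bdd_mul (c := C) (Continuous.aestronglyMeasurable (by fun_prop)) ?_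
    filter_upwards [ae_restrict_mem measurableSet_Ioi] with t ht
    exact hC _ (hbd t ht)
  have hpoly : ∀ P : Polynomial ℝ, ∫ t in Ioi (0 : ℝ), P.eval (Real.exp (-t)) * k t = 0 := by
    intro P
    induction P using Polynomial.induction_on' with
    | add P Q hP hQ =>
      simp_rw [Polynomial.eval_add, add_mul]
      rw [integral_add (hintp P) (hintp Q), hP, hQ, add_zero]
    | monomial n a =>
      simp_rw [Polynomial.eval_monomial, mul_assoc]
      rw [integral_const_mul, hmono, mul_zero]
  refine isOpen_Ioi.ae_eq_zero_of_integral_contDiff_smul_eq_zero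
    (IntegrableOn.locallyIntegrableOn hint) fun g hg hgc hgs => ?_
  have hg0 : ∀ t, t ≤ 0 → g t = 0 := fun t ht =>
    image_eq_zero_of_notMem_tsupport fun h => not_lt.2 ht (hgs h)
  -- Near x = 0 the time -log x leaves the compact support of g, so the function vanishes there.
  have hcont : ContinuousOn (fun x => g (-Real.log x)) (Icc 0 1) := by
    intro x hx
    rcases hx.1.eq_or_lt with h0 | h0
    · rw [← h0]
      obtain ⟨M, hM⟩ := hgc.isCompact.bddAbove
      have hev : ∀ᶠ x in 𝓝 (0 : ℝ), g (-Real.log x) = 0 := by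
        have h1 : ∀ᶠ x in 𝓝[≠] (0 : ℝ), g (-Real.log x) = 0 := by
          filter_upwards [Real.tendsto_log_nhdsNE_zero.eventually_lt_atBot (-M)] with x hx
          exact image_eq_zero_of_notMem_tsupport fun h => by
            have := hM h
            linarith
        rw [eventually_nhdsWithin_iff] at h1
        filter_upwards [h1] with x hx
        by_cases hx0 : x = 0
        -- The convention log 0 = 0 is harmless because g(0) = 0.
        · rw [hx0, Real.log_zero, neg_zero, hg0 0 le_rfl]
        · exact hx hx0
      exact (continuousAt_const.congr (hev.mono fun x hx => hx.symm)).continuousWithinAt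
    · exact (hg.continuous.continuousAt.comp
        (Real.continuousAt_log h0.ne').neg).continuousWithinAt
  have hgk : IntegrableOn (fun t => g t * k t) (Ioi 0) := by
    obtain ⟨C, hC⟩ := hgc.exists_bound_of_continuous hg.continuous
    exact hint.bdd_mul (c := C) hg.continuous.aestronglyMeasurable (Eventually.of_forall hC)
  have hsmall : ∀ ε : ℝ, 0 < ε → |∫ t in Ioi (0 : ℝ), g t * k t| ≤
      ε * ∫ t in Ioi (0 : ℝ), ‖k t‖ := by
    intro ε hε
    obtain ⟨P, hP⟩ := exists_polynomial_near_of_continuousOn 0 1 _ hcont ε hε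
    have hsub : ∫ t in Ioi (0 : ℝ), g t * k t =
        ∫ t in Ioi (0 : ℝ), (g t * k t - P.eval (Real.exp (-t)) * k t) := by
      rw [integral_sub hgk (hintp P), hpoly, sub_zero]
    rw [hsub, ← integral_const_mul, ← Real.norm_eq_abs]
    refine norm_integral_le_of_norm_le (hint.norm.const_mul ε) ?_
    filter_upwards [ae_restrict_mem measurableSet_Ioi] with t ht
    rw [← sub_mul, norm_mul]
    gcongr
    have := hP _ (hbd t ht)
    rw [Real.log_exp, neg_neg] at this
    rw [Real.norm_eq_abs, abs_sub_comm]
    exact this.le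
  have hI0 : ∫ t in Ioi (0 : ℝ), g t * k t = 0 := by
    by_contra hne
    have hpos := abs_pos.2 hne
    set N := ∫ t in Ioi (0 : ℝ), ‖k t‖
    have hN : 0 ≤ N := integral_nonneg fun _ => norm_nonneg _
    -- This tolerance would bound the integral by less than itself, since N / (2(N+1)) < 1.
    have := hsmall (|∫ t in Ioi (0 : ℝ), g t * k t| / (2 * (N + 1))) (by positivity)
    rw [div_mul_eq_mul_div, le_div_iff₀ (by positivity)] at this
    nlinarith
  rw [← hI0, ← integral_indicator measurableSet_Ioi]
  congr 1
  funext t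
  by_cases ht : t ∈ Ioi (0 : ℝ)
  · rw [indicator_of_mem ht, smul_eq_mul]
  · rw [indicator_of_notMem ht, hg0 t (not_lt.1 ht), zero_smul]

/-- On `[1, ∞)`, `F` is the Laplace transform of `f`. -/
def HasLaplace (f F : ℝ → ℝ) : Prop :=
  ∀ p : ℝ, 1 ≤ p → IntegrableOn (fun t => Real.exp (-(p * t)) * f t) (Ioi 0) ∧
    ∫ t in Ioi (0 : ℝ), Real.exp (-(p * t)) * f t = F p

theorem HasLaplace.sub {f g F G : ℝ → ℝ} (hf : HasLaplace f F) (hg : HasLaplace g G) :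
    HasLaplace (fun t => f t - g t) (fun p => F p - G p) := by
  intro p hp
  simp_rw [mul_sub]
  exact ⟨(hf p hp).1.sub (hg p hp).1, by
    rw [integral_sub (hf p hp).1 (hg p hp).1, (hf p hp).2, (hg p hp).2]⟩

theorem HasLaplace.ae_eq {f g F G : ℝ → ℝ} (hf : HasLaplace f F) (hg : HasLaplace g G)
    (h : ∀ p, 1 ≤ p → F p = G p) : ∀ᵐ t, t ∈ Ioi (0 : ℝ) → f t = g t := by
  have hs := hf.sub hg
  have := ae_eq_zero_of_laplace_eq_zero (h := fun t => f t - g t)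
    (by simpa using (hs 1 le_rfl).1) (fun p hp => (hs p hp).2.trans (sub_eq_zero.2 (h p hp)))
  filter_upwards [this] with t ht htp
  exact sub_eq_zero.1 (ht htp)

theorem hasLaplace_rayTransform {α q : ℝ} (hα : 1 < α ∧ α < 2) (hq : -1 < q) (hqα : q < α) :
    HasLaplace (rayTransform α q) (symbolValue α q) := fun _ hp =>
  laplace_rayTransform hα hq hqα (by linarith)

theorem hasLaplace_omega {b : ℝ} (hb : 0 < b) : HasLaplace (omega b) (fun p => p ^ (-b)) := by
  intro p hp
  have hp0 : 0 < p := by linarith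
  have hG := Real.Gamma_pos_of_pos hb
  have e : ∀ t : ℝ, Real.exp (-(p * t)) * omega b t =
      t ^ (b - 1) * Real.exp (-(p * t)) / Real.Gamma b := fun t => by
    unfold omega
    ring
  simp_rw [e]
  refine ⟨(integrableOn_rpow_mul_exp_neg_mul hb hp0).div_const _, ?_⟩
  rw [integral_div, Real.integral_rpow_mul_exp_neg_mul_Ioi hb hp0, one_div, Real.inv_rpow hp0.le,
    Real.rpow_neg hp0.le]
  field_simp

/-- The weight e^{-px} factors over a convolution, so the weighted fractional integral is a
convolution of two integrable functions. -/
theorem HasLaplace.riemannLiouville {f F : ℝ → ℝ} {b : ℝ} (hb : 0 < b) (hf : HasLaplace f F) :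
    HasLaplace (fracIntegral b f) (fun p => p ^ (-b) * F p) := by
  intro p hp
  obtain ⟨h1, h2⟩ := hf p hp
  obtain ⟨h3, h4⟩ := hasLaplace_omega hb p hp
  have e : ∀ x : ℝ, Real.exp (-(p * x)) * fracIntegral b f x =
      ∫ t in (0 : ℝ)..x, ContinuousLinearMap.mul ℝ ℝ (Real.exp (-(p * t)) * f t)
        (Real.exp (-(p * (x - t))) * omega b (x - t)) := by
    intro x
    unfold fracIntegral
    rw [← intervalIntegral.integral_const_mul]
    congr 1
    funext t
    have : Real.exp (-(p * x)) = Real.exp (-(p * t)) * Real.exp (-(p * (x - t))) := by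
      rw [← Real.exp_add]
      ring_nf
    rw [this, smul_eq_mul, ContinuousLinearMap.mul_apply']
    ring
  simp_rw [e]
  constructor
  · have := (integrable_posConvolution h1 h3 (ContinuousLinearMap.mul ℝ ℝ)).integrableOn (s := Ioi 0)
    exact this.congr_fun (fun x hx => by
      rw [posConvolution, indicator_of_mem hx]) measurableSet_Ioi
  · rw [integral_posConvolution h1 h3 (ContinuousLinearMap.mul ℝ ℝ), h2, h4,
      ContinuousLinearMap.mul_apply', mul_comm]

theorem omega_one (t : ℝ) : omega 1 t = 1 := by simp [omega]

theorem fracIntegral_one {E : Type*} [NormedAddCommGroup E] [NormedSpace ℝ E] (f : ℝ → E) (t : ℝ) :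
    fracIntegral 1 f t = ∫ s in (0 : ℝ)..t, f s := by
  simp [fracIntegral, omega_one]

theorem HasLaplace.primitive {f F : ℝ → ℝ} (hf : HasLaplace f F) :
    HasLaplace (fun t => ∫ s in (0 : ℝ)..t, f s) (fun p => p⁻¹ * F p) := by
  have := hf.riemannLiouville one_pos
  simp only [Real.rpow_neg_one] at this
  rwa [show fracIntegral 1 f = fun t => ∫ s in (0 : ℝ)..t, f s from
    funext (fracIntegral_one f)] at this

theorem HasLaplace.intervalIntegrable {f F : ℝ → ℝ} (hf : HasLaplace f F) (T : ℝ) (hT : 0 ≤ T) :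
    IntervalIntegrable f volume 0 T := by
  rw [intervalIntegrable_iff_integrableOn_Ioc_of_le hT]
  have h := (hf 1 le_rfl).1.mono_set (Ioc_subset_Ioi_self : Ioc 0 T ⊆ Ioi 0)
  have h2 : IntegrableOn (fun t => Real.exp t * (Real.exp (-(1 * t)) * f t)) (Ioc 0 T) := by
    refine h.bdd_mul (c := Real.exp T) Real.continuous_exp.aestronglyMeasurable ?_
    filter_upwards [ae_restrict_mem measurableSet_Ioc] with t ht
    rw [Real.norm_of_nonneg (Real.exp_pos _).le]
    exact Real.exp_le_exp.2 ht.2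
  refine h2.congr_fun (fun t _ => ?_) measurableSet_Ioc
  beta_reduce
  rw [← mul_assoc, ← Real.exp_add]
  simp

theorem continuousOn_rayTransform {α q : ℝ} (hα : 1 < α ∧ α < 2) (hq : -1 < q) :
    ContinuousOn (rayTransform α q) (Ioi 0) := fun _ ht =>
  (hasDerivAt_rayTransform hα hq ht).continuousAt.continuousWithinAt

/-! ### Relaxation functions: identities and decay -/

/-- `E_α(-t ^ α)`. -/
noncomputable def relaxation (α t : ℝ) : ℝ := rayTransform α (α - 1) t

/-- `t E_{α,2}(-t ^ α)`. -/
noncomputable def relaxationPrim (α t : ℝ) : ℝ := ∫ s in (0 : ℝ)..t, relaxation α s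

/-- Writing every power through p and X = p^(α/2) makes the symbol identities below rational ones,
within reach of `field_simp` and `ring`. -/
theorem symbol_powers (α : ℝ) {p : ℝ} (hp : 1 ≤ p) : 0 < p ∧ 0 < p ^ (α / 2) ∧
    p ^ α = (p ^ (α / 2)) ^ 2 ∧ p ^ (α - 1) = (p ^ (α / 2)) ^ 2 / p ∧
    p ^ (-(1 - α / 2)) = p ^ (α / 2) / p ∧ p ^ (3 * (α / 2) - 1) = (p ^ (α / 2)) ^ 3 / p ∧
    p ^ (-(2 - α)) = (p ^ (α / 2)) ^ 2 / p ^ 2 := by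
  have hp0 : 0 < p := by linarith
  have h2 : (p ^ (α / 2)) ^ 2 = p ^ α := by
    rw [← Real.rpow_natCast, ← Real.rpow_mul hp0.le]
    norm_num
  have h3 : (p ^ (α / 2)) ^ 3 = p ^ (3 * (α / 2)) := by
    rw [← Real.rpow_natCast, ← Real.rpow_mul hp0.le]
    norm_num
    ring_nf
  refine ⟨hp0, Real.rpow_pos_of_pos hp0 _, h2.symm, ?_, ?_, ?_, ?_⟩
  · rw [h2, Real.rpow_sub_one hp0.ne']
  · rw [neg_sub, Real.rpow_sub_one hp0.ne']
  · rw [h3, Real.rpow_sub_one hp0.ne']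
  · rw [h2, neg_sub, Real.rpow_sub hp0]
    norm_num

section identities

variable {α : ℝ} (hα : 1 < α ∧ α < 2)
include hα

theorem hasLaplace_relaxation : HasLaplace (relaxation α) (symbolValue α (α - 1)) :=
  hasLaplace_rayTransform hα (by linarith [hα.1]) (by linarith)

/-- On symbols, p^(α-1)/(1+p^α) = 1/p - p^(-1)/(1+p^α). Lerch gives equality almost everywhere, and
continuity on (0, ∞) gives it everywhere. -/
theorem relaxation_eq_one_sub {t : ℝ} (ht : 0 < t) :
    relaxation α t = 1 - ∫ s in (0 : ℝ)..t, rayTransform α 0 s := by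
  have hL0 := hasLaplace_rayTransform hα (q := 0) (by norm_num) (by linarith [hα.1])
  have hae := (hasLaplace_relaxation hα).ae_eq ((hasLaplace_omega one_pos).sub hL0.primitive)
    (fun p hp => by
      obtain ⟨h0, h1, h2, h3, h4, h5, h6⟩ := symbol_powers α hp
      simp only [symbolValue, h2, h3, Real.rpow_neg_one, Real.rpow_zero]
      field_simp
      ring)
  have hc1 : ContinuousOn (relaxation α) (Ioi 0) :=
    continuousOn_rayTransform hα (by linarith [hα.1])
  have hc2 : ContinuousOn (fun t => omega 1 t - ∫ s in (0 : ℝ)..t, rayTransform α 0 s) (Ioi 0) := by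
    simp_rw [omega_one]
    refine continuousOn_const.sub fun t ht => ?_
    have ht0 : (0 : ℝ) < t := ht
    have := intervalIntegral.continuousOn_primitive_interval'
      (hL0.intervalIntegrable (t + 1) (by linarith)) left_mem_uIcc
    refine (this.continuousAt ?_).continuousWithinAt
    rw [uIcc_of_le (by linarith)]
    exact Icc_mem_nhds ht0 (by linarith)
  have := Measure.eqOn_open_of_ae_eq (μ := volume) ((ae_restrict_iff' measurableSet_Ioi).2 hae)
    isOpen_Ioi hc1 hc2 ht
  simpa [omega_one] using this

/-- This and the next three identities are the two equations of the system at unit frequency. As v'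
corresponds to p^(α/2) times the symbol of u', the a₀ part of v' has symbol -p^(α/2)/(1+p^α), and
the a₁, f part has p^(3α/2-1)/(1+p^α). -/
theorem primitive_rayTransform_half : ∀ᵐ t, t ∈ Ioi (0 : ℝ) →
    ∫ s in (0 : ℝ)..t, rayTransform α (α / 2) s =
      fracIntegral (1 - α / 2) (rayTransform α 0) t := by
  have hL0 := hasLaplace_rayTransform hα (q := 0) (by norm_num) (by linarith [hα.1])
  have hL1 := hasLaplace_rayTransform hα (q := α / 2) (by linarith [hα.1]) (by linarith [hα.1])
  refine hL1.primitive.ae_eq (hL0.riemannLiouville (by linarith [hα.2])) fun p hp => ?_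
  obtain ⟨h0, h1, h2, h3, h4, h5, h6⟩ := symbol_powers α hp
  simp only [symbolValue, h2, h4, Real.rpow_zero]
  field_simp

theorem primitive_rayTransform_three_half : ∀ᵐ t, t ∈ Ioi (0 : ℝ) →
    ∫ s in (0 : ℝ)..t, rayTransform α (3 * (α / 2) - 1) s =
      fracIntegral (1 - α / 2) (relaxation α) t := by
  have hL1 := hasLaplace_rayTransform hα (q := 3 * (α / 2) - 1) (by linarith [hα.1])
    (by linarith [hα.2])
  refine hL1.primitive.ae_eq ((hasLaplace_relaxation hα).riemannLiouville (by linarith [hα.2]))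
    fun p hp => ?_
  obtain ⟨h0, h1, h2, h3, h4, h5, h6⟩ := symbol_powers α hp
  simp only [symbolValue, h2, h3, h4, h5]
  field_simp

theorem fracIntegral_rayTransform_half : ∀ᵐ t, t ∈ Ioi (0 : ℝ) →
    fracIntegral (1 - α / 2) (rayTransform α (α / 2)) t = relaxation α t := by
  have hL1 := hasLaplace_rayTransform hα (q := α / 2) (by linarith [hα.1]) (by linarith [hα.1])
  refine (hL1.riemannLiouville (by linarith [hα.2])).ae_eq (hasLaplace_relaxation hα) fun p hp => ?_
  obtain ⟨h0, h1, h2, h3, h4, h5, h6⟩ := symbol_powers α hp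
  simp only [symbolValue, h2, h3, h4]
  field_simp

theorem fracIntegral_rayTransform_three_half : ∀ᵐ t, t ∈ Ioi (0 : ℝ) →
    fracIntegral (1 - α / 2) (rayTransform α (3 * (α / 2) - 1)) t =
      omega (2 - α) t - relaxationPrim α t := by
  have hL1 := hasLaplace_rayTransform hα (q := 3 * (α / 2) - 1) (by linarith [hα.1])
    (by linarith [hα.2])
  refine (hL1.riemannLiouville (by linarith [hα.2])).ae_eq
    ((hasLaplace_omega (b := 2 - α) (by linarith [hα.2])).sub
      (hasLaplace_relaxation hα).primitive) fun p hp => ?_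
  obtain ⟨h0, h1, h2, h3, h4, h5, h6⟩ := symbol_powers α hp
  simp only [symbolValue, h2, h3, h4, h5, h6]
  field_simp
  ring

end identities

/-- The successive derivatives of `t E_{α,2}(-t ^ α)` on `(0, ∞)`. -/
noncomputable def relaxationDeriv (α : ℝ) : ℕ → ℝ → ℝ
  | 0, t => relaxationPrim α t
  | 1, t => relaxation α t
  | n + 2, t => -rayTransform α n t

section bounds

variable {α : ℝ} (hα : 1 < α ∧ α < 2)
include hα

theorem hasDerivAt_relaxationPrim {t : ℝ} (ht : 0 < t) :
    HasDerivAt (relaxationPrim α) (relaxation α t) t := by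
  have hc : ContinuousOn (relaxation α) (Ioi 0) :=
    continuousOn_rayTransform hα (by linarith [hα.1])
  exact intervalIntegral.integral_hasDerivAt_right
    ((hasLaplace_relaxation hα).intervalIntegrable t ht.le)
    (hc.stronglyMeasurableAtFilter isOpen_Ioi t ht) (hc.continuousAt (Ioi_mem_nhds ht))

theorem hasDerivAt_relaxation {t : ℝ} (ht : 0 < t) :
    HasDerivAt (relaxation α) (-rayTransform α 0 t) t := by
  have hL0 := hasLaplace_rayTransform hα (q := 0) (by norm_num) (by linarith [hα.1])
  have hc : ContinuousOn (rayTransform α 0) (Ioi 0) := continuousOn_rayTransform hα (by norm_num)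
  have h1 := (intervalIntegral.integral_hasDerivAt_right (hL0.intervalIntegrable t ht.le)
    (hc.stronglyMeasurableAtFilter isOpen_Ioi t ht) (hc.continuousAt (Ioi_mem_nhds ht))).const_sub 1
  refine h1.congr_of_eventuallyEq ?_
  filter_upwards [Ioi_mem_nhds ht] with s hs
  exact relaxation_eq_one_sub hα hs

theorem hasDerivAt_relaxationDeriv (n : ℕ) {t : ℝ} (ht : 0 < t) :
    HasDerivAt (relaxationDeriv α n) (relaxationDeriv α (n + 1) t) t := by
  match n with
  | 0 => exact hasDerivAt_relaxationPrim hα ht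
  | 1 =>
    change HasDerivAt (relaxation α) (-rayTransform α ((0 : ℕ) : ℝ) t) t
    simpa using hasDerivAt_relaxation hα ht
  | n + 2 =>
    have := (hasDerivAt_rayTransform hα (q := n) (by linarith [n.cast_nonneg (α := ℝ)]) ht).fun_neg
    change HasDerivAt (fun s => -rayTransform α n s) (-rayTransform α ((n + 1 : ℕ) : ℝ) t) t
    simpa using this

theorem relaxationDeriv_eq_rayTransform (n : ℕ) {t : ℝ} (ht : 0 < t) :
    relaxationDeriv α (n + 1) t = rayTransform α (α - 1 + n) t := by
  induction n generalizing t with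
  | zero => simp [relaxationDeriv, relaxation]
  | succ n ih =>
    have h1 := hasDerivAt_relaxationDeriv hα (n + 1) ht
    have h2 := hasDerivAt_rayTransform hα (q := α - 1 + n)
      (by linarith [n.cast_nonneg (α := ℝ), hα.1]) ht
    have h3 := h1.congr_of_eventuallyEq (f₁ := rayTransform α (α - 1 + n))
      (by filter_upwards [Ioi_mem_nhds ht] with s hs using (ih hs).symm)
    rw [h3.unique h2]
    push_cast
    ring_nf

/-- Here κ = 3α/4, so that κ - (α - 1 + n) - 1 = -n - α/4. -/
theorem abs_relaxationDeriv_le_succ (n : ℕ) : ∃ C : ℝ, 0 < C ∧ ∀ t : ℝ, 0 < t →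
    |relaxationDeriv α (n + 1) t| ≤ C * t ^ (1 - ((n + 1 : ℕ) : ℝ) - α / 4) := by
  have hn := n.cast_nonneg (α := ℝ)
  obtain ⟨C, hC, h⟩ := abs_rayTransform_le (q := α - 1 + n) (κ := 3 * α / 4) hα
    (by linarith [hα.1]) (by linarith [hα.1]) (by linarith [hα.1])
  refine ⟨C, hC, fun t ht => ?_⟩
  rw [relaxationDeriv_eq_rayTransform hα n ht]
  convert h t ht using 3
  push_cast
  ring

/-- One derivative more under the same power of t as in the previous bound, obtained with κ = 1 -
α/4 in the other representation. The extra derivative is what the a₀ part costs in frequency. -/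
theorem abs_relaxationDeriv_le_add_two (n : ℕ) : ∃ C : ℝ, 0 < C ∧ ∀ t : ℝ, 0 < t →
    |relaxationDeriv α (n + 2) t| ≤ C * t ^ (1 - ((n + 1 : ℕ) : ℝ) - α / 4) := by
  have hn := n.cast_nonneg (α := ℝ)
  obtain ⟨C, hC, h⟩ := abs_rayTransform_le (q := n) (κ := 1 - α / 4) hα
    (by linarith [hα.2]) (by linarith [hα.1]) (by linarith [hα.1])
  refine ⟨C, hC, fun t ht => ?_⟩
  rw [relaxationDeriv, abs_neg]
  convert h t ht using 3
  push_cast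
  ring

theorem abs_relaxationPrim_le : ∃ C : ℝ, 0 < C ∧ ∀ t : ℝ, 0 < t →
    |relaxationPrim α t| ≤ C * t ^ (1 - α / 4) := by
  obtain ⟨C, hC, h⟩ := abs_relaxationDeriv_le_succ hα 0
  have h1 : 0 < 1 - α / 4 := by linarith [hα.2]
  refine ⟨C / (1 - α / 4), by positivity, fun t ht => ?_⟩
  have hi : ∫ s in (0 : ℝ)..t, C * s ^ (-(α / 4)) = C / (1 - α / 4) * t ^ (1 - α / 4) := by
    rw [intervalIntegral.integral_const_mul, integral_rpow (by left; linarith),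
      show -(α / 4) + 1 = 1 - α / 4 by ring, Real.zero_rpow h1.ne']
    ring
  rw [← hi, ← Real.norm_eq_abs]
  refine intervalIntegral.norm_integral_le_of_norm_le ht.le (Eventually.of_forall fun s hs => ?_)
    ((intervalIntegral.intervalIntegrable_rpow' (r := -(α / 4)) (by linarith)).const_mul C)
  have := h s hs.1
  rw [show 1 - ((0 + 1 : ℕ) : ℝ) - α / 4 = -(α / 4) by push_cast; ring] at this
  exact this

/-- Time decay of the derivatives of `t E_{α,2}(-t ^ α)`. -/
theorem abs_relaxationDeriv_le (n : ℕ) : ∃ C : ℝ, 0 < C ∧ ∀ t : ℝ, 0 < t →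
    |relaxationDeriv α n t| ≤ C * t ^ (1 - (n : ℝ) - α / 4) := by
  cases n with
  | zero => simpa [relaxationDeriv] using abs_relaxationPrim_le hα
  | succ n => exact abs_relaxationDeriv_le_succ hα n

/-- For t ≥ 1 the power decay suffices; for t ≤ 1 use 1 minus the integral of a function of size
s^(-α/4), integrable at 0. -/
theorem abs_relaxation_le : ∃ C : ℝ, 0 < C ∧ ∀ t : ℝ, 0 < t → |relaxation α t| ≤ C := by
  obtain ⟨C, hC, h⟩ := abs_relaxationDeriv_le_succ hα 0
  obtain ⟨D, hD, h'⟩ := abs_relaxationDeriv_le_add_two hα 0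
  have h1 : 0 < 1 - α / 4 := by linarith [hα.2]
  refine ⟨max C (1 + D / (1 - α / 4)), lt_max_of_lt_left hC, fun t ht => ?_⟩
  rcases le_total 1 t with h2 | h2
  · refine le_trans ?_ (le_max_left _ _)
    refine (h t ht).trans (mul_le_of_le_one_right hC.le ?_)
    exact Real.rpow_le_one_of_one_le_of_nonpos h2 (by push_cast; linarith [hα.1])
  · refine le_trans ?_ (le_max_right _ _)
    rw [relaxation_eq_one_sub hα ht]
    have hi : ∫ s in (0 : ℝ)..t, D * s ^ (-(α / 4)) = D / (1 - α / 4) * t ^ (1 - α / 4) := by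
      rw [intervalIntegral.integral_const_mul, integral_rpow (by left; linarith),
        show -(α / 4) + 1 = 1 - α / 4 by ring, Real.zero_rpow h1.ne']
      ring
    have hb : |∫ s in (0 : ℝ)..t, rayTransform α 0 s| ≤ D / (1 - α / 4) * t ^ (1 - α / 4) := by
      rw [← hi, ← Real.norm_eq_abs]
      refine intervalIntegral.norm_integral_le_of_norm_le ht.le
        (Eventually.of_forall fun s hs => ?_)
        ((intervalIntegral.intervalIntegrable_rpow' (r := -(α / 4)) (by linarith)).const_mul D)
      have := h' s hs.1
      rw [relaxationDeriv, abs_neg] at this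
      convert this using 3
      · simp
      · push_cast
        ring
    have hb2 : D / (1 - α / 4) * t ^ (1 - α / 4) ≤ D / (1 - α / 4) :=
      mul_le_of_le_one_right (by positivity) (Real.rpow_le_one ht.le h2 h1.le)
    calc |1 - ∫ s in (0 : ℝ)..t, rayTransform α 0 s|
        ≤ |1| + |∫ s in (0 : ℝ)..t, rayTransform α 0 s| := abs_sub _ _
      _ ≤ 1 + D / (1 - α / 4) := by
        rw [abs_one]
        linarith

end bounds

/-! ### Fractional integrals and Volterra uniqueness -/

theorem measurable_omega (b : ℝ) : Measurable (omega b) := by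
  unfold omega
  fun_prop

theorem omega_nonneg {b t : ℝ} (hb : 0 < b) (ht : 0 ≤ t) : 0 ≤ omega b t :=
  div_nonneg (Real.rpow_nonneg ht _) (Real.Gamma_pos_of_pos hb).le

theorem omega_pos {b t : ℝ} (hb : 0 < b) (ht : 0 < t) : 0 < omega b t :=
  div_pos (Real.rpow_pos_of_pos ht _) (Real.Gamma_pos_of_pos hb)

theorem omega_mul {b c t : ℝ} (hc : 0 < c) (ht : 0 ≤ t) :
    omega b (c * t) = c ^ (b - 1) * omega b t := by
  unfold omega
  rw [Real.mul_rpow hc.le ht]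
  ring

theorem omega_le {b t T : ℝ} (hb : 1 ≤ b) (ht : 0 ≤ t) (htT : t ≤ T) : omega b t ≤ omega b T := by
  unfold omega
  have := Real.Gamma_pos_of_pos (show 0 < b by linarith)
  have : 0 ≤ b - 1 := by linarith
  gcongr

theorem fracIntegral_comp_mul {E : Type*} [NormedAddCommGroup E] [NormedSpace ℝ E] (b : ℝ)
    (g : ℝ → E) {c t : ℝ} (hc : 0 < c) (ht : 0 ≤ t) :
    fracIntegral b (fun s => g (c * s)) t = c ^ (-b) • fracIntegral b g (c * t) := by
  unfold fracIntegral
  have h1 : ∀ s ∈ uIcc 0 t, omega b (t - s) • g (c * s) =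
      c ^ (1 - b) • (omega b (c * t - c * s) • g (c * s)) := by
    intro s hs
    rw [uIcc_of_le ht] at hs
    rw [← mul_sub, omega_mul hc (by linarith [hs.2]), smul_smul, ← mul_assoc, ← Real.rpow_add hc]
    simp
  rw [intervalIntegral.integral_congr h1, intervalIntegral.integral_smul,
    intervalIntegral.integral_comp_mul_left (fun s => omega b (c * t - s) • g s) hc.ne', smul_smul,
    mul_zero]
  congr 1
  rw [sub_eq_add_neg, Real.rpow_add hc, Real.rpow_one]
  field_simp

/-- Lerch gives the convolution identity almost everywhere, hence at some point s. Both sides are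
homogeneous of degree a + b - 1, so it spreads from s to every t. -/
theorem fracIntegral_omega {a b t : ℝ} (ha : 0 < a) (hb : 0 < b) (ht : 0 < t) :
    fracIntegral a (omega b) t = omega (a + b) t := by
  have hae := ((hasLaplace_omega hb).riemannLiouville ha).ae_eq (hasLaplace_omega (add_pos ha hb))
    (fun p hp => by
      have : 0 < p := by linarith
      rw [← Real.rpow_add this]
      ring_nf)
  obtain ⟨s, hs0, hs⟩ : ∃ s : ℝ, 0 < s ∧ fracIntegral a (omega b) s = omega (a + b) s := by
    by_contra! hne
    have : volume (Ioi (0 : ℝ)) = 0 := by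
      rw [ae_iff] at hae
      refine measure_mono_null (fun s hs => ?_) hae
      simp only [mem_ofPred_eq, Classical.not_imp]
      exact ⟨hs, hne s hs⟩
    simp at this
  have hc : 0 < t / s := by positivity
  have h1 := fracIntegral_comp_mul a (omega b) hc hs0.le
  rw [div_mul_cancel₀ _ hs0.ne'] at h1
  have h2 : fracIntegral a (fun r => omega b (t / s * r)) s =
      (t / s) ^ (b - 1) * fracIntegral a (omega b) s := by
    unfold fracIntegral
    rw [← intervalIntegral.integral_const_mul]
    refine intervalIntegral.integral_congr fun r hr => ?_
    rw [uIcc_of_le hs0.le] at hr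
    simp only [smul_eq_mul]
    rw [omega_mul hc hr.1]
    ring
  rw [h2, hs, smul_eq_mul] at h1
  have h3 : omega (a + b) t = (t / s) ^ (a + b - 1) * omega (a + b) s := by
    rw [← omega_mul hc hs0.le, div_mul_cancel₀ _ hs0.ne']
  rw [h3, show a + b - 1 = a + (b - 1) by ring, Real.rpow_add hc, mul_assoc, h1, ← mul_assoc,
    ← Real.rpow_add hc]
  simp

theorem integral_omega_mul_omega {a b r t : ℝ} (ha : 0 < a) (hb : 0 < b) (hrt : r < t) :
    IntegrableOn (fun s => omega a (t - s) * omega b (s - r)) (Ioc r t) ∧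
      ∫ s in Ioc r t, omega a (t - s) * omega b (s - r) = omega (a + b) (t - r) := by
  have h := fracIntegral_omega ha hb (sub_pos.2 hrt)
  have h2 : ∫ s in r..t, omega a (t - s) * omega b (s - r) = omega (a + b) (t - r) := by
    rw [← h, fracIntegral]
    have := intervalIntegral.integral_comp_sub_right (a := r) (b := t)
      (fun s => omega a (t - r - s) • omega b s) r
    rw [sub_self] at this
    rw [← this]
    refine intervalIntegral.integral_congr fun s _ => ?_
    simp [smul_eq_mul]
  rw [intervalIntegral.integral_of_le hrt.le] at h2
  refine ⟨?_, h2⟩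
  -- Integrability is read off from the nonzero value of the integral.
  by_contra hn
  rw [integral_undef hn] at h2
  exact (omega_pos (add_pos ha hb) (sub_pos.2 hrt)).ne h2

theorem integrableOn_omega {b T : ℝ} (hb : 0 < b) : IntegrableOn (omega b) (Ioc 0 T) := by
  rcases le_total T 0 with h | h
  · simp [Ioc_eq_empty_of_le h]
  · exact (intervalIntegrable_iff_integrableOn_Ioc_of_le h).1
      ((hasLaplace_omega hb).intervalIntegrable T h)

/-- A convolution of two integrable functions, here cut off to (0, T], converges absolutely at
almost every point. Only then do coefficients and linear combinations pass through the fractional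
integral. -/
theorem ae_integrableOn_omega_smul {E : Type*} [NormedAddCommGroup E] [NormedSpace ℝ E]
    {b T : ℝ} (hb : 0 < b) {w : ℝ → E} (hw : IntegrableOn w (Ioc 0 T)) :
    ∀ᵐ t, t ∈ Ioc 0 T → IntegrableOn (fun s => omega b (t - s) • w s) (Ioc 0 t) := by
  have h1 := (integrable_indicator_iff measurableSet_Ioc).2 hw
  have h2 := (integrable_indicator_iff measurableSet_Ioc).2 (integrableOn_omega (T := T) hb)
  filter_upwards [h1.ae_convolution_exists (ContinuousLinearMap.lsmul ℝ ℝ).flip h2] with t ht htT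
  have h3 := (show Integrable _ volume from ht).integrableOn (s := Ioo 0 t)
  rw [integrableOn_Ioc_iff_integrableOn_Ioo]
  refine h3.congr_fun (fun s hs => ?_) measurableSet_Ioo
  have m1 : s ∈ Ioc 0 T := ⟨hs.1, hs.2.le.trans htT.2⟩
  have m2 : t - s ∈ Ioc 0 T := ⟨by linarith [hs.2], by linarith [hs.1, htT.2]⟩
  simp [indicator_of_mem m1, indicator_of_mem m2]

/-- Fubini on the triangle r < s ≤ t, with the convolution of kernels as inner integral. For a + b ≥
1 the resulting kernel is bounded, so integrability of w suffices at every t and not merely almost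
every t. -/
theorem fracIntegral_fracIntegral {a b t : ℝ} (ha : 0 < a) (hb : 0 < b) (hab : 1 ≤ a + b)
    (ht : 0 ≤ t) {w : ℝ → ℝ} (hw : IntegrableOn w (Ioc 0 t)) :
    fracIntegral a (fracIntegral b w) t = fracIntegral (a + b) w t := by
  set μ := volume.restrict (Ioc 0 t) with hμ
  set F : ℝ → ℝ → ℝ := fun s r =>
    (Ioi r).indicator (fun s => omega a (t - s) * omega b (s - r)) s * w r with hF
  have hsec : ∀ r ∈ Ioo 0 t, Integrable (fun s => F s r) μ ∧
      ∫ s, F s r ∂μ = omega (a + b) (t - r) * w r ∧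
      ∫ s, ‖F s r‖ ∂μ = omega (a + b) (t - r) * ‖w r‖ := by
    intro r hr
    obtain ⟨g1, g2⟩ := integral_omega_mul_omega ha hb hr.2
    have hI : Ioc 0 t ∩ Ioi r = Ioc r t := by
      ext s
      simp only [mem_inter_iff, mem_Ioc, mem_Ioi]
      exact ⟨fun h => ⟨h.2, h.1.2⟩, fun h => ⟨⟨hr.1.trans h.1, h.2⟩, h.1⟩⟩
    have h1 : Integrable ((Ioi r).indicator fun s => omega a (t - s) * omega b (s - r)) μ := by
      rw [integrable_indicator_iff measurableSet_Ioi, IntegrableOn, hμ,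
        Measure.restrict_restrict measurableSet_Ioi, inter_comm, hI]
      exact g1
    have h2 : ∫ s, (Ioi r).indicator (fun s => omega a (t - s) * omega b (s - r)) s ∂μ =
        omega (a + b) (t - r) := by
      rw [integral_indicator measurableSet_Ioi, hμ,
        Measure.restrict_restrict measurableSet_Ioi, inter_comm, hI, g2]
    refine ⟨h1.mul_const _, by rw [hF, integral_mul_const, h2], ?_⟩
    rw [← h2, ← integral_mul_const]
    refine setIntegral_congr_fun measurableSet_Ioc fun s hs => ?_
    rw [hF]
    simp only [norm_mul]
    congr 1
    refine Real.norm_of_nonneg ?_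
    by_cases hsr : s ∈ Ioi r
    · rw [indicator_of_mem hsr]
      have : r < s := hsr
      exact mul_nonneg (omega_nonneg ha (by linarith [hs.2])) (omega_nonneg hb (by linarith))
    · rw [indicator_of_notMem hsr]
  have hae : ∀ᵐ r ∂μ, r ∈ Ioo 0 t := by
    rw [hμ, ← Measure.restrict_congr_set Ioo_ae_eq_Ioc]
    exact ae_restrict_mem measurableSet_Ioo
  have hmeas : AEStronglyMeasurable (Function.uncurry F) (μ.prod μ) := by
    have h1 : Measurable fun y : ℝ × ℝ =>
        (Ioi y.2).indicator (fun s => omega a (t - s) * omega b (s - y.2)) y.1 := by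
      have h2 : Measurable fun y : ℝ × ℝ => omega a (t - y.1) * omega b (y.1 - y.2) :=
        ((measurable_omega a).comp (by fun_prop)).mul ((measurable_omega b).comp (by fun_prop))
      exact h2.indicator (measurableSet_lt measurable_snd measurable_fst)
    exact h1.aestronglyMeasurable.mul hw.aestronglyMeasurable.comp_snd
  have hint : Integrable (Function.uncurry F) (μ.prod μ) := by
    refine (integrable_prod_iff' hmeas).2 ⟨?_, ?_⟩
    · filter_upwards [hae] with r hr using (hsec r hr).1
    · have h1 : Integrable (fun r => omega (a + b) (t - r) * ‖w r‖) μ := by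
        refine hw.norm.bdd_mul (c := omega (a + b) t)
          ((measurable_omega _).comp (by fun_prop)).aestronglyMeasurable ?_
        filter_upwards [hae] with r hr
        rw [Real.norm_of_nonneg (omega_nonneg (by linarith) (by linarith [hr.2]))]
        exact omega_le hab (by linarith [hr.2]) (by linarith [hr.1])
      refine h1.congr ?_
      filter_upwards [hae] with r hr using (hsec r hr).2.2.symm
  have hswap := integral_integral_swap hint
  have hR : ∫ r, ∫ s, F s r ∂μ ∂μ = fracIntegral (a + b) w t := by
    rw [fracIntegral, intervalIntegral.integral_of_le ht]
    refine integral_congr_ae ?_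
    filter_upwards [hae] with r hr
    rw [(hsec r hr).2.1, smul_eq_mul]
  have hL : ∫ s, ∫ r, F s r ∂μ ∂μ = fracIntegral a (fracIntegral b w) t := by
    rw [fracIntegral, intervalIntegral.integral_of_le ht]
    refine setIntegral_congr_fun measurableSet_Ioc fun s hs => ?_
    simp only [hF, smul_eq_mul, fracIntegral]
    rw [intervalIntegral.integral_of_le hs.1.le, ← integral_const_mul]
    have h1 : ∀ r, (Ioi r).indicator (fun s => omega a (t - s) * omega b (s - r)) s * w r =
        (Iio s).indicator (fun r => omega a (t - s) * (omega b (s - r) * w r)) r := by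
      intro r
      by_cases hsr : r < s
      · rw [indicator_of_mem (show s ∈ Ioi r from hsr), indicator_of_mem (show r ∈ Iio s from hsr)]
        ring
      · rw [indicator_of_notMem (show s ∉ Ioi r from hsr),
          indicator_of_notMem (show r ∉ Iio s from hsr), zero_mul]
    simp_rw [h1]
    rw [integral_indicator measurableSet_Iio, hμ, Measure.restrict_restrict measurableSet_Iio,
      integral_Ioc_eq_integral_Ioo]
    congr 2
    ext r
    simp only [mem_inter_iff, mem_Iio, mem_Ioc, mem_Ioo]
    exact ⟨fun h => ⟨h.2.1, h.1⟩, fun h => ⟨h.2, h.1, h.2.le.trans hs.2⟩⟩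
  rw [← hL, hswap, hR]

/-- Grönwall's inequality for the primitive of |h|; h is extended continuously to the line by
`projIcc` so that the primitive is differentiable everywhere. -/
theorem eq_zero_of_le_integral {T C : ℝ} {h : ℝ → ℝ} (hc : ContinuousOn h (Icc 0 T))
    (hle : ∀ t ∈ Icc 0 T, |h t| ≤ C * ∫ s in (0 : ℝ)..t, |h s|) : ∀ t ∈ Icc 0 T, h t = 0 := by
  intro t ht
  have hT : 0 ≤ T := ht.1.trans ht.2
  set g : ℝ → ℝ := fun s => |h (projIcc 0 T hT s)| with hg
  have hgc : Continuous g :=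
    (hc.comp_continuous (continuous_subtype_val.comp continuous_projIcc) fun s => Subtype.prop _).abs
  have hgh : ∀ s ∈ Icc 0 T, g s = |h s| := fun s hs => by
    rw [hg]
    simp only [projIcc_of_mem hT hs]
  have hint : ∀ s ∈ Icc 0 T, ∫ r in (0 : ℝ)..s, |h r| = ∫ r in (0 : ℝ)..s, g r := by
    intro s hs
    refine intervalIntegral.integral_congr fun r hr => ?_
    rw [uIcc_of_le hs.1] at hr
    exact (hgh r ⟨hr.1, hr.2.trans hs.2⟩).symm
  have hd : ∀ s : ℝ, HasDerivAt (fun s => ∫ r in (0 : ℝ)..s, g r) (g s) s := fun s =>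
    intervalIntegral.integral_hasDerivAt_right (hgc.intervalIntegrable _ _)
      (hgc.stronglyMeasurableAtFilter _ _) hgc.continuousAt
  have hnn : ∀ s ∈ Icc 0 T, 0 ≤ ∫ r in (0 : ℝ)..s, g r := fun s hs =>
    intervalIntegral.integral_nonneg hs.1 fun r _ => abs_nonneg _
  have hgron := norm_le_gronwallBound_of_norm_deriv_right_le (f := fun s => ∫ r in (0 : ℝ)..s, g r)
    (f' := g) (δ := 0) (K := C) (ε := 0) (a := 0) (b := T)
    (fun s _ => (hd s).continuousAt.continuousWithinAt) (fun s _ => (hd s).hasDerivWithinAt)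
    (by simp) (fun s hs => by
      have hs' : s ∈ Icc 0 T := ⟨hs.1, hs.2.le⟩
      rw [add_zero, Real.norm_of_nonneg (abs_nonneg _), Real.norm_of_nonneg (hnn s hs'), ← hint s hs',
        show |h (projIcc 0 T hT s)| = |h s| from hgh s hs']
      exact hle s hs') t ht
  rw [gronwallBound_ε0_δ0] at hgron
  have h0 := norm_le_zero_iff.1 hgron
  have := hle t ht
  rw [hint t ht, h0, mul_zero] at this
  exact abs_nonpos_iff.1 this

/-- Uniqueness for the scalar symmetric system of order `α / 2`. -/
theorem primitive_eq_zero_of_homogeneous {α T c : ℝ} (hα : 1 < α ∧ α < 2) {du dv : ℝ → ℝ}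
    (hdu : IntegrableOn du (Ioc 0 T)) (hdv : IntegrableOn dv (Ioc 0 T))
    (h1 : ∀ᵐ t, t ∈ Ioo 0 T → ∫ s in (0 : ℝ)..t, dv s = fracIntegral (1 - α / 2) du t)
    (h2 : ∀ᵐ t, t ∈ Ioo 0 T →
      fracIntegral (1 - α / 2) dv t = -(c * ∫ s in (0 : ℝ)..t, du s)) :
    ∀ t ∈ Icc 0 T, ∫ s in (0 : ℝ)..t, du s = 0 := by
  have hb : 0 < α / 2 := by linarith [hα.1]
  have hb' : 0 < 1 - α / 2 := by linarith [hα.2]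
  set h : ℝ → ℝ := fun t => ∫ s in (0 : ℝ)..t, du s with hh
  set k : ℝ → ℝ := fun t => ∫ s in (0 : ℝ)..t, dv s with hk
  have hcongr : ∀ {f g : ℝ → ℝ}, (∀ᵐ t, t ∈ Ioo 0 T → f t = g t) → ∀ t ∈ Icc 0 T,
      fracIntegral (α / 2) f t = fracIntegral (α / 2) g t := by
    intro f g hfg t ht
    unfold fracIntegral
    refine intervalIntegral.integral_congr_ae ?_
    have hne : ∀ᵐ s : ℝ, s ≠ T := by simp [ae_iff]
    filter_upwards [hfg, hne] with s hs hsT hst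
    rw [uIoc_of_le ht.1] at hst
    rw [hs ⟨hst.1, lt_of_le_of_ne (hst.2.trans ht.2) hsT⟩]
  -- Applying I^(α/2) to a Caputo derivative of order α/2 recovers the increment of the function.
  have hsub : ∀ {t : ℝ} {w : ℝ → ℝ}, t ∈ Icc 0 T → IntegrableOn w (Ioc 0 T) →
      fracIntegral (α / 2) (fracIntegral (1 - α / 2) w) t = ∫ s in (0 : ℝ)..t, w s := by
    intro t w ht hw
    rw [fracIntegral_fracIntegral hb hb' (by linarith) ht.1
      (hw.mono_set (Ioc_subset_Ioc_right ht.2)), add_sub_cancel, fracIntegral_one]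
  have hu : ∀ t ∈ Icc 0 T, h t = fracIntegral (α / 2) k t := fun t ht => by
    rw [hcongr h1 t ht, hsub ht hdu]
  have hv : ∀ t ∈ Icc 0 T, k t = -(c * fracIntegral (α / 2) h t) := fun t ht => by
    rw [hk]
    beta_reduce
    rw [← hsub ht hdv, hcongr h2 t ht]
    unfold fracIntegral
    rw [← intervalIntegral.integral_const_mul, ← intervalIntegral.integral_neg]
    congr 1
    funext s
    simp only [smul_eq_mul]
    ring
  rcases lt_or_ge T 0 with hT | hT
  · intro t ht
    exact absurd (ht.1.trans ht.2) (not_le.2 hT)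
  have hcont : ContinuousOn h (Icc 0 T) := by
    have := intervalIntegral.continuousOn_primitive_interval'
      ((intervalIntegrable_iff_integrableOn_Ioc_of_le hT).2 hdu) left_mem_uIcc
    rwa [uIcc_of_le hT] at this
  -- The two half-order relations combine into one Volterra equation of order α > 1, whose kernel is
  -- bounded on [0, T].
  have hvolt : ∀ t ∈ Icc 0 T, h t = -(c * fracIntegral α h t) := by
    intro t ht
    have hi : IntegrableOn h (Ioc 0 t) :=
      ((hcont.mono (Icc_subset_Icc_right ht.2)).integrableOn_Icc).mono_set Ioc_subset_Icc_self
    rw [hu t ht, hcongr (Eventually.of_forall fun s hs => hv s ⟨hs.1.le, hs.2.le⟩) t ht,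
      show fracIntegral α h t = fracIntegral (α / 2 + α / 2) h t by rw [add_halves],
      ← fracIntegral_fracIntegral hb hb (by linarith [hα.1]) ht.1 hi, fracIntegral,
      show fracIntegral (α / 2) (fracIntegral (α / 2) h) t =
        ∫ s in (0 : ℝ)..t, omega (α / 2) (t - s) • fracIntegral (α / 2) h s from rfl,
      ← intervalIntegral.integral_const_mul, ← intervalIntegral.integral_neg]
    congr 1
    funext s
    simp only [smul_eq_mul]
    ring
  refine eq_zero_of_le_integral (C := |c| * omega α T) hcont fun t ht => ?_
  have hi : IntervalIntegrable h volume 0 t :=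
    (hcont.mono (Icc_subset_Icc_right ht.2)).intervalIntegrable_of_Icc ht.1
  change |h t| ≤ |c| * omega α T * ∫ s in (0 : ℝ)..t, |h s|
  rw [hvolt t ht, abs_neg, abs_mul, mul_assoc, ← intervalIntegral.integral_const_mul]
  gcongr
  rw [fracIntegral, ← Real.norm_eq_abs]
  refine intervalIntegral.norm_integral_le_of_norm_le ht.1 (Eventually.of_forall fun s hs => ?_)
    (hi.abs.const_mul _)
  rw [norm_smul, Real.norm_of_nonneg (omega_nonneg (by linarith [hα.1]) (by linarith [hs.2])),
    Real.norm_eq_abs]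
  gcongr
  exact omega_le hα.1.le (by linarith [hs.2]) (by linarith [hs.1, ht.2])

/-! ### Scalar modes by rescaling time -/

theorem ae_comp_mul_pos {P : ℝ → Prop} {c : ℝ} (hc : 0 < c)
    (h : ∀ᵐ t, t ∈ Ioi (0 : ℝ) → P t) : ∀ᵐ t, t ∈ Ioi (0 : ℝ) → P (c * t) := by
  have := (Measure.quasiMeasurePreserving_smul (μ := (volume : Measure ℝ)) hc.ne').ae h
  filter_upwards [this] with t ht ht0
  exact ht (mul_pos hc ht0)

theorem fracIntegral_linear {b t x y : ℝ} (ht : 0 ≤ t) {f g : ℝ → ℝ}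
    (hf : IntegrableOn (fun s => omega b (t - s) • f s) (Ioc 0 t))
    (hg : IntegrableOn (fun s => omega b (t - s) • g s) (Ioc 0 t)) :
    fracIntegral b (fun s => x * f s + y * g s) t =
      x * fracIntegral b f t + y * fracIntegral b g t := by
  unfold fracIntegral
  rw [← intervalIntegral.integral_const_mul, ← intervalIntegral.integral_const_mul,
    ← intervalIntegral.integral_add]
  · congr 1
    funext s
    simp only [smul_eq_mul]
    ring
  · exact ((intervalIntegrable_iff_integrableOn_Ioc_of_le ht).2 hf).const_mul x
  · exact ((intervalIntegrable_iff_integrableOn_Ioc_of_le ht).2 hg).const_mul y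

theorem ae_fracIntegral_linear {b : ℝ} (hb : 0 < b) {f g : ℝ → ℝ} (x y : ℝ)
    (hf : ∀ T, 0 ≤ T → IntegrableOn f (Ioc 0 T)) (hg : ∀ T, 0 ≤ T → IntegrableOn g (Ioc 0 T)) :
    ∀ᵐ t, t ∈ Ioi (0 : ℝ) → fracIntegral b (fun s => x * f s + y * g s) t =
      x * fracIntegral b f t + y * fracIntegral b g t := by
  have h : ∀ᵐ t, ∀ n : ℕ, t ∈ Ioc (0 : ℝ) n → fracIntegral b (fun s => x * f s + y * g s) t =
      x * fracIntegral b f t + y * fracIntegral b g t := by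
    refine ae_all_iff.2 fun n => ?_
    filter_upwards [ae_integrableOn_omega_smul hb (hf n n.cast_nonneg),
      ae_integrableOn_omega_smul hb (hg n n.cast_nonneg)] with t h1 h2 ht
    exact fracIntegral_linear ht.1.le (h1 ht) (h2 ht)
  filter_upwards [h] with t ht ht0
  obtain ⟨n, hn⟩ := exists_nat_ge t
  exact ht n ⟨ht0, hn⟩

/-- The frequency `λ ^ (1 / α)`. -/
noncomputable def freq (α c : ℝ) : ℝ := c ^ (1 / α)

theorem freq_pos {α c : ℝ} (hc : 0 < c) : 0 < freq α c := Real.rpow_pos_of_pos hc _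

theorem freq_rpow {α c : ℝ} (hc : 0 < c) (y : ℝ) : freq α c ^ y = c ^ (y / α) := by
  rw [freq, ← Real.rpow_mul hc.le]
  ring_nf

/-- The solution `u` of the scalar equation `∂ₜ^α u + c u = b t^(1-α) / Γ(2-α)`, `u(0) = a`. -/
noncomputable def modeU (α c a b t : ℝ) : ℝ :=
  a * relaxationDeriv α 1 (freq α c * t) + b * ((freq α c)⁻¹ * relaxationDeriv α 0 (freq α c * t))

/-- The derivative of `modeU`. -/
noncomputable def modeDu (α c a b t : ℝ) : ℝ :=
  a * (freq α c * relaxationDeriv α 2 (freq α c * t)) + b * relaxationDeriv α 1 (freq α c * t)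

/-- The derivative of the Caputo derivative of order `α / 2` of `modeU`. -/
noncomputable def modeDv (α c a b t : ℝ) : ℝ :=
  a * (-(freq α c ^ (1 + α / 2) * rayTransform α (α / 2) (freq α c * t))) +
    b * (freq α c ^ (α / 2) * rayTransform α (3 * (α / 2) - 1) (freq α c * t))

theorem HasLaplace.integrableOn_comp_mul {f F : ℝ → ℝ} (hf : HasLaplace f F) {c : ℝ} (hc : 0 < c)
    (T : ℝ) (hT : 0 ≤ T) : IntegrableOn (fun t => f (c * t)) (Ioc 0 T) := by
  rw [← intervalIntegrable_iff_integrableOn_Ioc_of_le hT]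
  have := (hf.intervalIntegrable (c * T) (by positivity)).comp_mul_left (c := c)
  simpa [hc.ne'] using this

section modes

variable {α c : ℝ} (hα : 1 < α ∧ α < 2) (hc : 0 < c)
include hα hc

theorem integrableOn_modeDu (a b T : ℝ) (hT : 0 ≤ T) :
    IntegrableOn (modeDu α c a b) (Ioc 0 T) := by
  have h1 := (hasLaplace_rayTransform hα (q := 0) (by norm_num)
    (by linarith [hα.1])).integrableOn_comp_mul (freq_pos (α := α) hc) T hT
  have h2 := (hasLaplace_relaxation hα).integrableOn_comp_mul (freq_pos (α := α) hc) T hT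
  have h3 : IntegrableOn (fun t => -(a * freq α c) * rayTransform α 0 (freq α c * t) +
      b * relaxation α (freq α c * t)) (Ioc 0 T) := (h1.const_mul _).add (h2.const_mul b)
  refine h3.congr_fun (fun t _ => ?_) measurableSet_Ioc
  simp [modeDu, relaxationDeriv, mul_assoc]

theorem integrableOn_modeDv (a b T : ℝ) (hT : 0 ≤ T) :
    IntegrableOn (modeDv α c a b) (Ioc 0 T) := by
  have h1 := (hasLaplace_rayTransform hα (q := α / 2) (by linarith [hα.1])
    (by linarith [hα.1])).integrableOn_comp_mul (freq_pos (α := α) hc) T hT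
  have h2 := (hasLaplace_rayTransform hα (q := 3 * (α / 2) - 1) (by linarith [hα.1])
    (by linarith [hα.2])).integrableOn_comp_mul (freq_pos (α := α) hc) T hT
  exact ((h1.const_mul _).neg.const_mul _).add ((h2.const_mul _).const_mul _)

theorem add_integral_modeDu (a b : ℝ) {t : ℝ} (ht : 0 < t) :
    a + ∫ s in (0 : ℝ)..t, modeDu α c a b s = modeU α c a b t := by
  have hl := freq_pos (α := α) hc
  have hlt : 0 < freq α c * t := mul_pos hl ht
  have h1 := (hasLaplace_rayTransform hα (q := 0) (by norm_num)
    (by linarith [hα.1])).integrableOn_comp_mul hl t ht.le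
  have h2 := (hasLaplace_relaxation hα).integrableOn_comp_mul hl t ht.le
  rw [← intervalIntegrable_iff_integrableOn_Ioc_of_le ht.le] at h1 h2
  have e : ∀ s, modeDu α c a b s = -(a * freq α c) * rayTransform α 0 (freq α c * s) +
      b * relaxation α (freq α c * s) := fun s => by
    simp [modeDu, relaxationDeriv, mul_assoc]
  simp_rw [e]
  rw [intervalIntegral.integral_add (h1.const_mul _) (h2.const_mul _),
    intervalIntegral.integral_const_mul, intervalIntegral.integral_const_mul,
    intervalIntegral.integral_comp_mul_left _ hl.ne',
    intervalIntegral.integral_comp_mul_left _ hl.ne', mul_zero, modeU, relaxationDeriv,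
    relaxationDeriv, relaxation_eq_one_sub hα hlt, relaxationPrim]
  simp only [smul_eq_mul]
  field_simp
  ring

/-- The relation v = ∂ₜ^β u for one mode, transported from unit frequency by the homogeneity of the
fractional integral. -/
theorem integral_modeDv (a b : ℝ) : ∀ᵐ t, t ∈ Ioi (0 : ℝ) →
    ∫ s in (0 : ℝ)..t, modeDv α c a b s = fracIntegral (1 - α / 2) (modeDu α c a b) t := by
  have hl := freq_pos (α := α) hc
  have hL1 := hasLaplace_rayTransform hα (q := α / 2) (by linarith [hα.1]) (by linarith [hα.1])
  have hL2 := hasLaplace_rayTransform hα (q := 3 * (α / 2) - 1) (by linarith [hα.1])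
    (by linarith [hα.2])
  have hL3 := hasLaplace_rayTransform hα (q := 0) (by norm_num) (by linarith [hα.1])
  have hL4 := hasLaplace_relaxation hα
  filter_upwards [ae_comp_mul_pos hl (primitive_rayTransform_half hα),
    ae_comp_mul_pos hl (primitive_rayTransform_three_half hα),
    ae_fracIntegral_linear (b := 1 - α / 2) (by linarith [hα.2]) (-(a * freq α c)) b
      (hL3.integrableOn_comp_mul hl) (hL4.integrableOn_comp_mul hl)] with t h1 h2 h3 ht
  have ht0 : 0 < t := ht
  have e : modeDu α c a b = fun s => -(a * freq α c) * rayTransform α 0 (freq α c * s) +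
      b * relaxation α (freq α c * s) := by
    funext s
    simp [modeDu, relaxationDeriv, mul_assoc]
  have e2 : ∀ s, modeDv α c a b s =
      -(a * freq α c ^ (1 + α / 2)) * rayTransform α (α / 2) (freq α c * s) +
      b * freq α c ^ (α / 2) * rayTransform α (3 * (α / 2) - 1) (freq α c * s) := fun s => by
    simp only [modeDv]
    ring
  have i1 := hL1.integrableOn_comp_mul hl t ht0.le
  have i2 := hL2.integrableOn_comp_mul hl t ht0.le
  rw [← intervalIntegrable_iff_integrableOn_Ioc_of_le ht0.le] at i1 i2
  rw [e, h3 ht, fracIntegral_comp_mul _ _ hl ht0.le, fracIntegral_comp_mul _ _ hl ht0.le,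
    ← h1 ht, ← h2 ht]
  simp_rw [e2]
  rw [intervalIntegral.integral_add (i1.const_mul _) (i2.const_mul _),
    intervalIntegral.integral_const_mul, intervalIntegral.integral_const_mul,
    intervalIntegral.integral_comp_mul_left _ hl.ne',
    intervalIntegral.integral_comp_mul_left _ hl.ne', mul_zero]
  simp only [smul_eq_mul]
  rw [neg_sub, Real.rpow_sub_one hl.ne', Real.rpow_add hl, Real.rpow_one]
  field_simp

/-- The evolution equation for one mode. The forcing ω_{2-α} comes only from the `b` part; rescaling
produces the factor c as the α-th power of the frequency. -/
theorem fracIntegral_modeDv (a b : ℝ) : ∀ᵐ t, t ∈ Ioi (0 : ℝ) →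
    fracIntegral (1 - α / 2) (modeDv α c a b) t =
      b * omega (2 - α) t - c * modeU α c a b t := by
  have hl := freq_pos (α := α) hc
  have hL1 := hasLaplace_rayTransform hα (q := α / 2) (by linarith [hα.1]) (by linarith [hα.1])
  have hL2 := hasLaplace_rayTransform hα (q := 3 * (α / 2) - 1) (by linarith [hα.1])
    (by linarith [hα.2])
  filter_upwards [ae_comp_mul_pos hl (fracIntegral_rayTransform_half hα),
    ae_comp_mul_pos hl (fracIntegral_rayTransform_three_half hα),
    ae_fracIntegral_linear (b := 1 - α / 2) (by linarith [hα.2]) (-(a * freq α c ^ (1 + α / 2)))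
      (b * freq α c ^ (α / 2))
      (hL1.integrableOn_comp_mul hl) (hL2.integrableOn_comp_mul hl)] with t h1 h2 h3 ht
  have ht0 : 0 < t := ht
  have e2 : modeDv α c a b = fun s =>
      -(a * freq α c ^ (1 + α / 2)) * rayTransform α (α / 2) (freq α c * s) +
      b * freq α c ^ (α / 2) * rayTransform α (3 * (α / 2) - 1) (freq α c * s) := by
    funext s
    simp only [modeDv]
    ring
  have hcl : c = (freq α c ^ (α / 2)) ^ 2 := by
    have hα0 : α ≠ 0 := by linarith [hα.1]
    rw [freq_rpow hc, ← Real.rpow_natCast, ← Real.rpow_mul hc.le,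
      show α / 2 / α * ((2 : ℕ) : ℝ) = 1 by push_cast; field_simp, Real.rpow_one]
  have hp := Real.rpow_pos_of_pos hl (α / 2)
  rw [e2, h3 ht, fracIntegral_comp_mul _ _ hl ht0.le, fracIntegral_comp_mul _ _ hl ht0.le,
    h1 ht, h2 ht, omega_mul hl ht0.le, modeU]
  have hw : freq α c ^ (2 - α - 1) = freq α c / (freq α c ^ (α / 2)) ^ 2 := by
    rw [show 2 - α - 1 = 1 - (α / 2 + α / 2) by ring, Real.rpow_sub hl, Real.rpow_add hl,
      Real.rpow_one, sq]
  rw [hw]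
  conv_rhs => rw [hcl]
  simp only [smul_eq_mul, relaxationDeriv, ← hcl]
  rw [neg_sub, Real.rpow_sub_one hl.ne', Real.rpow_add hl, Real.rpow_one]
  have hX : (freq α c ^ (α / 2)) ^ 2 = c := hcl.symm
  clear h1 h2 h3 e2 hcl hw hL1 hL2
  generalize freq α c ^ (α / 2) = X at hp hX ⊢
  have hl0 := hl.ne'
  generalize freq α c = l at hl0 ⊢
  subst hX
  field_simp
  ring

end modes

/-! ### The sine basis and the Dirichlet Laplacian -/

theorem inner_eigenvector (L : ℝ) (ψ : L2 L) (n : ℕ) :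
    inner ℝ ψ (eigenvector L n) = ∫ x in Icc (0 : ℝ) L, ψ x * eigenfunction L n x := by
  rw [L2.inner_def]
  refine integral_congr_ae ?_
  filter_upwards [(memLp_eigenfunction L n).coeFn_toLp] with x hx
  rw [eigenvector, hx, real_inner_comm]
  simp [mul_comm]

theorem integrable_coeFn (L : ℝ) (ψ : L2 L) : IntegrableOn ψ (Icc (0 : ℝ) L) :=
  (Lp.memLp ψ).integrable (by norm_num)

theorem eigenvalue_pos {L : ℝ} (hL : 0 < L) (n : ℕ) : 0 < eigenvalue L n := by
  unfold eigenvalue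
  have := Real.pi_pos
  positivity

theorem integral_cos_int_mul {L : ℝ} (hL : 0 < L) (k : ℤ) (hk : k ≠ 0) :
    ∫ x in (0 : ℝ)..L, Real.cos (k * Real.pi / L * x) = 0 := by
  have hc : (k : ℝ) * Real.pi / L ≠ 0 := by
    have := Real.pi_ne_zero
    have : (k : ℝ) ≠ 0 := by exact_mod_cast hk
    positivity
  rw [intervalIntegral.integral_comp_mul_left _ hc, integral_cos,
    div_mul_cancel₀ _ hL.ne', Real.sin_int_mul_pi]
  simp

theorem orthonormal_eigenvector {L : ℝ} (hL : 0 < L) : Orthonormal ℝ (eigenvector L) := by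
  rw [orthonormal_iff_ite]
  intro n m
  have h2 : inner ℝ (eigenvector L n) (eigenvector L m) =
      ∫ x in (0 : ℝ)..L, (1 / L) * (Real.cos (((n - m : ℤ) : ℝ) * Real.pi / L * x) -
        Real.cos (((n + m + 2 : ℤ) : ℝ) * Real.pi / L * x)) := by
    rw [inner_eigenvector, intervalIntegral.integral_of_le hL.le, ← integral_Icc_eq_integral_Ioc]
    refine integral_congr_ae ?_
    filter_upwards [(memLp_eigenfunction L n).coeFn_toLp] with x hx
    rw [eigenvector, hx, eigenfunction, eigenfunction]
    have hs : Real.sqrt (2 / L) * Real.sqrt (2 / L) = 2 / L := Real.mul_self_sqrt (by positivity)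
    have e1 : ((n - m : ℤ) : ℝ) * Real.pi / L * x =
        (n + 1) * Real.pi / L * x - (m + 1) * Real.pi / L * x := by
      push_cast
      ring
    have e2 : ((n + m + 2 : ℤ) : ℝ) * Real.pi / L * x =
        (n + 1) * Real.pi / L * x + (m + 1) * Real.pi / L * x := by
      push_cast
      ring
    rw [e1, e2, Real.cos_sub, Real.cos_add]
    linear_combination Real.sin ((n + 1) * Real.pi / L * x) *
      Real.sin ((m + 1) * Real.pi / L * x) * hs
  rw [h2, intervalIntegral.integral_const_mul, intervalIntegral.integral_sub
    (Continuous.intervalIntegrable (by fun_prop) _ _)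
    (Continuous.intervalIntegrable (by fun_prop) _ _), integral_cos_int_mul hL (n + m + 2) (by omega),
    sub_zero]
  by_cases h : n = m
  · subst h
    simp [hL.ne']
  · rw [integral_cos_int_mul hL _ (by omega), if_neg h, mul_zero]

theorem integrable_mul_continuous (L : ℝ) (ψ : L2 L) {g : ℝ → ℝ} (hg : Continuous g) :
    IntegrableOn (fun x => ψ x * g x) (Icc (0 : ℝ) L) := by
  obtain ⟨C, hC⟩ := isCompact_Icc.exists_bound_of_continuousOn (hg.continuousOn (s := Icc (0 : ℝ) L))
  refine (integrable_coeFn L ψ).mul_bdd (c := C) hg.aestronglyMeasurable ?_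
  filter_upwards [ae_restrict_mem measurableSet_Icc] with x hx using hC x hx

/-- The Dirichlet eigenfunctions are complete. -/
theorem eq_zero_of_inner_eigenvector_eq_zero {L : ℝ} (hL : 0 < L) {ψ : L2 L}
    (h : ∀ n, inner ℝ ψ (eigenvector L n) = 0) : ψ = 0 := by
  have hsin : ∀ k : ℕ, ∫ x in Icc (0 : ℝ) L, ψ x * Real.sin (k * (Real.pi / L * x)) = 0 := by
    intro k
    cases k with
    | zero => simp
    | succ n =>
      have h1 := h n
      rw [inner_eigenvector] at h1
      have h2 : ∀ x, ψ x * eigenfunction L n x =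
          Real.sqrt (2 / L) * (ψ x * Real.sin ((n + 1 : ℕ) * (Real.pi / L * x))) := fun x => by
        rw [eigenfunction]
        push_cast
        ring_nf
      simp_rw [h2] at h1
      rw [integral_const_mul] at h1
      exact (mul_eq_zero.1 h1).resolve_left (Real.sqrt_pos.2 (by positivity)).ne'
  -- By 2 sin(kθ) cos θ = sin((k+1)θ) + sin((k-1)θ), orthogonality to sines extends to sines times
  -- powers of cos θ. Taking k = 1 makes ψ sin θ orthogonal to all polynomials in cos θ.
  have hcos : ∀ n k : ℕ, ∫ x in Icc (0 : ℝ) L,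
      ψ x * (Real.sin (k * (Real.pi / L * x)) * Real.cos (Real.pi / L * x) ^ n) = 0 := by
    intro n
    induction n with
    | zero => simpa using hsin
    | succ n ih =>
      intro k
      cases k with
      | zero => simp
      | succ k =>
        have e : ∀ x, ψ x * (Real.sin ((k + 1 : ℕ) * (Real.pi / L * x)) *
            Real.cos (Real.pi / L * x) ^ (n + 1)) =
            (1 / 2) * (ψ x * (Real.sin ((k + 2 : ℕ) * (Real.pi / L * x)) *
              Real.cos (Real.pi / L * x) ^ n)) + (1 / 2) * (ψ x *
              (Real.sin (k * (Real.pi / L * x)) * Real.cos (Real.pi / L * x) ^ n)) := by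
          intro x
          have e1 : ((k + 2 : ℕ) : ℝ) * (Real.pi / L * x) =
            (k + 1 : ℕ) * (Real.pi / L * x) + Real.pi / L * x := by push_cast; ring
          have e2 : (k : ℝ) * (Real.pi / L * x) =
            (k + 1 : ℕ) * (Real.pi / L * x) - Real.pi / L * x := by push_cast; ring
          rw [e1, e2, Real.sin_add, Real.sin_sub]
          ring
        simp_rw [e]
        rw [integral_add ((integrable_mul_continuous L ψ (by fun_prop)).const_mul _)
          ((integrable_mul_continuous L ψ (by fun_prop)).const_mul _), integral_const_mul,
          integral_const_mul, ih, ih]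
        simp
  set k : ℝ → ℝ := fun x => ψ x * Real.sin (Real.pi / L * x) with hk
  have hkint : IntegrableOn k (Icc 0 L) := integrable_mul_continuous L ψ (by fun_prop)
  have hkP : ∀ P : Polynomial ℝ,
      IntegrableOn (fun x => k x * P.eval (Real.cos (Real.pi / L * x))) (Icc 0 L) := fun P => by
    simp_rw [hk, mul_assoc]
    exact integrable_mul_continuous L ψ (by
      have := P.continuous
      fun_prop)
  have hpoly : ∀ P : Polynomial ℝ,
      ∫ x in Icc (0 : ℝ) L, k x * P.eval (Real.cos (Real.pi / L * x)) = 0 := by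
    intro P
    induction P using Polynomial.induction_on' with
    | add P Q hP hQ =>
      simp_rw [Polynomial.eval_add, mul_add]
      rw [integral_add (hkP P) (hkP Q), hP, hQ, add_zero]
    | monomial n a =>
      have e : ∀ x, k x * (Polynomial.monomial n a).eval (Real.cos (Real.pi / L * x)) =
          a * (ψ x * (Real.sin ((1 : ℕ) * (Real.pi / L * x)) *
            Real.cos (Real.pi / L * x) ^ n)) := fun x => by
        rw [Polynomial.eval_monomial, hk, Nat.cast_one, one_mul]
        ring
      simp_rw [e]
      rw [integral_const_mul, hcos, mul_zero]
  have hk0 : ∀ᵐ x ∂(volume.restrict (Icc 0 L)), k x = 0 := by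
    refine ae_eq_zero_of_integral_contDiff_smul_eq_zero
      (Integrable.locallyIntegrable hkint) fun g hg _ => ?_
    have hgk : IntegrableOn (fun x => g x * k x) (Icc 0 L) := by
      have e : (fun x => g x * k x) = fun x => ψ x * (g x * Real.sin (Real.pi / L * x)) := by
        funext x
        rw [hk]
        ring
      rw [e]
      exact integrable_mul_continuous L ψ (by
        have := hg.continuous
        fun_prop)
    have hsmall : ∀ ε : ℝ, 0 < ε → |∫ x in Icc 0 L, g x * k x| ≤
        ε * ∫ x in Icc 0 L, ‖k x‖ := by
      intro ε hε
      -- Since cos(πx/L) is injective on [0, L], every test function is a continuous function of it,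
      -- via arccos, and Weierstrass applies.
      obtain ⟨P, hP⟩ := exists_polynomial_near_of_continuousOn (-1) 1
        (fun y => g (L / Real.pi * Real.arccos y))
        (hg.continuous.comp (by have := Real.continuous_arccos; fun_prop)).continuousOn ε hε
      have hsub : ∫ x in Icc 0 L, g x * k x =
          ∫ x in Icc 0 L, (g x * k x - k x * P.eval (Real.cos (Real.pi / L * x))) := by
        rw [integral_sub hgk (hkP P), hpoly, sub_zero]
      rw [hsub, ← integral_const_mul, ← Real.norm_eq_abs]
      refine norm_integral_le_of_norm_le (hkint.norm.const_mul ε) ?_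
      filter_upwards [ae_restrict_mem measurableSet_Icc] with x hx
      rw [mul_comm (g x), ← mul_sub, norm_mul, mul_comm]
      gcongr
      have hpi := Real.pi_pos
      have := hP (Real.cos (Real.pi / L * x)) (Real.cos_mem_Icc _)
      rw [Real.arccos_cos (by have := hx.1; positivity)
        (by rw [div_mul_eq_mul_div, div_le_iff₀ hL]; exact mul_le_mul_of_nonneg_left hx.2 hpi.le),
        show L / Real.pi * (Real.pi / L * x) = x by field_simp] at this
      rw [Real.norm_eq_abs, abs_sub_comm]
      exact this.le
    by_contra hne
    have hpos := abs_pos.2 hne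
    simp only [smul_eq_mul] at hpos
    set N := ∫ x in Icc 0 L, ‖k x‖
    have hN : 0 ≤ N := integral_nonneg fun _ => norm_nonneg _
    have := hsmall (|∫ x in Icc 0 L, g x * k x| / (2 * (N + 1))) (by positivity)
    rw [div_mul_eq_mul_div, le_div_iff₀ (by positivity)] at this
    nlinarith
  refine (Lp.eq_zero_iff_ae_eq_zero (f := ψ)).2 ?_
  have hIoo : ∀ᵐ x ∂(volume.restrict (Icc 0 L)), x ∈ Ioo 0 L := by
    rw [← Measure.restrict_congr_set Ioo_ae_eq_Icc]
    exact ae_restrict_mem measurableSet_Ioo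
  filter_upwards [hk0, hIoo] with x hx hxI
  have hpi := Real.pi_pos
  -- The weight sin(πx/L) is positive inside the interval and can be cancelled there.
  refine (mul_eq_zero.1 hx).resolve_right (Real.sin_pos_of_pos_of_lt_pi ?_ ?_).ne'
  · have := hxI.1
    positivity
  · rw [div_mul_eq_mul_div, div_lt_iff₀ hL]
    exact mul_lt_mul_of_pos_left hxI.2 hpi

/-- Integration by parts for an absolutely continuous function against a smooth one. -/
theorem integral_mul_eq_sub_of_primitive {L : ℝ} (hL : 0 ≤ L) {g G φ φ' : ℝ → ℝ}
    (hg : IntervalIntegrable g volume 0 L)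
    (hG : ∀ x ∈ Icc (0 : ℝ) L, G x = G 0 + ∫ y in (0 : ℝ)..x, g y)
    (hφ : ∀ x, HasDerivAt φ (φ' x) x) (hφ' : Continuous φ') :
    ∫ x in (0 : ℝ)..L, g x * φ x = G L * φ L - G 0 * φ 0 - ∫ x in (0 : ℝ)..L, G x * φ' x := by
  have hF := hg.absolutelyContinuousOnInterval_intervalIntegral (c := 0) left_mem_uIcc
  have hφeq : deriv φ = φ' := funext fun x => (hφ x).deriv
  have hφc : AbsolutelyContinuousOnInterval φ 0 L := by
    have h1 : ContDiff ℝ 1 φ := contDiff_one_iff_deriv.2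
      ⟨fun x => (hφ x).differentiableAt, by rw [hφeq]; exact hφ'⟩
    exact (h1.contDiffOn (s := uIcc 0 L)).absolutelyContinuousOnInterval
  have h := hF.integral_mul_deriv_eq_deriv_mul hφc
  rw [hφeq] at h
  have hd : ∫ x in (0 : ℝ)..L, deriv (fun x => ∫ y in (0 : ℝ)..x, g y) x * φ x =
      ∫ x in (0 : ℝ)..L, g x * φ x := by
    refine intervalIntegral.integral_congr_ae ?_
    filter_upwards [hg.ae_hasDerivAt_integral] with x hx hxI
    rw [(hx (uIoc_subset_uIcc hxI) 0 left_mem_uIcc).deriv]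
  rw [hd, intervalIntegral.integral_same, zero_mul, sub_zero] at h
  have hφi : ∫ x in (0 : ℝ)..L, φ' x = φ L - φ 0 :=
    intervalIntegral.integral_eq_sub_of_hasDerivAt (fun x _ => hφ x)
      (hφ'.intervalIntegrable _ _)
  have hsplit : ∫ x in (0 : ℝ)..L, G x * φ' x =
      G 0 * (φ L - φ 0) + ∫ x in (0 : ℝ)..L, (∫ y in (0 : ℝ)..x, g y) * φ' x := by
    rw [← hφi, ← intervalIntegral.integral_const_mul, ← intervalIntegral.integral_add]
    · refine intervalIntegral.integral_congr fun x hx => ?_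
      rw [uIcc_of_le hL] at hx
      rw [hG x hx]
      ring
    · exact (hφ'.intervalIntegrable _ _).const_mul _
    · exact (hF.continuousOn.mul hφ'.continuousOn).intervalIntegrable
  rw [hsplit, hG L ⟨hL, le_rfl⟩]
  linarith

theorem intervalIntegrable_coeFn {L : ℝ} (hL : 0 ≤ L) (ψ : L2 L) :
    IntervalIntegrable ψ volume 0 L :=
  (intervalIntegrable_iff_integrableOn_Icc_of_le hL).2 (integrable_coeFn L ψ)

theorem inner_eigenvector_of_ae_eq {L : ℝ} (hL : 0 ≤ L) {ψ : L2 L} {U : ℝ → ℝ}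
    (h : ψ =ᵐ[volume.restrict (Icc (0 : ℝ) L)] U) (n : ℕ) :
    inner ℝ ψ (eigenvector L n) = ∫ x in (0 : ℝ)..L, U x * eigenfunction L n x := by
  rw [inner_eigenvector, intervalIntegral.integral_of_le hL, ← integral_Icc_eq_integral_Ioc]
  refine integral_congr_ae ?_
  filter_upwards [h] with x hx
  rw [hx]

/-- Two integrations by parts. The first boundary term vanishes because the eigenfunction does at
both ends, the second because U does. -/
theorem HasDirichletLaplacian.inner_eq {L : ℝ} (hL : 0 < L) {ψ w : L2 L}
    (h : HasDirichletLaplacian L ψ w) (n : ℕ) :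
    inner ℝ w (eigenvector L n) = -(eigenvalue L n * inner ℝ ψ (eigenvector L n)) := by
  obtain ⟨g, U, V, ⟨hψ, hU⟩, ⟨hg, hV⟩, hU0, hUL⟩ := h
  set k : ℝ := (n + 1) * Real.pi / L with hk
  set φ' : ℝ → ℝ := fun x => Real.sqrt (2 / L) * (k * Real.cos (k * x)) with hφ'
  have hd1 : ∀ x, HasDerivAt (eigenfunction L n) (φ' x) x := by
    intro x
    have := (((hasDerivAt_id x).const_mul k).sin).const_mul (Real.sqrt (2 / L))
    exact this.congr_deriv (by simp only [hφ', id, mul_one]; ring)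
  have hd2 : ∀ x, HasDerivAt φ' (-(k ^ 2) * eigenfunction L n x) x := by
    intro x
    have := ((((hasDerivAt_id x).const_mul k).cos).const_mul k).const_mul (Real.sqrt (2 / L))
    exact this.congr_deriv (by simp only [eigenfunction, ← hk, id, mul_one]; ring)
  have hc1 : Continuous φ' := by fun_prop
  have hc0 : Continuous (eigenfunction L n) := by unfold eigenfunction; fun_prop
  have hφ0 : eigenfunction L n 0 = 0 := by simp [eigenfunction]
  have hφL : eigenfunction L n L = 0 := by
    rw [eigenfunction, div_mul_cancel₀ _ hL.ne']
    have := Real.sin_nat_mul_pi (n + 1)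
    push_cast at this
    rw [this, mul_zero]
  have i1 := integral_mul_eq_sub_of_primitive hL.le (intervalIntegrable_coeFn hL.le w) hV hd1 hc1
  have i2 := integral_mul_eq_sub_of_primitive hL.le (intervalIntegrable_coeFn hL.le g) hU hd2
    (by fun_prop)
  have hVg : ∫ x in (0 : ℝ)..L, V x * φ' x = ∫ x in (0 : ℝ)..L, g x * φ' x := by
    rw [intervalIntegral.integral_of_le hL.le, intervalIntegral.integral_of_le hL.le,
      ← integral_Icc_eq_integral_Ioc, ← integral_Icc_eq_integral_Ioc]
    refine integral_congr_ae ?_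
    filter_upwards [hg] with x hx
    rw [hx]
  have hUe : ∫ x in (0 : ℝ)..L, U x * (-(k ^ 2) * eigenfunction L n x) =
      -(k ^ 2) * ∫ x in (0 : ℝ)..L, U x * eigenfunction L n x := by
    rw [← intervalIntegral.integral_const_mul]
    congr 1
    funext x
    ring
  rw [inner_eigenvector_of_ae_eq hL.le (EventuallyEq.rfl (f := (w : ℝ → ℝ))) n,
    inner_eigenvector_of_ae_eq hL.le hψ n, i1, hφ0, hφL, hVg, i2, hU0, hUL, hUe, eigenvalue, ← hk]
  ring

theorem memLp_of_continuousOn {L : ℝ} {V : ℝ → ℝ} (hV : ContinuousOn V (Icc 0 L)) :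
    MemLp V 2 (volume.restrict (Icc (0 : ℝ) L)) := by
  obtain ⟨C, hC⟩ := isCompact_Icc.exists_bound_of_continuousOn hV
  refine MemLp.of_bound (hV.aestronglyMeasurable measurableSet_Icc) C ?_
  filter_upwards [ae_restrict_mem measurableSet_Icc] with x hx using hC x hx

/-- Solve the Dirichlet problem for w by integrating twice. The solution has the same sine
coefficients as ψ, because the eigenvalues are nonzero, so completeness identifies the two. -/
theorem hasDirichletLaplacian_of_inner_eq {L : ℝ} (hL : 0 < L) {ψ w : L2 L}
    (h : ∀ n, inner ℝ w (eigenvector L n) = -(eigenvalue L n * inner ℝ ψ (eigenvector L n))) :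
    HasDirichletLaplacian L ψ w := by
  set W : ℝ → ℝ := fun x => ∫ y in (0 : ℝ)..x, w y with hW
  have hWc : ContinuousOn W (Icc 0 L) := by
    have := intervalIntegral.continuousOn_primitive_interval'
      (intervalIntegrable_coeFn hL.le w) left_mem_uIcc
    rwa [uIcc_of_le hL.le] at this
  -- The constant of integration giving the first derivative mean zero, so that U vanishes at L as
  -- well as at 0.
  set c : ℝ := -((1 / L) * ∫ x in (0 : ℝ)..L, W x) with hc
  set V : ℝ → ℝ := fun x => c + W x with hV
  have hVc : ContinuousOn V (Icc 0 L) := continuousOn_const.add hWc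
  set U : ℝ → ℝ := fun x => ∫ y in (0 : ℝ)..x, V y with hU
  have hVi : IntervalIntegrable V volume 0 L := hVc.intervalIntegrable_of_Icc hL.le
  have hUc : ContinuousOn U (Icc 0 L) := by
    have := intervalIntegral.continuousOn_primitive_interval' hVi left_mem_uIcc
    rwa [uIcc_of_le hL.le] at this
  have hVm := memLp_of_continuousOn hVc
  have hUm := memLp_of_continuousOn hUc
  have hgV := hVm.coeFn_toLp
  have hW0 : W 0 = 0 := by simp [hW]
  have hU0 : U 0 = 0 := by simp [hU]
  have hUL : U L = 0 := by
    simp only [hU, hV]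
    rw [intervalIntegral.integral_add intervalIntegrable_const
      (hWc.intervalIntegrable_of_Icc hL.le), intervalIntegral.integral_const, hc]
    simp only [sub_zero, smul_eq_mul]
    field_simp
    ring
  have hD : HasDirichletLaplacian L (hUm.toLp U) w := by
    refine ⟨hVm.toLp V, U, V, ⟨hUm.coeFn_toLp, fun x hx => ?_⟩, ⟨hgV, fun x _ => ?_⟩, hU0, hUL⟩
    · rw [hU0, zero_add]
      refine intervalIntegral.integral_congr_ae ?_
      filter_upwards [(ae_restrict_iff' measurableSet_Icc).1 hgV] with y hy hyI
      rw [uIoc_of_le hx.1] at hyI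
      rw [hy ⟨hyI.1.le, hyI.2.trans hx.2⟩]
    · simp [hV, hW]
  have heq : hUm.toLp U = ψ := by
    rw [← sub_eq_zero]
    refine eq_zero_of_inner_eigenvector_eq_zero hL fun n => ?_
    have h1 := hD.inner_eq hL n
    rw [h n] at h1
    have h2 := mul_left_cancel₀ (eigenvalue_pos hL n).ne' (neg_injective h1)
    rw [inner_sub_left, h2, sub_self]
  rwa [heq] at hD

/-- The Dirichlet eigenfunctions as a Hilbert basis of `L²(0, L)`. -/
noncomputable def sineBasis {L : ℝ} (hL : 0 < L) : HilbertBasis ℕ ℝ (L2 L) :=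
  HilbertBasis.mkOfOrthogonalEqBot (orthonormal_eigenvector hL) (by
    rw [Submodule.eq_bot_iff]
    intro ψ hψ
    refine eq_zero_of_inner_eigenvector_eq_zero hL fun n => ?_
    rw [real_inner_comm]
    exact hψ _ (Submodule.subset_span (mem_range_self n)))

theorem coe_sineBasis {L : ℝ} (hL : 0 < L) : ⇑(sineBasis hL) = eigenvector L :=
  HilbertBasis.coe_mkOfOrthogonalEqBot _ _

/-! ### Time-dependent multipliers of the sine coefficients -/

/-- The sine coefficient as a continuous functional. -/
noncomputable def coef (L : ℝ) (n : ℕ) : L2 L →L[ℝ] ℝ := innerSL ℝ (eigenvector L n)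

theorem coef_apply (L : ℝ) (n : ℕ) (ψ : L2 L) : coef L n ψ = inner ℝ ψ (eigenvector L n) := by
  rw [coef, innerSL_apply_apply, real_inner_comm]

theorem coef_ext {L : ℝ} (hL : 0 < L) {ψ χ : L2 L} (h : ∀ n, coef L n ψ = coef L n χ) :
    ψ = χ := by
  rw [← sub_eq_zero]
  refine eq_zero_of_inner_eigenvector_eq_zero hL fun n => ?_
  rw [← coef_apply, map_sub, h, sub_self]

theorem coef_tsum {L : ℝ} (hL : 0 < L) {c : ℕ → ℝ} (hc : Summable fun n => c n ^ 2) (n : ℕ) :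
    coef L n (∑' k, c k • eigenvector L k) = c n := by
  have hmem : Memℓp c 2 := by
    refine (memℓp_gen_iff (by norm_num)).2 ?_
    simpa using hc
  have h := (sineBasis hL).hasSum_repr_symm ⟨c, hmem⟩
  rw [coe_sineBasis] at h
  have h2 : ∑' k, c k • eigenvector L k = (sineBasis hL).repr.symm ⟨c, hmem⟩ := h.tsum_eq
  have h3 := (sineBasis hL).repr_apply_apply ((sineBasis hL).repr.symm ⟨c, hmem⟩) n
  rw [coe_sineBasis, LinearIsometryEquiv.apply_symm_apply] at h3
  rw [h2, coef, innerSL_apply_apply, ← h3]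

theorem hasSum_coef_sq {L : ℝ} (hL : 0 < L) (ψ : L2 L) :
    HasSum (fun n => coef L n ψ ^ 2) (‖ψ‖ ^ 2) := by
  have h := (sineBasis hL).hasSum_inner_mul_inner ψ ψ
  rw [coe_sineBasis, real_inner_self_eq_norm_sq] at h
  have e : (fun n => coef L n ψ ^ 2) =
      fun n => inner ℝ ψ (eigenvector L n) * inner ℝ (eigenvector L n) ψ := by
    funext n
    rw [coef_apply, sq, real_inner_comm ψ]
  rw [e]
  exact h

/-- The operator that multiplies the sine coefficients by `m`. -/
noncomputable def diagMul (L : ℝ) (m : ℕ → ℝ) (ψ : L2 L) : L2 L :=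
  ∑' n, (m n * coef L n ψ) • eigenvector L n

theorem summable_diagMul {L : ℝ} (hL : 0 < L) {m : ℕ → ℝ} {K : ℝ} (hm : ∀ n, |m n| ≤ K)
    (ψ : L2 L) : Summable fun n => (m n * coef L n ψ) ^ 2 := by
  refine Summable.of_nonneg_of_le (fun n => sq_nonneg _) (fun n => ?_)
    ((hasSum_coef_sq hL ψ).summable.mul_left (K ^ 2))
  rw [mul_pow]
  exact mul_le_mul_of_nonneg_right (sq_le_sq' (abs_le.1 (hm n)).1 (abs_le.1 (hm n)).2)
    (sq_nonneg _)

theorem coef_diagMul {L : ℝ} (hL : 0 < L) {m : ℕ → ℝ} {K : ℝ} (hm : ∀ n, |m n| ≤ K) (ψ : L2 L)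
    (n : ℕ) : coef L n (diagMul L m ψ) = m n * coef L n ψ :=
  coef_tsum hL (summable_diagMul hL hm ψ) n

theorem norm_diagMul_le {L : ℝ} (hL : 0 < L) {m : ℕ → ℝ} {K : ℝ} (hm : ∀ n, |m n| ≤ K)
    (ψ : L2 L) : ‖diagMul L m ψ‖ ≤ K * ‖ψ‖ := by
  have hK : 0 ≤ K := (abs_nonneg _).trans (hm 0)
  refine le_of_sq_le_sq ?_ (by positivity)
  have h1 := hasSum_coef_sq hL (diagMul L m ψ)
  have h2 := (hasSum_coef_sq hL ψ).mul_left (K ^ 2)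
  rw [mul_pow]
  refine hasSum_le (fun n => ?_) h1 h2
  rw [coef_diagMul hL hm, mul_pow]
  exact mul_le_mul_of_nonneg_right (sq_le_sq' (abs_le.1 (hm n)).1 (abs_le.1 (hm n)).2)
    (sq_nonneg _)

/-- Dominated convergence for Parseval's series: each squared coefficient of the difference is at
most (2K)² times that of ψ. -/
theorem tendsto_diagMul {L : ℝ} (hL : 0 < L) {ι : Type*} {l : Filter ι} {x : ι → ℕ → ℝ}
    {y : ℕ → ℝ} {K : ℝ} (hx : ∀ᶠ i in l, ∀ n, |x i n| ≤ K) (hy : ∀ n, |y n| ≤ K)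
    (hxy : ∀ n, Tendsto (fun i => x i n) l (𝓝 (y n))) (ψ : L2 L) :
    Tendsto (fun i => diagMul L (x i) ψ) l (𝓝 (diagMul L y ψ)) := by
  have hsum := (hasSum_coef_sq hL ψ).summable.mul_left ((2 * K) ^ 2)
  have h := tendsto_tsum_of_dominated_convergence (𝓕 := l)
    (f := fun i n => ((x i n - y n) * coef L n ψ) ^ 2) (g := fun _ => 0) hsum
    (fun n => by
      have := (((hxy n).sub_const (y n)).mul_const (coef L n ψ)).pow 2
      simpa using this)
    (by
      filter_upwards [hx] with i hi n
      rw [Real.norm_of_nonneg (sq_nonneg _), mul_pow]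
      have h1 := abs_le.1 (hi n)
      have h2 := abs_le.1 (hy n)
      exact mul_le_mul_of_nonneg_right (sq_le_sq' (by linarith) (by linarith)) (sq_nonneg _))
  rw [tsum_zero] at h
  rw [tendsto_iff_norm_sub_tendsto_zero]
  have h2 : Tendsto (fun i => ‖diagMul L (x i) ψ - diagMul L y ψ‖ ^ 2) l (𝓝 0) := by
    refine h.congr' ?_
    filter_upwards [hx] with i hi
    rw [← (hasSum_coef_sq hL (diagMul L (x i) ψ - diagMul L y ψ)).tsum_eq]
    refine tsum_congr fun n => ?_
    rw [map_sub, coef_diagMul hL hi, coef_diagMul hL hy, sub_mul]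
  have h3 := h2.sqrt
  simpa using h3

/-- A family of multipliers depending on `t > 0`, bounded by `B t` uniformly in the mode. -/
structure BoundedFamily (m : ℕ → ℝ → ℝ) (B : ℝ → ℝ) : Prop where
  continuousOn_bound : ContinuousOn B (Ioi 0)
  le_bound : ∀ n t, 0 < t → |m n t| ≤ B t

theorem BoundedFamily.exists_local {m : ℕ → ℝ → ℝ} {B : ℝ → ℝ} (h : BoundedFamily m B) {t : ℝ}
    (ht : 0 < t) : ∃ K : ℝ, ∀ s ∈ Icc (t / 2) (2 * t), ∀ n, |m n s| ≤ K := by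
  have hsub : Icc (t / 2) (2 * t) ⊆ Ioi 0 := fun s hs => lt_of_lt_of_le (half_pos ht) hs.1
  obtain ⟨K, hK⟩ := isCompact_Icc.exists_bound_of_continuousOn (h.continuousOn_bound.mono hsub)
  exact ⟨K, fun s hs n => (h.le_bound n s (hsub hs)).trans ((le_abs_self _).trans (hK s hs))⟩

theorem continuousOn_diagMul {L : ℝ} (hL : 0 < L) {m : ℕ → ℝ → ℝ} {B : ℝ → ℝ}
    (h : BoundedFamily m B) (hc : ∀ n, ContinuousOn (m n) (Ioi 0)) (ψ : L2 L) :
    ContinuousOn (fun t => diagMul L (fun n => m n t) ψ) (Ioi 0) := by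
  intro t ht
  have ht : 0 < t := ht
  obtain ⟨K, hK⟩ := h.exists_local ht
  have hnhds : Icc (t / 2) (2 * t) ∈ 𝓝 t := Icc_mem_nhds (by linarith) (by linarith)
  refine ContinuousAt.continuousWithinAt ?_
  refine tendsto_diagMul hL (K := K) ?_ (hK t (mem_of_mem_nhds hnhds)) (fun n => ?_) ψ
  · filter_upwards [hnhds] with s hs using hK s hs
  · exact (hc n).continuousAt (Ioi_mem_nhds ht)

/-- Difference quotients of the multipliers are bounded uniformly in the mode by the mean value
inequality near t, so modewise convergence of slopes gives convergence in L². -/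
theorem hasDerivAt_diagMul {L : ℝ} (hL : 0 < L) {m m' : ℕ → ℝ → ℝ} {B B' : ℝ → ℝ}
    (h : BoundedFamily m B) (h' : BoundedFamily m' B')
    (hd : ∀ n t, 0 < t → HasDerivAt (m n) (m' n t) t) (ψ : L2 L) {t : ℝ} (ht : 0 < t) :
    HasDerivAt (fun t => diagMul L (fun n => m n t) ψ) (diagMul L (fun n => m' n t) ψ) t := by
  obtain ⟨K, hK⟩ := h'.exists_local ht
  obtain ⟨K₀, hK₀⟩ := h.exists_local ht
  have hnhds : Icc (t / 2) (2 * t) ∈ 𝓝 t := Icc_mem_nhds (by linarith) (by linarith)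
  have htm := mem_of_mem_nhds hnhds
  rw [hasDerivAt_iff_tendsto_slope]
  have hslope : ∀ s ∈ Icc (t / 2) (2 * t), ∀ n, |slope (m n) t s| ≤ K := by
    intro s hs n
    rw [slope_def_field, abs_div]
    refine div_le_of_le_mul₀ (abs_nonneg _) ((abs_nonneg _).trans (hK t htm n)) ?_
    exact (convex_Icc (t / 2) (2 * t)).norm_image_sub_le_of_norm_hasDerivWithin_le
      (f := m n) (f' := m' n) (fun r hr =>
        (hd n r (lt_of_lt_of_le (half_pos ht) hr.1)).hasDerivWithinAt)
      (fun r hr => hK r hr n) htm hs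
  have hmain := tendsto_diagMul hL (l := 𝓝[≠] t) (x := fun s n => slope (m n) t s)
    (y := fun n => m' n t) (K := K)
    (by
      filter_upwards [nhdsWithin_le_nhds hnhds] with s hs using hslope s hs) (hK t htm)
    (fun n => hasDerivAt_iff_tendsto_slope.1 (hd n t ht)) ψ
  refine hmain.congr' ?_
  filter_upwards [nhdsWithin_le_nhds hnhds] with s hs
  refine coef_ext hL fun n => ?_
  rw [coef_diagMul hL (hslope s hs), slope_def_field, slope_def_module, map_smul, map_sub,
    coef_diagMul hL (hK₀ s hs), coef_diagMul hL (hK₀ t htm), smul_eq_mul]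
  ring

theorem fracLaplacian_eq_diagMul (L γ : ℝ) (ψ : L2 L) :
    fracLaplacian L γ ψ = diagMul L (fun n => eigenvalue L n ^ γ) ψ := by
  unfold fracLaplacian diagMul
  simp_rw [coef_apply]

theorem coef_fracLaplacian {L γ : ℝ} (hL : 0 < L) {ψ : L2 L} (h : ψ ∈ fracDomain L γ) (n : ℕ) :
    coef L n (fracLaplacian L γ ψ) = eigenvalue L n ^ γ * coef L n ψ := by
  rw [fracLaplacian_eq_diagMul]
  refine coef_tsum hL (c := fun n => eigenvalue L n ^ γ * coef L n ψ) ?_ n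
  simpa only [sq_abs, ← coef_apply] using
    (show Summable fun n : ℕ => |eigenvalue L n ^ γ * inner ℝ ψ (eigenvector L n)| ^ 2 from h)

/-- Any L² element with the expected coefficients certifies, by Parseval, both membership in the
domain and the value. -/
theorem mem_fracDomain_of_coef {L γ : ℝ} (hL : 0 < L) {ψ χ : L2 L}
    (h : ∀ n, coef L n χ = eigenvalue L n ^ γ * coef L n ψ) :
    ψ ∈ fracDomain L γ ∧ fracLaplacian L γ ψ = χ := by
  have hmem : ψ ∈ fracDomain L γ := by
    have := (hasSum_coef_sq hL χ).summable
    simp_rw [h, coef_apply] at this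
    simpa only [fracDomain, mem_ofPred_eq, sq_abs] using this
  exact ⟨hmem, coef_ext hL fun n => by rw [coef_fracLaplacian hL hmem, h]⟩

/-! ### Sine coefficients of an arbitrary solution -/

theorem coef_fracIntegral {L b t : ℝ} (ht : 0 ≤ t) {w : ℝ → L2 L}
    (hw : IntegrableOn (fun s => omega b (t - s) • w s) (Ioc 0 t)) (n : ℕ) :
    coef L n (fracIntegral b w t) = fracIntegral b (fun s => coef L n (w s)) t := by
  unfold fracIntegral
  rw [← ContinuousLinearMap.intervalIntegral_comp_comm _
    ((intervalIntegrable_iff_integrableOn_Ioc_of_le ht).2 hw)]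
  simp only [map_smul]

theorem coef_primitive {L t T : ℝ} (ht : 0 ≤ t) (htT : t ≤ T) {w : ℝ → L2 L}
    (hw : IntegrableOn w (Ioc 0 T)) (n : ℕ) :
    coef L n (∫ s in (0 : ℝ)..t, w s) = ∫ s in (0 : ℝ)..t, coef L n (w s) := by
  rw [← ContinuousLinearMap.intervalIntegral_comp_comm _
    ((intervalIntegrable_iff_integrableOn_Ioc_of_le ht).2
      (hw.mono_set (Ioc_subset_Ioc_right htT)))]

theorem fracIntegral_sub {b t : ℝ} (ht : 0 ≤ t) {f g : ℝ → ℝ}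
    (hf : IntegrableOn (fun s => omega b (t - s) • f s) (Ioc 0 t))
    (hg : IntegrableOn (fun s => omega b (t - s) • g s) (Ioc 0 t)) :
    fracIntegral b (fun s => f s - g s) t = fracIntegral b f t - fracIntegral b g t := by
  have := fracIntegral_linear (x := 1) (y := -1) ht hf hg
  simp only [one_mul, neg_one_mul, ← sub_eq_add_neg] at this
  exact this

/-- The sine coefficients of every solution are the scalar modes. -/
theorem IsSolution.coef_eq {α L T : ℝ} (hα : 1 < α ∧ α < 2) (hL : 0 < L) {a₀ a₁ f : L2 L}
    {u v : ℝ → L2 L} (h : IsSolution α L T a₀ a₁ f u v) (n : ℕ) {t : ℝ} (ht : t ∈ Ioc 0 T) :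
    coef L n (u t) = modeU α (eigenvalue L n) (coef L n a₀)
      (coef L n (a₁ + Real.Gamma (2 - α) • f)) t := by
  obtain ⟨du, dv, ⟨hdu, hu⟩, ⟨hdv, hv⟩, hu0, hv0, hsys⟩ := h
  have hT : 0 ≤ T := ht.1.le.trans ht.2
  have hb : 0 < 1 - α / 2 := by linarith [hα.2]
  have hc := eigenvalue_pos hL n
  set c := eigenvalue L n with hcdef
  set a := coef L n a₀ with ha
  set b := coef L n (a₁ + Real.Gamma (2 - α) • f) with hbdef
  have hG := Real.Gamma_pos_of_pos (show 0 < 2 - α by linarith [hα.2])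
  have cdu : IntegrableOn (fun s => coef L n (du s)) (Ioc 0 T) :=
    (coef L n).integrable_comp hdu
  have cdv : IntegrableOn (fun s => coef L n (dv s)) (Ioc 0 T) :=
    (coef L n).integrable_comp hdv
  have mdu := integrableOn_modeDu hα hc a b T hT
  have mdv := integrableOn_modeDv hα hc a b T hT
  -- The difference between the coefficient of the solution and the explicit mode solves the
  -- homogeneous scalar system.
  have hmain := primitive_eq_zero_of_homogeneous (c := c) hα (cdu.sub mdu) (cdv.sub mdv) ?_ ?_ t
    ⟨ht.1.le, ht.2⟩
  · have i1 : IntervalIntegrable (fun s => coef L n (du s)) volume 0 t :=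
      (intervalIntegrable_iff_integrableOn_Ioc_of_le ht.1.le).2
        (cdu.mono_set (Ioc_subset_Ioc_right ht.2))
    have i2 : IntervalIntegrable (modeDu α c a b) volume 0 t :=
      (intervalIntegrable_iff_integrableOn_Ioc_of_le ht.1.le).2
        (mdu.mono_set (Ioc_subset_Ioc_right ht.2))
    simp only [Pi.sub_apply] at hmain
    rw [intervalIntegral.integral_sub i1 i2] at hmain
    rw [hu t ⟨ht.1.le, ht.2⟩, map_add, hu0, coef_primitive ht.1.le ht.2 hdu,
      sub_eq_zero.1 hmain, add_integral_modeDu hα hc a b ht.1]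
  · rw [ae_restrict_iff' measurableSet_Ioo] at hsys
    filter_upwards [hsys, ae_integrableOn_omega_smul hb hdu, ae_integrableOn_omega_smul hb cdu,
      ae_integrableOn_omega_smul hb mdu, integral_modeDv hα hc a b] with s hs w1 w2 w3 hm hsI
    have hsc : s ∈ Ioc 0 T := ⟨hsI.1, hsI.2.le⟩
    have hsicc : s ∈ Icc 0 T := ⟨hsI.1.le, hsI.2.le⟩
    have i1 : IntervalIntegrable (fun s => coef L n (dv s)) volume 0 s :=
      (intervalIntegrable_iff_integrableOn_Ioc_of_le hsI.1.le).2
        (cdv.mono_set (Ioc_subset_Ioc_right hsI.2.le))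
    have i2 : IntervalIntegrable (modeDv α c a b) volume 0 s :=
      (intervalIntegrable_iff_integrableOn_Ioc_of_le hsI.1.le).2
        (mdv.mono_set (Ioc_subset_Ioc_right hsI.2.le))
    have h1 := congrArg (coef L n) (hs hsI).1
    rw [coef_fracIntegral hsI.1.le (w1 hsc), hv s hsicc, hv0, zero_add,
      coef_primitive hsI.1.le hsI.2.le hdv] at h1
    simp only [Pi.sub_apply]
    rw [intervalIntegral.integral_sub i1 i2, h1, hm hsI.1]
    exact (fracIntegral_sub hsI.1.le (w2 hsc) (w3 hsc)).symm
  · rw [ae_restrict_iff' measurableSet_Ioo] at hsys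
    filter_upwards [hsys, ae_integrableOn_omega_smul hb hdv, ae_integrableOn_omega_smul hb cdv,
      ae_integrableOn_omega_smul hb mdv, fracIntegral_modeDv hα hc a b] with s hs w1 w2 w3 hm hsI
    have hsc : s ∈ Ioc 0 T := ⟨hsI.1, hsI.2.le⟩
    have hsicc : s ∈ Icc 0 T := ⟨hsI.1.le, hsI.2.le⟩
    have i1 : IntervalIntegrable (fun s => coef L n (du s)) volume 0 s :=
      (intervalIntegrable_iff_integrableOn_Ioc_of_le hsI.1.le).2
        (cdu.mono_set (Ioc_subset_Ioc_right hsI.2.le))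
    have i2 : IntervalIntegrable (modeDu α c a b) volume 0 s :=
      (intervalIntegrable_iff_integrableOn_Ioc_of_le hsI.1.le).2
        (mdu.mono_set (Ioc_subset_Ioc_right hsI.2.le))
    obtain ⟨w, hw, heq⟩ := (hs hsI).2
    have h1 := congrArg (coef L n) heq
    have hwn := hw.inner_eq hL n
    rw [← coef_apply, ← coef_apply, ← hcdef] at hwn
    rw [map_sub, coef_fracIntegral hsI.1.le (w1 hsc), hwn, hu s hsicc, hu0, map_add,
      coef_primitive hsI.1.le hsI.2.le hdu, map_add, map_smul, map_smul, smul_eq_mul,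
      smul_eq_mul] at h1
    -- Since s^(1-α) = Γ(2-α) ω_{2-α}(s), the source f acts exactly like additional initial
    -- velocity.
    have hrhs : omega (2 - α) s * coef L n a₁ + s ^ (1 - α) * coef L n f =
        b * omega (2 - α) s := by
      rw [hbdef, map_add, map_smul, omega, smul_eq_mul, show 2 - α - 1 = 1 - α by ring]
      field_simp
    rw [hrhs] at h1
    have h2 := fracIntegral_sub hsI.1.le (w2 hsc) (w3 hsc)
    simp only [Pi.sub_def]
    rw [intervalIntegral.integral_sub i1 i2, h2, hm hsI.1,
      ← add_integral_modeDu hα hc a b hsI.1]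
    linear_combination h1

/-! ### Uniform multiplier bounds and the time estimates -/

theorem eigenvalue_rpow_le {L δ : ℝ} (hL : 0 < L) (hδ : δ ≤ 0) (n : ℕ) :
    eigenvalue L n ^ δ ≤ eigenvalue L 0 ^ δ := by
  refine Real.rpow_le_rpow_of_nonpos (eigenvalue_pos hL 0) ?_ hδ
  unfold eigenvalue
  have := Real.pi_pos
  gcongr
  simp

/-- The multipliers of the `k`-th time derivative of the part of `u` due to `a₀`. -/
noncomputable def multZero (α L δ : ℝ) (k n : ℕ) (t : ℝ) : ℝ :=
  eigenvalue L n ^ δ * (freq α (eigenvalue L n) ^ k *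
    relaxationDeriv α (k + 1) (freq α (eigenvalue L n) * t))

/-- The multipliers of the `k`-th time derivative of the part of `u` due to `a₁` and `f`. -/
noncomputable def multOne (α L δ : ℝ) (k n : ℕ) (t : ℝ) : ℝ :=
  eigenvalue L n ^ δ * (freq α (eigenvalue L n) ^ ((k : ℝ) - 1) *
    relaxationDeriv α k (freq α (eigenvalue L n) * t))

theorem hasDerivAt_relaxationDeriv_comp {α c : ℝ} (hα : 1 < α ∧ α < 2) (hc : 0 < c) (k : ℕ) {t : ℝ}
    (ht : 0 < t) : HasDerivAt (fun t => relaxationDeriv α k (c * t))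
      (c * relaxationDeriv α (k + 1) (c * t)) t := by
  have h1 := hasDerivAt_relaxationDeriv hα k (mul_pos hc ht)
  have h2 := h1.comp t ((hasDerivAt_id t).const_mul c)
  exact h2.congr_deriv (by ring)

/-- The effect of rescaling time by the frequency on a power-law bound. -/
theorem scaled_bound {α c r C x y : ℝ} {g : ℝ → ℝ} (hc : 0 < c)
    (hg : ∀ t, 0 < t → |g t| ≤ C * t ^ y) (t : ℝ) (ht : 0 < t) :
    |c ^ x * (freq α c ^ r * g (freq α c * t))| ≤ c ^ (x + (r + y) / α) * (C * t ^ y) := by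
  have hl := freq_pos (α := α) hc
  have h1 := hg _ (mul_pos hl ht)
  rw [Real.mul_rpow hl.le ht.le] at h1
  rw [abs_mul, abs_mul, abs_of_pos (Real.rpow_pos_of_pos hc x),
    abs_of_pos (Real.rpow_pos_of_pos hl r)]
  calc c ^ x * (freq α c ^ r * |g (freq α c * t)|)
      ≤ c ^ x * (freq α c ^ r * (C * (freq α c ^ y * t ^ y))) := by
        have := Real.rpow_pos_of_pos hc x
        have := Real.rpow_pos_of_pos hl r
        gcongr
    _ = c ^ x * (freq α c ^ r * freq α c ^ y) * (C * t ^ y) := by ring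
    _ = _ := by rw [← Real.rpow_add hl, freq_rpow hc, ← Real.rpow_add hc]

section families

variable {α L : ℝ} (hα : 1 < α ∧ α < 2) (hL : 0 < L)
include hα hL

theorem hasDerivAt_multZero (δ : ℝ) (k n : ℕ) (t : ℝ) (ht : 0 < t) :
    HasDerivAt (multZero α L δ k n) (multZero α L δ (k + 1) n t) t := by
  have hl := freq_pos (α := α) (eigenvalue_pos hL n)
  have := ((hasDerivAt_relaxationDeriv_comp hα hl (k + 1) ht).const_mul
    (freq α (eigenvalue L n) ^ k)).const_mul (eigenvalue L n ^ δ)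
  exact this.congr_deriv (by rw [multZero, pow_succ]; ring)

theorem hasDerivAt_multOne (δ : ℝ) (k n : ℕ) (t : ℝ) (ht : 0 < t) :
    HasDerivAt (multOne α L δ k n) (multOne α L δ (k + 1) n t) t := by
  have hl := freq_pos (α := α) (eigenvalue_pos hL n)
  have := ((hasDerivAt_relaxationDeriv_comp hα hl k ht).const_mul
    (freq α (eigenvalue L n) ^ ((k : ℝ) - 1))).const_mul (eigenvalue L n ^ δ)
  refine this.congr_deriv ?_
  rw [multOne, show ((k + 1 : ℕ) : ℝ) - 1 = ((k : ℝ) - 1) + 1 by push_cast; ring,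
    Real.rpow_add_one hl.ne']
  ring

/-- Rescaling leaves the frequency to the power -α/4 at every order k, that is λ^(δ - 1/4), which is
largest at the first eigenvalue. -/
theorem abs_multOne_le {δ : ℝ} (hδ : δ < 1 / 4) (k : ℕ) : ∃ C : ℝ, 0 < C ∧ ∀ n t, 0 < t →
    |multOne α L δ k n t| ≤ C * (1 + t ^ (1 - (k : ℝ) - α / 4)) := by
  obtain ⟨C, hC, h⟩ := abs_relaxationDeriv_le hα k
  have hα0 : 0 < α := by linarith [hα.1]
  refine ⟨eigenvalue L 0 ^ (δ - 1 / 4) * C,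
    mul_pos (Real.rpow_pos_of_pos (eigenvalue_pos hL 0) _) hC, fun n t ht => ?_⟩
  have h1 := scaled_bound (α := α) (x := δ) (r := (k : ℝ) - 1) (eigenvalue_pos hL n) h t ht
  rw [show δ + ((k : ℝ) - 1 + (1 - (k : ℝ) - α / 4)) / α = δ - 1 / 4 by field_simp; ring] at h1
  have h2 := eigenvalue_rpow_le hL (show δ - 1 / 4 ≤ 0 by linarith) n
  have h3 := Real.rpow_pos_of_pos ht (1 - (k : ℝ) - α / 4)
  have h4 := Real.rpow_pos_of_pos (eigenvalue_pos hL 0) (δ - 1 / 4)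
  calc |multOne α L δ k n t| ≤ eigenvalue L n ^ (δ - 1 / 4) *
        (C * t ^ (1 - (k : ℝ) - α / 4)) := h1
    _ ≤ eigenvalue L 0 ^ (δ - 1 / 4) * (C * t ^ (1 - (k : ℝ) - α / 4)) := by gcongr
    _ ≤ eigenvalue L 0 ^ (δ - 1 / 4) * (C * (1 + t ^ (1 - (k : ℝ) - α / 4))) := by
      gcongr
      linarith
    _ = _ := by ring

/-- For k ≥ 1 rescaling leaves λ^(δ + 1/α - 1/4). For k = 0 no power of t is needed: the mode is
bounded, δ is negative, and the summand 1 in the time bound takes it. -/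
theorem abs_multZero_le {δ : ℝ} (hδ : δ < 1 / 4 - 1 / α) (k : ℕ) : ∃ C : ℝ, 0 < C ∧
    ∀ n t, 0 < t → |multZero α L δ k n t| ≤ C * (1 + t ^ (1 - (k : ℝ) - α / 4)) := by
  have hα0 : 0 < α := by linarith [hα.1]
  have hinv : 1 / 4 < 1 / α := by
    rw [div_lt_div_iff₀ (by norm_num) hα0]
    linarith [hα.2]
  cases k with
  | zero =>
    obtain ⟨C, hC, h⟩ := abs_relaxation_le hα
    refine ⟨eigenvalue L 0 ^ δ * C,
      mul_pos (Real.rpow_pos_of_pos (eigenvalue_pos hL 0) _) hC, fun n t ht => ?_⟩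
    have h2 := eigenvalue_rpow_le hL (show δ ≤ 0 by linarith) n
    have h3 := Real.rpow_pos_of_pos ht (1 - ((0 : ℕ) : ℝ) - α / 4)
    have h4 := Real.rpow_pos_of_pos (eigenvalue_pos hL 0) δ
    have h5 := Real.rpow_pos_of_pos (eigenvalue_pos hL n) δ
    rw [multZero, pow_zero, one_mul, abs_mul, abs_of_pos h5]
    calc eigenvalue L n ^ δ * |relaxationDeriv α (0 + 1) (freq α (eigenvalue L n) * t)|
        ≤ eigenvalue L 0 ^ δ * C := by
          gcongr
          exact h _ (mul_pos (freq_pos (eigenvalue_pos hL n)) ht)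
      _ ≤ eigenvalue L 0 ^ δ * C * (1 + t ^ (1 - ((0 : ℕ) : ℝ) - α / 4)) :=
          le_mul_of_one_le_right (by positivity) (by linarith)
  | succ k =>
    obtain ⟨C, hC, h⟩ := abs_relaxationDeriv_le_add_two hα k
    set η : ℝ := δ + (1 / α - 1 / 4) with hη
    refine ⟨eigenvalue L 0 ^ η * C,
      mul_pos (Real.rpow_pos_of_pos (eigenvalue_pos hL 0) _) hC, fun n t ht => ?_⟩
    have h1 := scaled_bound (α := α) (x := δ) (r := ((k + 1 : ℕ) : ℝ)) (eigenvalue_pos hL n) h t ht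
    rw [show δ + (((k + 1 : ℕ) : ℝ) + (1 - ((k + 1 : ℕ) : ℝ) - α / 4)) / α = η by
      rw [hη]; field_simp; ring, Real.rpow_natCast] at h1
    have h2 := eigenvalue_rpow_le hL (show η ≤ 0 by linarith) n
    have h3 := Real.rpow_pos_of_pos ht (1 - ((k + 1 : ℕ) : ℝ) - α / 4)
    have h4 := Real.rpow_pos_of_pos (eigenvalue_pos hL 0) η
    calc |multZero α L δ (k + 1) n t| ≤ eigenvalue L n ^ η *
          (C * t ^ (1 - ((k + 1 : ℕ) : ℝ) - α / 4)) := h1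
      _ ≤ eigenvalue L 0 ^ η * (C * t ^ (1 - ((k + 1 : ℕ) : ℝ) - α / 4)) := by gcongr
      _ ≤ eigenvalue L 0 ^ η * (C * (1 + t ^ (1 - ((k + 1 : ℕ) : ℝ) - α / 4))) := by
        gcongr
        linarith
      _ = _ := by ring

omit hα hL in
theorem continuousOn_timeBound (C y : ℝ) : ContinuousOn (fun t : ℝ => C * (1 + t ^ y)) (Ioi 0) :=
  continuousOn_const.mul (continuousOn_const.add fun _ ht =>
    (Real.continuousAt_rpow_const _ _ (Or.inl (ne_of_gt ht))).continuousWithinAt)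

/-- Apply the multipliers with δ = σ - γ and δ = σ - γ' to (-Δ)^γ a₀ and to (-Δ)^γ' of a₁ + Γ(2-α)
f. The bounds hold on all of (0, ∞), so the constant does not involve T. -/
theorem hasTimeBounds_of_isSolution {σ γ γ' : ℝ} (hγ : σ - γ < 1 / 4 - 1 / α)
    (hγ' : σ - γ' < 1 / 4) : ∃ C : ℝ, 0 < C ∧ ∀ (T : ℝ) (a₀ a₁ f : L2 L),
      a₀ ∈ fracDomain L γ → a₁ ∈ fracDomain L γ' → f ∈ fracDomain L γ' →
      ∀ u v : ℝ → L2 L, IsSolution α L T a₀ a₁ f u v → HasTimeBounds α L T σ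
        (C * (‖fracLaplacian L γ a₀‖ + ‖fracLaplacian L γ' a₁‖ + ‖fracLaplacian L γ' f‖)) u := by
  choose A hA hAb using abs_multZero_le hα hL hγ
  choose B hB hBb using abs_multOne_le hα hL hγ'
  set Γ := Real.Gamma (2 - α) with hΓ
  have hG : 0 < Γ := Real.Gamma_pos_of_pos (by linarith [hα.2])
  -- The sum dominates the constant of each order m = 0, 1, 2, 3; 1 + Γ absorbs the weight of f.
  refine ⟨∑ k ∈ Finset.range 4, (A k + B k * (1 + Γ)), ?_, ?_⟩
  · exact Finset.sum_pos (fun k _ => by have := hA k; have := hB k; positivity) (by simp)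
  intro T a₀ a₁ f h₀ h₁ hf u v hsol
  set ψ₀ := fracLaplacian L γ a₀ with hψ₀
  set ψ₁ := fracLaplacian L γ' a₁ + Γ • fracLaplacian L γ' f with hψ₁
  set F : ℕ → ℝ → L2 L := fun k t => diagMul L (fun n => multZero α L (σ - γ) k n t) ψ₀ +
    diagMul L (fun n => multOne α L (σ - γ') k n t) ψ₁ with hF
  have famA : ∀ k, BoundedFamily (multZero α L (σ - γ) k)
      (fun t => A k * (1 + t ^ (1 - (k : ℝ) - α / 4))) := fun k =>
    ⟨continuousOn_timeBound _ _, fun n t ht => hAb k n t ht⟩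
  have famB : ∀ k, BoundedFamily (multOne α L (σ - γ') k)
      (fun t => B k * (1 + t ^ (1 - (k : ℝ) - α / 4))) := fun k =>
    ⟨continuousOn_timeBound _ _, fun n t ht => hBb k n t ht⟩
  have hFd : ∀ k t, 0 < t → HasDerivAt (F k) (F (k + 1) t) t := fun k t ht =>
    (hasDerivAt_diagMul hL (famA k) (famA (k + 1)) (hasDerivAt_multZero hα hL _ k) ψ₀ ht).add
      (hasDerivAt_diagMul hL (famB k) (famB (k + 1)) (hasDerivAt_multOne hα hL _ k) ψ₁ ht)
  have hu : ∀ t ∈ Ioc 0 T, u t ∈ fracDomain L σ ∧ fracLaplacian L σ (u t) = F 0 t := by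
    intro t ht
    refine mem_fracDomain_of_coef hL fun n => ?_
    have hc := eigenvalue_pos hL n
    rw [hsol.coef_eq hα hL n ht, hF]
    simp only [map_add]
    rw [coef_diagMul hL (fun n => (famA 0).le_bound n t ht.1),
      coef_diagMul hL (fun n => (famB 0).le_bound n t ht.1), hψ₀, hψ₁, map_add, map_smul,
      coef_fracLaplacian hL h₀, coef_fracLaplacian hL h₁, coef_fracLaplacian hL hf, modeU, multZero,
      multOne, Real.rpow_sub hc, Real.rpow_sub hc, map_smul, smul_eq_mul, smul_eq_mul, pow_zero,
      show ((0 : ℕ) : ℝ) - 1 = -1 by norm_num, Real.rpow_neg_one,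
      ← hΓ]
    have := (Real.rpow_pos_of_pos hc γ).ne'
    have := (Real.rpow_pos_of_pos hc γ').ne'
    field_simp
  have huniq : UniqueDiffOn ℝ (Ioc 0 T) := uniqueDiffOn_Ioc 0 T
  have hiter : ∀ k : ℕ, ∀ t ∈ Ioc 0 T,
      iteratedDerivWithin k (fun t => fracLaplacian L σ (u t)) (Ioc 0 T) t = F k t := by
    intro k
    induction k with
    | zero =>
      intro t ht
      rw [iteratedDerivWithin_zero]
      exact (hu t ht).2
    | succ k ih =>
      intro t ht
      rw [iteratedDerivWithin_succ, derivWithin_congr ih (ih t ht)]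
      exact (hFd k t ht.1).hasDerivWithinAt.derivWithin (huniq t ht)
  refine ⟨fun t ht => (hu t ht).1, ?_, fun m hm t ht => ?_⟩
  · refine contDiffOn_of_differentiableOn_deriv (n := 3) fun m _ => ?_
    exact DifferentiableOn.congr (f := F m)
      (fun t ht => (hFd m t ht.1).differentiableAt.differentiableWithinAt) (hiter m)
  · rw [hiter m t ht]
    have h1 := norm_diagMul_le hL (fun n => (famA m).le_bound n t ht.1) ψ₀
    have h2 := norm_diagMul_le hL (fun n => (famB m).le_bound n t ht.1) ψ₁
    have h3 : ‖ψ₁‖ ≤ ‖fracLaplacian L γ' a₁‖ + Γ * ‖fracLaplacian L γ' f‖ := by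
      refine (norm_add_le _ _).trans ?_
      rw [norm_smul, Real.norm_of_nonneg hG.le]
    have h4 : A m + B m * (1 + Γ) ≤ ∑ k ∈ Finset.range 4, (A k + B k * (1 + Γ)) :=
      Finset.single_le_sum (f := fun k => A k + B k * (1 + Γ))
        (fun k _ => by have := hA k; have := hB k; positivity) (Finset.mem_range.2 (by omega))
    set X := 1 + t ^ (1 - (m : ℝ) - α / 4) with hX
    have hX0 : 0 < X := by
      have := Real.rpow_pos_of_pos ht.1 (1 - (m : ℝ) - α / 4)
      linarith
    have hAm := hA m
    have hBm := hB m
    set x := ‖ψ₀‖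
    set y := ‖fracLaplacian L γ' a₁‖
    set z := ‖fracLaplacian L γ' f‖
    have hx : 0 ≤ x := norm_nonneg _
    have hy : 0 ≤ y := norm_nonneg _
    have hz : 0 ≤ z := norm_nonneg _
    calc ‖F m t‖ ≤ A m * X * x + B m * X * ‖ψ₁‖ := (norm_add_le _ _).trans (add_le_add h1 h2)
      _ ≤ A m * X * x + B m * X * (y + Γ * z) := by gcongr
      _ ≤ (A m + B m * (1 + Γ)) * (x + y + z) * X := by
        have e : (A m + B m * (1 + Γ)) * (x + y + z) * X - (A m * X * x + B m * X * (y + Γ * z)) =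
            (A m * (y + z) + B m * (x + z) + B m * Γ * (x + y)) * X := by ring
        have : 0 ≤ (A m * (y + z) + B m * (x + z) + B m * Γ * (x + y)) * X := by positivity
        linarith
      _ ≤ _ := by gcongr

end families

theorem HasTimeBounds.mono {α L T σ K K' : ℝ} {u : ℝ → L2 L} (h : HasTimeBounds α L T σ K u)
    (hK : K ≤ K') : HasTimeBounds α L T σ K' u := by
  refine ⟨h.1, h.2.1, fun m hm t ht => (h.2.2 m hm t ht).trans ?_⟩
  have := Real.rpow_pos_of_pos ht.1 (1 - (m : ℝ) - α / 4)
  gcongr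

/-! ### Existence -/

/-- The multipliers of `∂ₜ v` due to `a₀`. -/
noncomputable def multDvZero (α L δ : ℝ) (n : ℕ) (t : ℝ) : ℝ :=
  eigenvalue L n ^ δ * (freq α (eigenvalue L n) ^ (1 + α / 2) *
    -rayTransform α (α / 2) (freq α (eigenvalue L n) * t))

/-- The multipliers of `∂ₜ v` due to `a₁` and `f`. -/
noncomputable def multDvOne (α L δ : ℝ) (n : ℕ) (t : ℝ) : ℝ :=
  eigenvalue L n ^ δ * (freq α (eigenvalue L n) ^ (α / 2) *
    rayTransform α (3 * (α / 2) - 1) (freq α (eigenvalue L n) * t))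

section existence

variable {α L : ℝ} (hα : 1 < α ∧ α < 2) (hL : 0 < L)
include hα hL

/-- With κ = 1 the time factor is t^(-α/2), integrable at 0 because α < 2, at the cost of λ^(1/α).
-/
theorem abs_multDvZero_le {δ : ℝ} (hδ : δ ≤ -(1 / α)) : ∃ C : ℝ, 0 < C ∧ ∀ n t, 0 < t →
    |multDvZero α L δ n t| ≤ C * t ^ (-(α / 2)) := by
  have hα0 : 0 < α := by linarith [hα.1]
  obtain ⟨C, hC, h⟩ := abs_rayTransform_le (q := α / 2) (κ := 1) hα zero_le_one hα.1.le
    (by linarith)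
  have h' : ∀ t, 0 < t → |-rayTransform α (α / 2) t| ≤ C * t ^ (-(α / 2)) := fun t ht => by
    have := h t ht
    rwa [show 1 - α / 2 - 1 = -(α / 2) by ring, ← abs_neg] at this
  refine ⟨eigenvalue L 0 ^ (δ + 1 / α) * C,
    mul_pos (Real.rpow_pos_of_pos (eigenvalue_pos hL 0) _) hC, fun n t ht => ?_⟩
  have h1 := scaled_bound (α := α) (x := δ) (r := 1 + α / 2) (eigenvalue_pos hL n) h' t ht
  rw [show δ + (1 + α / 2 + -(α / 2)) / α = δ + 1 / α by ring] at h1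
  have h2 := eigenvalue_rpow_le hL (show δ + 1 / α ≤ 0 by linarith) n
  refine h1.trans ?_
  rw [mul_assoc]
  have := Real.rpow_pos_of_pos ht (-(α / 2))
  gcongr

/-- With κ = α the same time factor t^(-α/2) costs no power of λ. -/
theorem abs_multDvOne_le {δ : ℝ} (hδ : δ ≤ 0) : ∃ C : ℝ, 0 < C ∧ ∀ n t, 0 < t →
    |multDvOne α L δ n t| ≤ C * t ^ (-(α / 2)) := by
  have hα0 : 0 < α := by linarith [hα.1]
  obtain ⟨C, hC, h⟩ := abs_rayTransform_le (q := 3 * (α / 2) - 1) (κ := α) hα hα0.le le_rfl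
    (by linarith)
  have h' : ∀ t, 0 < t → |rayTransform α (3 * (α / 2) - 1) t| ≤ C * t ^ (-(α / 2)) :=
    fun t ht => by
      have := h t ht
      rwa [show α - (3 * (α / 2) - 1) - 1 = -(α / 2) by ring] at this
  refine ⟨eigenvalue L 0 ^ δ * C,
    mul_pos (Real.rpow_pos_of_pos (eigenvalue_pos hL 0) _) hC, fun n t ht => ?_⟩
  have h1 := scaled_bound (α := α) (x := δ) (r := α / 2) (eigenvalue_pos hL n) h' t ht
  rw [show δ + (α / 2 + -(α / 2)) / α = δ by ring] at h1
  have h2 := eigenvalue_rpow_le hL hδ n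
  refine h1.trans ?_
  rw [mul_assoc]
  have := Real.rpow_pos_of_pos ht (-(α / 2))
  gcongr

omit hα in
theorem integrableOn_diagMul_add {m m' : ℕ → ℝ → ℝ} {B B' y T : ℝ} (hy : -1 < y) (hT : 0 ≤ T)
    (h : BoundedFamily m fun t => B * (1 + t ^ y)) (h' : BoundedFamily m' fun t => B' * (1 + t ^ y))
    (hc : ∀ n, ContinuousOn (m n) (Ioi 0)) (hc' : ∀ n, ContinuousOn (m' n) (Ioi 0)) (ψ χ : L2 L) :
    IntegrableOn (fun t => diagMul L (fun n => m n t) ψ + diagMul L (fun n => m' n t) χ)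
      (Ioc 0 T) := by
  have hcont := (continuousOn_diagMul hL h hc ψ).add (continuousOn_diagMul hL h' hc' χ)
  have hi : IntegrableOn (fun t : ℝ => B * (1 + t ^ y) * ‖ψ‖ + B' * (1 + t ^ y) * ‖χ‖)
      (Ioc 0 T) := by
    have h1 : IntegrableOn (fun t : ℝ => 1 + t ^ y) (Ioc 0 T) :=
      (intervalIntegrable_iff_integrableOn_Ioc_of_le hT).1
        (intervalIntegrable_const.add (intervalIntegral.intervalIntegrable_rpow' hy))
    exact ((h1.const_mul B).mul_const _).add ((h1.const_mul B').mul_const _)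
  refine Integrable.mono' hi
    ((hcont.mono Ioc_subset_Ioi_self).aestronglyMeasurable measurableSet_Ioc) ?_
  filter_upwards [ae_restrict_mem measurableSet_Ioc] with t ht
  exact (norm_add_le _ _).trans (add_le_add
    (norm_diagMul_le hL (fun n => h.le_bound n t ht.1) ψ)
    (norm_diagMul_le hL (fun n => h'.le_bound n t ht.1) χ))

/-- The series for u' and v' are summed first, as integrable functions of time, and u, v are their
primitives; the equations are then checked on each sine coefficient. -/
theorem exists_isSolution {γ γ' T : ℝ} (hγ : 1 / α ≤ γ) (hγ' : 0 ≤ γ') (hT : 0 < T)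
    {a₀ a₁ f : L2 L} (h₀ : a₀ ∈ fracDomain L γ) (h₁ : a₁ ∈ fracDomain L γ')
    (hf : f ∈ fracDomain L γ') : ∃ u v : ℝ → L2 L, IsSolution α L T a₀ a₁ f u v := by
  have hα0 : 0 < α := by linarith [hα.1]
  have hb : 0 < 1 - α / 2 := by linarith [hα.2]
  set Γ := Real.Gamma (2 - α) with hΓ
  have hG : 0 < Γ := Real.Gamma_pos_of_pos (by linarith [hα.2])
  set ψ₀ := fracLaplacian L γ a₀ with hψ₀
  set ψ₁ := fracLaplacian L γ' a₁ + Γ • fracLaplacian L γ' f with hψ₁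
  obtain ⟨A, hA, hAb⟩ := abs_multZero_le hα hL (δ := -γ) (by linarith) 1
  obtain ⟨B, hB, hBb⟩ := abs_multOne_le hα hL (δ := -γ') (by linarith) 1
  obtain ⟨A', hA', hAb'⟩ := abs_multDvZero_le hα hL (δ := -γ) (by linarith)
  obtain ⟨B', hB', hBb'⟩ := abs_multDvOne_le hα hL (δ := -γ') (by linarith)
  have famA : BoundedFamily (multZero α L (-γ) 1) _ := ⟨continuousOn_timeBound _ _, hAb⟩
  have famB : BoundedFamily (multOne α L (-γ') 1) _ := ⟨continuousOn_timeBound _ _, hBb⟩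
  have famA' : BoundedFamily (multDvZero α L (-γ)) (fun t => A' * (1 + t ^ (-(α / 2)))) :=
    ⟨continuousOn_timeBound _ _, fun n t ht => (hAb' n t ht).trans (by gcongr; linarith)⟩
  have famB' : BoundedFamily (multDvOne α L (-γ')) (fun t => B' * (1 + t ^ (-(α / 2)))) :=
    ⟨continuousOn_timeBound _ _, fun n t ht => (hBb' n t ht).trans (by gcongr; linarith)⟩
  have hcomp : ∀ q : ℝ, -1 < q → ∀ n, ContinuousOn
      (fun t => rayTransform α q (freq α (eigenvalue L n) * t)) (Ioi 0) := fun q hq n =>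
    (continuousOn_rayTransform hα hq).comp (by fun_prop) fun t ht =>
      mul_pos (freq_pos (eigenvalue_pos hL n)) ht
  set du : ℝ → L2 L := fun t => diagMul L (fun n => multZero α L (-γ) 1 n t) ψ₀ +
    diagMul L (fun n => multOne α L (-γ') 1 n t) ψ₁ with hdu
  set dv : ℝ → L2 L := fun t => diagMul L (fun n => multDvZero α L (-γ) n t) ψ₀ +
    diagMul L (fun n => multDvOne α L (-γ') n t) ψ₁ with hdv
  have idu : IntegrableOn du (Ioc 0 T) :=
    integrableOn_diagMul_add hL (by push_cast; linarith [hα.2]) hT.le famA famB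
      (fun n t ht => (hasDerivAt_multZero hα hL _ 1 n t ht).continuousAt.continuousWithinAt)
      (fun n t ht => (hasDerivAt_multOne hα hL _ 1 n t ht).continuousAt.continuousWithinAt) ψ₀ ψ₁
  have idv : IntegrableOn dv (Ioc 0 T) :=
    integrableOn_diagMul_add hL (by linarith [hα.2]) hT.le famA' famB'
      (fun n => continuousOn_const.mul (continuousOn_const.mul
        (hcomp _ (by linarith [hα.1]) n).neg))
      (fun n => continuousOn_const.mul (continuousOn_const.mul
        (hcomp _ (by linarith [hα.1]) n))) ψ₀ ψ₁
  set b : ℕ → ℝ := fun n => coef L n (a₁ + Γ • f) with hbdef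
  have hcψ₀ : ∀ n, coef L n ψ₀ = eigenvalue L n ^ γ * coef L n a₀ := coef_fracLaplacian hL h₀
  have hcψ₁ : ∀ n, coef L n ψ₁ = eigenvalue L n ^ γ' * b n := fun n => by
    rw [hψ₁, map_add, map_smul, coef_fracLaplacian hL h₁, coef_fracLaplacian hL hf, hbdef]
    simp only [map_add, map_smul, smul_eq_mul]
    ring
  have hcdu : ∀ n t, 0 < t →
      coef L n (du t) = modeDu α (eigenvalue L n) (coef L n a₀) (b n) t := by
    intro n t ht
    have hc := eigenvalue_pos hL n
    rw [hdu]
    simp only [map_add]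
    rw [coef_diagMul hL (fun n => famA.le_bound n t ht),
      coef_diagMul hL (fun n => famB.le_bound n t ht), hcψ₀, hcψ₁, multZero, multOne, modeDu,
      Real.rpow_neg hc.le, Real.rpow_neg hc.le, pow_one, Nat.cast_one, sub_self, Real.rpow_zero]
    have := (Real.rpow_pos_of_pos hc γ).ne'
    have := (Real.rpow_pos_of_pos hc γ').ne'
    field_simp
  have hcdv : ∀ n t, 0 < t →
      coef L n (dv t) = modeDv α (eigenvalue L n) (coef L n a₀) (b n) t := by
    intro n t ht
    have hc := eigenvalue_pos hL n
    rw [hdv]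
    simp only [map_add]
    rw [coef_diagMul hL (fun n => famA'.le_bound n t ht),
      coef_diagMul hL (fun n => famB'.le_bound n t ht), hcψ₀, hcψ₁, multDvZero, multDvOne, modeDv,
      Real.rpow_neg hc.le, Real.rpow_neg hc.le]
    have := (Real.rpow_pos_of_pos hc γ).ne'
    have := (Real.rpow_pos_of_pos hc γ').ne'
    field_simp
  have hprim : ∀ {w : ℝ → L2 L} {g : ℝ → ℝ} (n : ℕ) {t : ℝ}, t ∈ Ioo 0 T →
      IntegrableOn w (Ioc 0 T) → (∀ t, 0 < t → coef L n (w t) = g t) →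
      coef L n (∫ s in (0 : ℝ)..t, w s) = ∫ s in (0 : ℝ)..t, g s := by
    intro w g n t ht hw hg
    rw [coef_primitive ht.1.le ht.2.le hw]
    refine intervalIntegral.integral_congr_ae (Eventually.of_forall fun s hs => ?_)
    rw [uIoc_of_le ht.1.le] at hs
    exact hg s hs.1
  have hfrac : ∀ {w : ℝ → L2 L} {g : ℝ → ℝ} (n : ℕ) {t : ℝ}, t ∈ Ioo 0 T →
      IntegrableOn (fun s => omega (1 - α / 2) (t - s) • w s) (Ioc 0 t) →
      (∀ t, 0 < t → coef L n (w t) = g t) →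
      coef L n (fracIntegral (1 - α / 2) w t) = fracIntegral (1 - α / 2) g t := by
    intro w g n t ht hw hg
    rw [coef_fracIntegral ht.1.le hw]
    refine intervalIntegral.integral_congr_ae (Eventually.of_forall fun s hs => ?_)
    rw [uIoc_of_le ht.1.le] at hs
    beta_reduce
    rw [hg s hs.1]
  refine ⟨fun t => a₀ + ∫ s in (0 : ℝ)..t, du s, fun t => ∫ s in (0 : ℝ)..t, dv s, du, dv,
    ⟨idu, fun t _ => by simp⟩, ⟨idv, fun t _ => by simp⟩, by simp, by simp, ?_⟩
  rw [ae_restrict_iff' measurableSet_Ioo]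
  -- Countably many modes: the exceptional null sets of times are united.
  have hm1 := ae_all_iff.2 fun n =>
    integral_modeDv hα (eigenvalue_pos hL n) (coef L n a₀) (b n)
  have hm2 := ae_all_iff.2 fun n =>
    fracIntegral_modeDv hα (eigenvalue_pos hL n) (coef L n a₀) (b n)
  filter_upwards [hm1, hm2, ae_integrableOn_omega_smul hb idu, ae_integrableOn_omega_smul hb idv]
    with t e1 e2 w1 w2 ht
  have htc : t ∈ Ioc 0 T := ⟨ht.1, ht.2.le⟩
  -- The candidate for u_xx is dictated by the equation; what remains is that its coefficients are
  -- -λₙ times those of u(t).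
  refine ⟨coef_ext hL fun n => ?_, fracIntegral (1 - α / 2) dv t -
    (omega (2 - α) t • a₁ + t ^ (1 - α) • f), ?_, by abel⟩
  · rw [hprim n ht idv (hcdv n), hfrac n ht (w1 htc) (hcdu n), e1 n ht.1]
  · refine hasDirichletLaplacian_of_inner_eq hL fun n => ?_
    rw [← coef_apply, ← coef_apply, map_sub, hfrac n ht (w2 htc) (hcdv n), e2 n ht.1, map_add,
      map_add, hprim n ht idu (hcdu n), add_integral_modeDu hα (eigenvalue_pos hL n) _ _ ht.1,
      map_smul, map_smul, hbdef]
    simp only [map_add, map_smul, smul_eq_mul, omega, show 2 - α - 1 = 1 - α by ring, ← hΓ]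
    field_simp
    ring

end existence

end DiffusionWave

/-! ### The theorem -/

theorem lemma3p3 (α L γ₁ γ₂ ε : ℝ) (hα : 1 < α ∧ α < 2) (hL : 0 < L)
    (hγ₁ : γ₁ ∈ Set.Ioc (1 / α + 1 / 4) (3 / 2)) (hγ₂ : γ₂ ∈ Set.Ioc (1 / 4) 1) (hε : 0 < ε) :
    ∃ C : ℝ, 0 < C ∧ ∀ T : ℝ, 0 < T → ∀ a₀ a₁ f : L2 L,
      (a₀ ∈ fracDomain L (γ₁ + ε) → a₁ ∈ fracDomain L (γ₂ + ε) → f ∈ fracDomain L (γ₂ + ε) →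
        (∃ u v : ℝ → L2 L, IsSolution α L T a₀ a₁ f u v) ∧
        ∀ u v : ℝ → L2 L, IsSolution α L T a₀ a₁ f u v →
          HasTimeBounds α L T (1 / 2)
            (C * (‖fracLaplacian L (γ₁ + ε) a₀‖ + ‖fracLaplacian L (γ₂ + ε) a₁‖ +
              ‖fracLaplacian L (γ₂ + ε) f‖)) u) ∧
      (a₀ ∈ fracDomain L (γ₁ + ε + 1 / 2) → a₁ ∈ fracDomain L (γ₂ + ε + 1 / 2) →
        f ∈ fracDomain L (γ₂ + ε + 1 / 2) →
        ∀ u v : ℝ → L2 L, IsSolution α L T a₀ a₁ f u v →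
          HasTimeBounds α L T 1
            (C * (‖fracLaplacian L (γ₁ + ε + 1 / 2) a₀‖ + ‖fracLaplacian L (γ₂ + ε + 1 / 2) a₁‖ +
              ‖fracLaplacian L (γ₂ + ε + 1 / 2) f‖)) u) := by
  -- With σ = 1/2 the two conditions read γ₁ + ε > 1/α + 1/4 and γ₂ + ε > 1/4. Raising σ and both
  -- exponents by 1/2 leaves the differences, hence the conditions, unchanged.
  obtain ⟨C, hC, h⟩ := hasTimeBounds_of_isSolution hα hL (σ := 1 / 2) (γ := γ₁ + ε)
    (γ' := γ₂ + ε) (by linarith [hγ₁.1]) (by linarith [hγ₂.1])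
  obtain ⟨D, hD, h'⟩ := hasTimeBounds_of_isSolution hα hL (σ := 1) (γ := γ₁ + ε + 1 / 2)
    (γ' := γ₂ + ε + 1 / 2) (by linarith [hγ₁.1]) (by linarith [hγ₂.1])
  refine ⟨max C D, lt_max_of_lt_left hC, fun T hT a₀ a₁ f => ⟨fun h₀ h₁ hf => ⟨?_, ?_⟩, ?_⟩⟩
  · exact exists_isSolution hα hL (by linarith [hγ₁.1]) (by linarith [hγ₂.1]) hT h₀ h₁ hf
  · intro u v hsol
    refine (h T a₀ a₁ f h₀ h₁ hf u v hsol).mono ?_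
    gcongr
    exact le_max_left _ _
  · intro h₀ h₁ hf u v hsol
    refine (h' T a₀ a₁ f h₀ h₁ hf u v hsol).mono ?_
    gcongr
    exact le_max_right _ _
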